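/- **Setting.** Let $J_1,\dots,J_N:\mathbb R^M\to\mathbb R$ ($N\ge 1$) be convex and twice differentiable, all minimized at a common point $w^o$, and suppose that $J^{\rm glob}=\sum_{k}J_k$ satisfies $\nu_c I\le\nabla^2J^{\rm glob}(w)\le\delta_c I$ for all $w$, where $0<\nu_c\le\delta_c$. The asynchronous centralized solution is $$\boldsymbol w_i=\boldsymbol w_{i-1}-\boldsymbol\mu(i)\sum_{k=1}^N\boldsymbol\pi_k(i)\,\widehat{\nabla J}_{k,i}(\boldsymbol w_{i-1}),\qquad i\ge 0,$$ with a square-integrable initial condition $\boldsymbol w_{-1}$. Write $\tilde{\boldsymbol w}_i=w^o-\boldsymbol w_i$ and let $\mathcal F_{i-1}$ be the $\sigma$-algebra generated by $\boldsymbol w_{-1},\dots,\boldsymbol w_{i-1}$. Assume: * the step-sizes satisfy $\boldsymbol\mu(i)\in[0,\mu_{\rm ub}]$ and have mean $\bar\mu>0$ and variance $\sigma_\mu^2$ for all $i$; put $\mu_x=\bar\mu+\sigma_\mu^2/\bar\mu$; * $\boldsymbol\pi_k(i)\ge0$, $\sum_k\boldsymbol\pi_k(i)=1$, $\mathbb E\,\boldsymbol\pi_k(i)=1/N$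 and $\operatorname{Var}\boldsymbol\pi_k(i)=\sigma_{\pi,k}^2$ for all $i$ (coefficients with the same $i$ may be correlated); * the step-sizes, the vectors $(\boldsymbol\pi_1(i),\dots,\boldsymbol\pi_N(i))$, $i\ge0$, and the remaining data (initial condition and approximate gradient fields) are mutually independent; * the gradient noises $\boldsymbol s_{k,i}(w)=\widehat{\nabla J}_{k,i}(w)-\nabla J_k(w)$, taken at $\boldsymbol w_{i-1}$, are square integrable and satisfy almost surely $\mathbb E[\boldsymbol s_{k,i}|\mathcal F_{i-1}]=0$, $\mathbb E[\|\boldsymbol s_{k,i}\|^2|\mathcal F_{i-1}]\le\beta_k^2\|\tilde{\boldsymbol w}_{i-1}\|^2+\sigma_{s,k}^2$, and $\mathbb E[\boldsymbol s_{k,i}\boldsymbol s_{\ell,i}^{\sf T}|\mathcal F_{i-1}]=0$ for $k\ne\ell$. Let $\beta_c^2=\sum_k[\beta_k^2+N^2\sigma_{\pi,k}^2(\beta_k^2+\delta_c^2)]$ and $\sigma_s^2=\sum_k(1+N^2\sigma_{\pi,k}^2)\sigma_{s,k}^2$. **(a)** If $\mu_x/N<2\nu_c/(\delta_c^2+\beta_c^2)$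 then, for every $i\ge0$, $$\mathbb E\|\tilde{\boldsymbol w}_i\|^2\le\alpha\,\mathbb E\|\tilde{\boldsymbol w}_{i-1}\|^2+\sigma_s^2(\bar\mu^2+\sigma_\mu^2)/N^2<\infty,\qquad \alpha=1-2\nu_c\frac{\bar\mu}{N}+(\delta_c^2+\beta_c^2)\frac{\bar\mu^2+\sigma_\mu^2}{N^2},$$ and $0\le\alpha<1$. **(b)** There are constants $C$ and $\mu_1>0$, depending only on $N$, $M$, the costs and $\{\beta_k^2,\sigma_{s,k}^2,\sigma_{\pi,k}^2\}$, such that $\limsup_{i\to\infty}\mathbb E\|\tilde{\boldsymbol w}_i\|^2\le C\mu_x$ whenever $\mu_x\le\mu_1$. **(c)** Suppose moreover that, for some $\tau_c,\tau_2\ge0$, $1\le\kappa\le2$ and $r>0$: * $\|\nabla^2J^{\rm glob}(w^o+\delta w)-\nabla^2J^{\rm glob}(w^o)\|\le\tau_c\|\delta w\|$ for $\|\delta w\|\le r$; * for all $k$, $i$ and every $\mathcal F_{i-1}$-measurable $\boldsymbol v$ with $\|\boldsymbol v-w^o\|\le r$, $\boldsymbol s_{k,i}(\boldsymbol v)$ is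 square integrable and $\|R_{s,k,i}(\boldsymbol v)-R_{s,k,i}(w^o)\|\le\tau_2\|\boldsymbol v-w^o\|^\kappa$ almost surely, where $R_{s,k,i}(\boldsymbol v)=\mathbb E[\boldsymbol s_{k,i}(\boldsymbol v)\boldsymbol s_{k,i}(\boldsymbol v)^{\sf T}|\mathcal F_{i-1}]$; * $R_{s,k}=\lim_{i\to\infty}R_{s,k,i}(w^o)$ almost surely, with $R_{s,k}$ a constant matrix; * the noises $\boldsymbol s_{k,i}(\boldsymbol w_{i-1})$ have finite fourth moments and $\mathbb E[\|\boldsymbol s_{k,i}(\boldsymbol w_{i-1})\|^4|\mathcal F_{i-1}]\le\beta_{4,k}\|\tilde{\boldsymbol w}_{i-1}\|^4+\sigma_{4,k}$ almost surely, for some constants $\beta_{4,k},\sigma_{4,k}\ge0$; * $\mu_{\rm ub}^2\le c\,\mu_x$ for some constant $c$. Then there are constants $C$ and $\mu_1>0$, depending only on the quantities listed in (b) and on $R_{s,k},\tau_c,\tau_2,\kappa,r,\beta_{4,k},\sigma_{4,k},c$, such that whenever $\mu_x\le\mu_1$, the mean-square deviation ${\rm MSD}=\limsup_{i\to\infty}\mathbb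 E\|\tilde{\boldsymbol w}_i\|^2$ satisfies $$\Big|{\rm MSD}-\frac{\mu_x}{2N}\operatorname{Tr}\Big[\Big(\sum_{k=1}^NH_k\Big)^{-1}\Big(\sum_{k=1}^N(1+N^2\sigma_{\pi,k}^2)R_{s,k}\Big)\Big]\Big|\le C\mu_x^{3/2},\qquad H_k=\nabla^2J_k(w^o),$$ and the same bound holds with $\mathbb E\|\tilde{\boldsymbol w}_i\|^2$ in place of MSD for all sufficiently large $i$. -/

import Mathlib

open MeasureTheory ProbabilityTheory Filter Topology

universe u

noncomputable section

/-! ### Cost functions -/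

/-- Parameter space `ℝ^M` with the Euclidean norm. -/
abbrev Vec (M : ℕ) : Type := EuclideanSpace ℝ (Fin M)

/-- `J` is twice differentiable: `J` and its gradient are differentiable everywhere. -/
def TwiceDifferentiable {M : ℕ} (J : Vec M → ℝ) : Prop :=
  Differentiable ℝ J ∧ Differentiable ℝ (gradient J)

/-- The Hessian matrix `∇²J(w)`: its `(a, b)` entry is `∂_b (∂_a J) (w)`. -/
def hessian {M : ℕ} (J : Vec M → ℝ) (w : Vec M) : Matrix (Fin M) (Fin M) ℝ :=
  Matrix.of fun a b => (fderiv ℝ (gradient J) w (EuclideanSpace.single b 1)) a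

/-- The spectral norm (operator norm for the Euclidean norm) of a square matrix. -/
def specNorm {M : ℕ} (A : Matrix (Fin M) (Fin M) ℝ) : ℝ :=
  ‖Matrix.toEuclideanCLM (n := Fin M) (𝕜 := ℝ) A‖

/-- Conditions on a cost: twice differentiable with `0 < ν I ≤ ∇²J(w) ≤ δ I` for all `w`. -/
structure CostCond {M : ℕ} (J : Vec M → ℝ) (ν δ : ℝ) : Prop where
  twiceDiff : TwiceDifferentiable J
  nu_pos : 0 < ν
  nu_le : ν ≤ δ
  lower : ∀ w, (hessian J w - ν • (1 : Matrix (Fin M) (Fin M) ℝ)).PosSemidef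
  upper : ∀ w, (δ • (1 : Matrix (Fin M) (Fin M) ℝ) - hessian J w).PosSemidef

/-- The aggregate cost `J^glob(w) = ∑_k J_k(w)`. -/
def aggregateCost {M N : ℕ} (J : Fin N → Vec M → ℝ) : Vec M → ℝ := fun w => ∑ k, J k w

/-- The Hessian is `τ`-Lipschitz at `w^o` for perturbations of norm at most `r`. -/
def HessianLipschitzAt {M : ℕ} (J : Vec M → ℝ) (wo : Vec M) (τ r : ℝ) : Prop :=
  ∀ d : Vec M, ‖d‖ ≤ r → specNorm (hessian J (wo + d) - hessian J wo) ≤ τ * ‖d‖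

/-! ### The asynchronous centralized algorithm -/

/-- The random ingredients of the algorithm: the step-sizes `μ(i)`, the fusion coefficients
`π_k(i)`, the approximate gradient of `J_k` used at time `i` (as a random field in `w`), and the
initial condition `w_{-1}`. -/
structure CentralizedAlgorithm (M N : ℕ) (Ω : Type*) where
  step : ℕ → Ω → ℝ
  fusion : ℕ → Fin N → Ω → ℝ
  approxGrad : ℕ → Fin N → Vec M → Ω → Vec M
  init : Ω → Vec M

namespace CentralizedAlgorithm

variable {M N : ℕ} {Ω : Type*}

/-- The iterates, with the index shifted by one: `A.iter n` is `w_{n-1}`, so `A.iter 0 = w_{-1}`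
and `w_i = w_{i-1} - μ(i) ∑_k π_k(i) ĝ_{k,i}(w_{i-1})` for `i ≥ 0`. -/
def iter (A : CentralizedAlgorithm M N Ω) : ℕ → Ω → Vec M
  | 0 => A.init
  | i + 1 => fun ω => A.iter i ω -
      A.step i ω • ∑ k, A.fusion i k ω • A.approxGrad i k (A.iter i ω) ω

/-- `A.past i` is `F_{i-1}`, the σ-algebra generated by `w_{-1}, …, w_{i-1}`. -/
@[reducible] def past (A : CentralizedAlgorithm M N Ω) (i : ℕ) : MeasurableSpace Ω :=
  ⨆ j ∈ Set.Iic i, MeasurableSpace.comap (A.iter j) inferInstance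

/-- The gradient noise `s_{k,i}(v) = ĝ_{k,i}(v) - ∇J_k(v)` at a (possibly random) point `v`. -/
def noise (A : CentralizedAlgorithm M N Ω) (J : Fin N → Vec M → ℝ) (i : ℕ) (k : Fin N)
    (v : Ω → Vec M) : Ω → Vec M :=
  fun ω => A.approxGrad i k (v ω) ω - gradient (J k) (v ω)

/-- The sources of randomness: the σ-algebra `D` carrying the data, each step-size `μ(i)`, and
each vector of fusion coefficients `(π_1(i), …, π_N(i))`. -/
@[reducible] def source (A : CentralizedAlgorithm M N Ω) (D : MeasurableSpace Ω) :
    Option (ℕ ⊕ ℕ) → MeasurableSpace Ω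
  | none => D
  | some (Sum.inl i) => MeasurableSpace.comap (A.step i) inferInstance
  | some (Sum.inr i) => MeasurableSpace.comap (fun ω k => A.fusion i k ω) inferInstance

end CentralizedAlgorithm

/-- The conditional cross moment matrix `E[x yᵀ | m]`, entry by entry. -/
def condCross {M : ℕ} {Ω : Type*} [MeasurableSpace Ω] (P : Measure Ω) (m : MeasurableSpace Ω)
    (x y : Ω → Vec M) (ω : Ω) : Matrix (Fin M) (Fin M) ℝ :=
  Matrix.of fun a b => (P[fun ω' => x ω' a * y ω' b | m]) ω

/-! ### Assumptions on the random quantities -/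

/-- The step-sizes are bounded random variables in `[0, μub]` with mean `μbar > 0` and variance
`σμ2`, the same for all `i`. -/
structure StepSizeCond {M N : ℕ} {Ω : Type*} [MeasurableSpace Ω] (P : Measure Ω)
    (A : CentralizedAlgorithm M N Ω) (μbar σμ2 μub : ℝ) : Prop where
  measurable : ∀ i, Measurable (A.step i)
  bounded : ∀ i, ∀ᵐ ω ∂P, A.step i ω ∈ Set.Icc 0 μub
  mean : ∀ i, ∫ ω, A.step i ω ∂P = μbar
  variance : ∀ i, ∫ ω, (A.step i ω - μbar) ^ 2 ∂P = σμ2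
  mean_pos : 0 < μbar

/-- The fusion coefficients are nonnegative, sum to one, and have mean `1/N` and variances
`σπ2 k`. Coefficients with the same time index may be correlated. -/
structure FusionCond {M N : ℕ} {Ω : Type*} [MeasurableSpace Ω] (P : Measure Ω)
    (A : CentralizedAlgorithm M N Ω) (σπ2 : Fin N → ℝ) : Prop where
  measurable : ∀ i k, Measurable (A.fusion i k)
  nonneg : ∀ i k, ∀ᵐ ω ∂P, 0 ≤ A.fusion i k ω
  sum_eq_one : ∀ i, ∀ᵐ ω ∂P, ∑ k, A.fusion i k ω = 1
  mean : ∀ i k, ∫ ω, A.fusion i k ω ∂P = 1 / N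
  variance : ∀ i k, ∫ ω, (A.fusion i k ω - 1 / N) ^ 2 ∂P = σπ2 k

/-- Each step-size and each vector of fusion coefficients is independent of all the other random
quantities: the step-sizes, the fusion vectors, and a σ-algebra `D` carrying the initial condition
and the approximate gradient fields are mutually independent. -/
def IndependentSources {M N : ℕ} {Ω : Type*} [mΩ : MeasurableSpace Ω] (P : Measure Ω)
    (A : CentralizedAlgorithm M N Ω) : Prop :=
  ∃ D : MeasurableSpace Ω, D ≤ mΩ ∧
    Measurable[D] A.init ∧
    (∀ i k, Measurable[(inferInstance : MeasurableSpace (Vec M)).prod D]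
      (fun p : Vec M × Ω => A.approxGrad i k p.1 p.2)) ∧
    iIndep (A.source D) P

/-- Conditions on the individual gradient noises at the iterates: conditionally zero mean,
conditional variance at most `β_k² ‖w^o - w_{i-1}‖² + σ_{s,k}²`, and conditionally uncorrelated
across the agents. -/
structure NoiseCond {M N : ℕ} {Ω : Type*} [MeasurableSpace Ω] (P : Measure Ω)
    (A : CentralizedAlgorithm M N Ω) (J : Fin N → Vec M → ℝ) (wo : Vec M)
    (β2 σs2 : Fin N → ℝ) : Prop where
  memLp : ∀ i k, MemLp (A.noise J i k (A.iter i)) 2 P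
  mean_zero : ∀ i k, P[A.noise J i k (A.iter i) | A.past i] =ᵐ[P] 0
  var_le : ∀ i k, P[fun ω => ‖A.noise J i k (A.iter i) ω‖ ^ 2 | A.past i] ≤ᵐ[P]
    fun ω => β2 k * ‖wo - A.iter i ω‖ ^ 2 + σs2 k
  uncorrelated : ∀ i k l, k ≠ l → ∀ᵐ ω ∂P,
    condCross P (A.past i) (A.noise J i k (A.iter i)) (A.noise J i l (A.iter i)) ω = 0

/-- All standing conditions on one run of the asynchronous centralized algorithm. -/
structure AsyncCentralizedModel {M N : ℕ} {Ω : Type*} [MeasurableSpace Ω] (P : Measure Ω)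
    (A : CentralizedAlgorithm M N Ω) (J : Fin N → Vec M → ℝ) (wo : Vec M)
    (β2 σs2 σπ2 : Fin N → ℝ) (μbar σμ2 μub : ℝ) : Prop where
  init_memLp : MemLp A.init 2 P
  step : StepSizeCond P A μbar σμ2 μub
  fusion : FusionCond P A σπ2
  indep : IndependentSources P A
  noise : NoiseCond P A J wo β2 σs2

/-- Smoothness of the individual noise covariances `R_{s,k,i}(v) = E[s_{k,i}(v) s_{k,i}(v)ᵀ | F_{i-1}]`
near `w^o`, for `F_{i-1}`-measurable `v`:
`‖R_{s,k,i}(v) - R_{s,k,i}(w^o)‖ ≤ τ₂ ‖v - w^o‖^κ` whenever `‖v - w^o‖ ≤ r`. -/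
def CovarianceSmooth {M N : ℕ} {Ω : Type*} [MeasurableSpace Ω] (P : Measure Ω)
    (A : CentralizedAlgorithm M N Ω) (J : Fin N → Vec M → ℝ) (wo : Vec M) (τ₂ κ r : ℝ) : Prop :=
  ∀ i k, ∀ v : Ω → Vec M, Measurable[A.past i] v → (∀ ω, ‖v ω - wo‖ ≤ r) →
    MemLp (A.noise J i k v) 2 P ∧
    ∀ᵐ ω ∂P,
      specNorm (condCross P (A.past i) (A.noise J i k v) (A.noise J i k v) ω -
        condCross P (A.past i) (A.noise J i k fun _ => wo) (A.noise J i k fun _ => wo) ω)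
      ≤ τ₂ * ‖v ω - wo‖ ^ κ

/-- `R_{s,k} = lim_i E[s_{k,i}(w^o) s_{k,i}(w^o)ᵀ | F_{i-1}]` almost surely, for every agent. -/
def CovarianceLimit {M N : ℕ} {Ω : Type*} [MeasurableSpace Ω] (P : Measure Ω)
    (A : CentralizedAlgorithm M N Ω) (J : Fin N → Vec M → ℝ) (wo : Vec M)
    (Rs : Fin N → Matrix (Fin M) (Fin M) ℝ) : Prop :=
  ∀ k, (∀ i, MemLp (A.noise J i k fun _ => wo) 2 P) ∧
    ∀ᵐ ω ∂P, ∀ a b, Tendsto (fun i =>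
      condCross P (A.past i) (A.noise J i k fun _ => wo) (A.noise J i k fun _ => wo) ω a b)
      atTop (𝓝 (Rs k a b))

/-- Fourth-order moment condition on the individual gradient noises at the iterates. -/
def FourthMomentCond {M N : ℕ} {Ω : Type*} [MeasurableSpace Ω] (P : Measure Ω)
    (A : CentralizedAlgorithm M N Ω) (J : Fin N → Vec M → ℝ) (wo : Vec M)
    (β4 σ4 : Fin N → ℝ) : Prop :=
  ∀ i k, MemLp (A.noise J i k (A.iter i)) 4 P ∧
    P[fun ω => ‖A.noise J i k (A.iter i) ω‖ ^ 4 | A.past i] ≤ᵐ[P]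
      fun ω => β4 k * ‖wo - A.iter i ω‖ ^ 4 + σ4 k

/-! ### The quantities in the statement -/

/-- `μ_x = μbar + σ_μ² / μbar`. -/
def muX (μbar σμ2 : ℝ) : ℝ := μbar + σμ2 / μbar

/-- `β_c² = ∑_k [β_k² + N² σ_{π,k}² (β_k² + δ_c²)]`. -/
def betaC2 {N : ℕ} (δc : ℝ) (β2 σπ2 : Fin N → ℝ) : ℝ :=
  ∑ k, (β2 k + (N : ℝ) ^ 2 * σπ2 k * (β2 k + δc ^ 2))

/-- `σ_s² = ∑_k (1 + N² σ_{π,k}²) σ_{s,k}²`. -/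
def sigmaS2 {N : ℕ} (σs2 σπ2 : Fin N → ℝ) : ℝ :=
  ∑ k, (1 + (N : ℝ) ^ 2 * σπ2 k) * σs2 k

/-- `α = 1 - 2 ν_c μbar / N + (δ_c² + β_c²)(μbar² + σ_μ²) / N²`. -/
def alphaCent {N : ℕ} (νc δc : ℝ) (β2 σπ2 : Fin N → ℝ) (μbar σμ2 : ℝ) : ℝ :=
  1 - 2 * νc * (μbar / N) + (δc ^ 2 + betaC2 δc β2 σπ2) * (μbar ^ 2 + σμ2) / (N : ℝ) ^ 2

/-- The mean-square error with the shifted index: `mse P A wo n = E ‖w^o - w_{n-1}‖²`. -/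
def mse {M N : ℕ} {Ω : Type*} [MeasurableSpace Ω] (P : Measure Ω)
    (A : CentralizedAlgorithm M N Ω) (wo : Vec M) (n : ℕ) : ℝ :=
  ∫ ω, ‖wo - A.iter n ω‖ ^ 2 ∂P

/-- The steady-state mean-square deviation, as the upper limit of the mean-square error (the
limit itself where it exists). -/
def msd {M N : ℕ} {Ω : Type*} [MeasurableSpace Ω] (P : Measure Ω)
    (A : CentralizedAlgorithm M N Ω) (wo : Vec M) : ℝ :=
  limsup (mse P A wo) atTop

/-- `(μ_x / 2N) Tr[(∑_k H_k)⁻¹ (∑_k (1 + N² σ_{π,k}²) R_{s,k})]` with `H_k = ∇²J_k(w^o)`. -/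
def msdFormula {M N : ℕ} (J : Fin N → Vec M → ℝ) (wo : Vec M) (σπ2 : Fin N → ℝ)
    (Rs : Fin N → Matrix (Fin M) (Fin M) ℝ) (μx : ℝ) : ℝ :=
  μx / (2 * N) * Matrix.trace
    ((∑ k, hessian (J k) wo)⁻¹ * ∑ k, (1 + (N : ℝ) ^ 2 * σπ2 k) • Rs k)

end

/-! The starting point is an exact second-moment identity for one step. The current step-size and
weights are independent of each other and of everything that enters the current gradients, and the
noises are conditionally centred and mutually uncorrelated. Expanding the square of the new error
therefore leaves only a drift term with factor `μbar / N`, a gradient quadratic form with matrix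
`E[π_k π_l]`, and the diagonal noise variances, the last two multiplied by `E[μ²] = μbar * μ_x`
(`MixingStep.integral_norm_sq`).

For (a), the drift is controlled by strong monotonicity of the aggregate gradient. The quadratic
form needs a bound on the individual gradients although only the aggregate is assumed smooth. The
Bregman divergences of the convex `J_k` are nonnegative and add up to that of the aggregate, so each
`J_k` inherits the aggregate's quadratic upper bound. Because the minimizer is common, co-coercivity
then gives `∑ ‖∇J_k(w)‖² ≤ δ² ‖w - wo‖²` (`sum_norm_sq_gradient_le`). Part (b) iterates the
resulting scalar contraction, whose rate is at least `ν μbar / N` for small `μ_x`.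

For (c), the error is projected on a unit eigenvector `u` of the aggregate Hessian at `wo`, with
eigenvalue `l`. The same identity applied to the real variable `⟪u, w - wo⟫` is an affine recursion
for its second moment (`integral_inner_sq_succ`). Its unperturbed fixed point is the contribution of
`u` to the trace formula, and summing over an eigenbasis gives the trace. Each step moves the second
moment by terms of size `μbar * μ_x`, while the contraction rate is of order `μbar`; perturbations
of size `μbar * μ_x^{3/2}` per step thus cost `μ_x^{3/2}` in steady state
(`abs_affine_step_sub_le`). There are three of them.

The gradient quadratic form is of the order of the mean-square error, hence `O(μ_x)`.

The nonlinear part of the gradient contributes a cubic moment. The fourth-moment recursion makes the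
fourth moment `O(μ_x²)`, and a weighted mean inequality turns this into `O(μ_x^{3/2})` for the cubic
one. The initial condition is only square integrable, so fourth moments may be infinite; both
recursions are therefore localized to events of the past. An initial event of probability at least
`1 - √μ_x` carries a bounded initial error, and its complement is handled by the localized
mean-square bound (`eventually_integral_nonlinear_le`).

The noise variance along `u` differs from its limit by `O(√μ_x)`: smoothness of the covariance is
used where the iterate is within `r` of `wo`, dominated convergence for the covariance at `wo`, and
Chebyshev's inequality elsewhere (`eventually_integral_inner_noise_sq`). -/

open scoped RealInnerProductSpace in
/-- First-order characterisation of convexity. -/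
theorem ConvexOn.add_inner_gradient_le {E : Type*} [NormedAddCommGroup E] [InnerProductSpace ℝ E]
    [CompleteSpace E] {f : E → ℝ} (hf : ConvexOn ℝ Set.univ f) (hd : Differentiable ℝ f)
    (x y : E) : f x + ⟪gradient f x, y - x⟫ ≤ f y := by
  have hline : ∀ t : ℝ, HasDerivAt (fun t : ℝ => f (x + t • (y - x)))
      (⟪gradient f (x + t • (y - x)), y - x⟫) t := by
    intro t
    have h1 : HasDerivAt (fun t : ℝ => x + t • (y - x)) (y - x) t := by
      simpa using ((hasDerivAt_id t).smul_const (y - x)).const_add x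
    have h2 := (hd (x + t • (y - x))).hasFDerivAt.comp_hasDerivAt t h1
    rwa [← inner_gradient_left] at h2
  have hc : ConvexOn ℝ Set.univ (fun t : ℝ => f (x + t • (y - x))) := by
    have := hf.comp_affineMap (AffineMap.lineMap x y : ℝ →ᵃ[ℝ] E)
    simpa [Function.comp_def, AffineMap.lineMap_apply, add_comm] using this
  have := hc.le_slope_of_hasDerivAt (Set.mem_univ 0) (Set.mem_univ 1) one_pos (hline 0)
  simp only [slope_def_field, zero_smul, add_zero, one_smul, sub_zero, div_one] at this
  have e : x + (y - x) = y := by abel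
  rw [e] at this
  linarith

/-! ### Convexity, smoothness and spectral estimates for the costs. -/

section Costs

open scoped RealInnerProductSpace

variable {M N : ℕ}

theorem toEuclideanCLM_hessian (J : Vec M → ℝ) (w : Vec M) :
    Matrix.toEuclideanCLM (n := Fin M) (𝕜 := ℝ) (hessian J w) = fderiv ℝ (gradient J) w := by
  refine ContinuousLinearMap.coe_injective ?_
  refine (EuclideanSpace.basisFun (Fin M) ℝ).toBasis.ext fun b => ?_
  ext a
  simp [hessian, Matrix.mulVec_single]

theorem TwiceDifferentiable.continuous_gradient {J : Vec M → ℝ} (h : TwiceDifferentiable J) :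
    Continuous (gradient J) := h.2.continuous

theorem gradient_aggregateCost {J : Fin N → Vec M → ℝ} (hJ : ∀ k, TwiceDifferentiable (J k))
    (w : Vec M) : gradient (aggregateCost J) w = ∑ k, gradient (J k) w := by
  apply HasGradientAt.gradient
  rw [hasGradientAt_iff_hasFDerivAt, map_sum]
  have := HasFDerivAt.fun_sum (u := Finset.univ) (A := fun k => J k)
    (A' := fun k => (InnerProductSpace.toDual ℝ (Vec M)) (gradient (J k) w)) (x := w)
    (fun k _ => by
      simpa [toDual_gradient] using ((hJ k).1 w).hasFDerivAt)
  exact this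

theorem hessian_aggregateCost {J : Fin N → Vec M → ℝ} (hJ : ∀ k, TwiceDifferentiable (J k))
    (w : Vec M) : hessian (aggregateCost J) w = ∑ k, hessian (J k) w := by
  have h : gradient (aggregateCost J) = fun w => ∑ k, gradient (J k) w :=
    funext (gradient_aggregateCost hJ)
  ext a b
  simp only [hessian, h, Matrix.of_apply, Matrix.sum_apply]
  rw [fderiv_fun_sum fun k _ => (hJ k).2 w]
  simp

namespace CostCond

variable {J : Vec M → ℝ} {ν δ : ℝ}

theorem delta_pos (h : CostCond J ν δ) : 0 < δ := h.nu_pos.trans_le h.nu_le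

theorem le_inner_hessian (h : CostCond J ν δ) (w v : Vec M) :
    ν * ‖v‖ ^ 2 ≤ ⟪fderiv ℝ (gradient J) w v, v⟫ := by
  have := (h.lower w).dotProduct_mulVec_nonneg (v : Fin M → ℝ)
  rw [← toEuclideanCLM_hessian, real_inner_comm, Matrix.inner_toEuclideanCLM,
    ← real_inner_self_eq_norm_sq, EuclideanSpace.inner_eq_star_dotProduct]
  simp only [star_trivial, Matrix.sub_mulVec, dotProduct_sub, Matrix.smul_mulVec,
    Matrix.one_mulVec, dotProduct_smul, smul_eq_mul] at this ⊢
  linarith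

theorem inner_hessian_le (h : CostCond J ν δ) (w v : Vec M) :
    ⟪fderiv ℝ (gradient J) w v, v⟫ ≤ δ * ‖v‖ ^ 2 := by
  have := (h.upper w).dotProduct_mulVec_nonneg (v : Fin M → ℝ)
  rw [← toEuclideanCLM_hessian, real_inner_comm, Matrix.inner_toEuclideanCLM,
    ← real_inner_self_eq_norm_sq, EuclideanSpace.inner_eq_star_dotProduct]
  simp only [star_trivial, Matrix.sub_mulVec, dotProduct_sub, Matrix.smul_mulVec,
    Matrix.one_mulVec, dotProduct_smul, smul_eq_mul] at this ⊢
  linarith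

theorem hasDerivAt_inner_gradient (h : CostCond J ν δ) (x v : Vec M) (t : ℝ) :
    HasDerivAt (fun t : ℝ => ⟪gradient J (x + t • v), v⟫)
      ⟪fderiv ℝ (gradient J) (x + t • v) v, v⟫ t := by
  have h1 : HasDerivAt (fun t : ℝ => x + t • v) v t := by
    simpa using ((hasDerivAt_id t).smul_const v).const_add x
  have h2 := (h.twiceDiff.2 (x + t • v)).hasFDerivAt.comp_hasDerivAt t h1
  simpa using h2.inner ℝ (hasDerivAt_const t v)

/-- Strong monotonicity of the gradient. -/
theorem le_inner_gradient_sub (h : CostCond J ν δ) (x v : Vec M) {t : ℝ} (ht : 0 ≤ t) :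
    ν * ‖v‖ ^ 2 * t ≤ ⟪gradient J (x + t • v), v⟫ - ⟪gradient J x, v⟫ := by
  have := mul_sub_le_image_sub_of_le_deriv
    (f := fun t : ℝ => ⟪gradient J (x + t • v), v⟫)
    (fun t => (h.hasDerivAt_inner_gradient x v t).differentiableAt) (C := ν * ‖v‖ ^ 2)
    (fun t => by
      rw [(h.hasDerivAt_inner_gradient x v t).deriv]; exact h.le_inner_hessian _ _) ht
  simpa using this

theorem inner_gradient_sub_le (h : CostCond J ν δ) (x v : Vec M) {t : ℝ} (ht : 0 ≤ t) :
    ⟪gradient J (x + t • v), v⟫ - ⟪gradient J x, v⟫ ≤ δ * ‖v‖ ^ 2 * t := by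
  have := image_sub_le_mul_sub_of_deriv_le
    (f := fun t : ℝ => ⟪gradient J (x + t • v), v⟫)
    (fun t => (h.hasDerivAt_inner_gradient x v t).differentiableAt) (C := δ * ‖v‖ ^ 2)
    (fun t => by
      rw [(h.hasDerivAt_inner_gradient x v t).deriv]; exact h.inner_hessian_le _ _) ht
  simpa using this

/-- Quadratic upper bound (descent lemma). -/
theorem le_add_inner_gradient (h : CostCond J ν δ) (x v : Vec M) :
    J (x + v) ≤ J x + ⟪gradient J x, v⟫ + δ / 2 * ‖v‖ ^ 2 := by
  -- Subtracting the quadratic model along the segment leaves a function whose derivative is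
  -- nonpositive by the upper Hessian bound.
  have hder : ∀ t : ℝ, HasDerivAt
      (fun t : ℝ => J (x + t • v) - (t * ⟪gradient J x, v⟫ + t ^ 2 * (δ / 2 * ‖v‖ ^ 2)))
      (⟪gradient J (x + t • v), v⟫ - (⟪gradient J x, v⟫ + t * (δ * ‖v‖ ^ 2))) t := by
    intro t
    have h1 : HasDerivAt (fun t : ℝ => x + t • v) v t := by
      simpa using ((hasDerivAt_id t).smul_const v).const_add x
    have h2 := (h.twiceDiff.1 (x + t • v)).hasFDerivAt.comp_hasDerivAt t h1
    rw [← inner_gradient_left] at h2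
    have h3 := ((hasDerivAt_id t).mul_const ⟪gradient J x, v⟫).add
      (((hasDerivAt_id t).pow 2).mul_const (δ / 2 * ‖v‖ ^ 2))
    refine (h2.sub h3).congr_deriv ?_
    simp only [id, one_mul, pow_one, Nat.cast_ofNat, Nat.reduceSub, mul_one]
    ring
  have hanti : AntitoneOn
      (fun t : ℝ => J (x + t • v) - (t * ⟪gradient J x, v⟫ + t ^ 2 * (δ / 2 * ‖v‖ ^ 2)))
      (Set.Icc 0 1) := by
    refine antitoneOn_of_deriv_nonpos (convex_Icc 0 1)
      (fun t _ => (hder t).continuousAt.continuousWithinAt)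
      (fun t _ => (hder t).differentiableAt.differentiableWithinAt) fun t ht => ?_
    rw [interior_Icc] at ht
    rw [(hder t).deriv]
    have := h.inner_gradient_sub_le x v ht.1.le
    linarith
  have := hanti (Set.left_mem_Icc.2 zero_le_one) (Set.right_mem_Icc.2 zero_le_one) zero_le_one
  simp only [one_smul, one_mul, one_pow, zero_smul, add_zero, zero_mul, ne_eq, OfNat.ofNat_ne_zero,
    not_false_eq_true, zero_pow, sub_zero] at this
  linarith

end CostCond

theorem gradient_eq_zero_of_isMinOn {J : Vec M → ℝ} {wo : Vec M} (h : IsMinOn J Set.univ wo) :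
    gradient J wo = 0 := by
  have : fderiv ℝ J wo = 0 := IsLocalMin.fderiv_eq_zero (h.isLocalMin Filter.univ_mem)
  rw [← map_eq_zero_iff _ (InnerProductSpace.toDual ℝ (Vec M)).injective, toDual_gradient, this]

/-- A function with minimum `f wo` and a quadratic upper bound has a co-coercive gradient. -/
theorem norm_sq_gradient_le_of_quadratic_bound {f : Vec M → ℝ} {wo w : Vec M} {δ : ℝ} (hδ : 0 < δ)
    (hmin : IsMinOn f Set.univ wo)
    (hub : ∀ v, f (w + v) ≤ f w + ⟪gradient f w, v⟫ + δ / 2 * ‖v‖ ^ 2) :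
    ‖gradient f w‖ ^ 2 ≤ 2 * δ * (f w - f wo) := by
  -- This displacement minimizes the quadratic upper bound; its value there is still at least `f
  -- wo`.
  have h1 := hub (-(δ⁻¹) • gradient f w)
  have h2 : f wo ≤ f (w + -(δ⁻¹) • gradient f w) := hmin (Set.mem_univ _)
  rw [inner_smul_right, real_inner_self_eq_norm_sq, norm_smul, mul_pow] at h1
  simp only [norm_neg, Real.norm_eq_abs, sq_abs] at h1
  have h3 : f wo ≤ f w - 1 / (2 * δ) * ‖gradient f w‖ ^ 2 := by
    have e : -δ⁻¹ * ‖gradient f w‖ ^ 2 + δ / 2 * ((-δ⁻¹) ^ 2 * ‖gradient f w‖ ^ 2)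
      = - (1 / (2 * δ) * ‖gradient f w‖ ^ 2) := by field_simp; ring
    linarith
  have h4 : 1 / (2 * δ) * ‖gradient f w‖ ^ 2 ≤ f w - f wo := by linarith
  rw [div_mul_eq_mul_div, one_mul, div_le_iff₀ (by positivity)] at h4
  linarith

variable {J : Fin N → Vec M → ℝ} {wo : Vec M} {ν δ : ℝ}

theorem isMinOn_aggregateCost (hmin : ∀ k, IsMinOn (J k) Set.univ wo) :
    IsMinOn (aggregateCost J) Set.univ wo :=
  isMinOn_iff.2 fun w hw => by
    simpa only [aggregateCost] using Finset.sum_le_sum fun k _ => isMinOn_iff.1 (hmin k) w hw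

theorem inner_gradient_aggregate_ge (hmin : ∀ k, IsMinOn (J k) Set.univ wo)
    (h : CostCond (aggregateCost J) ν δ) (w : Vec M) :
    ν * ‖w - wo‖ ^ 2 ≤ ⟪w - wo, gradient (aggregateCost J) w⟫ := by
  have := h.le_inner_gradient_sub wo (w - wo) zero_le_one
  rw [gradient_eq_zero_of_isMinOn (isMinOn_aggregateCost hmin)] at this
  rw [real_inner_comm]
  simpa using this

theorem aggregateCost_sub_le (hmin : ∀ k, IsMinOn (J k) Set.univ wo)
    (h : CostCond (aggregateCost J) ν δ) (w : Vec M) :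
    aggregateCost J w - aggregateCost J wo ≤ δ / 2 * ‖w - wo‖ ^ 2 := by
  have := h.le_add_inner_gradient wo (w - wo)
  rw [gradient_eq_zero_of_isMinOn (isMinOn_aggregateCost hmin)] at this
  simp at this
  linarith

theorem norm_gradient_aggregate_le (hmin : ∀ k, IsMinOn (J k) Set.univ wo)
    (h : CostCond (aggregateCost J) ν δ) (w : Vec M) :
    ‖gradient (aggregateCost J) w‖ ^ 2 ≤ δ ^ 2 * ‖w - wo‖ ^ 2 := by
  have h1 := norm_sq_gradient_le_of_quadratic_bound h.delta_pos (isMinOn_aggregateCost hmin)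
    (h.le_add_inner_gradient w)
  have h2 := mul_le_mul_of_nonneg_left (aggregateCost_sub_le hmin h w)
    (by linarith [h.delta_pos] : 0 ≤ 2 * δ)
  linarith

/-- Convexity transfers the quadratic upper bound of the aggregate to every summand with the same
`δ`. Co-coercivity then bounds each squared gradient by an excess cost, and the excess costs sum to
that of the aggregate. Hence there is no factor `N` on the right. -/
theorem sum_norm_sq_gradient_le (hdiff : ∀ k, TwiceDifferentiable (J k))
    (hconv : ∀ k, ConvexOn ℝ Set.univ (J k)) (hmin : ∀ k, IsMinOn (J k) Set.univ wo)
    (h : CostCond (aggregateCost J) ν δ) (w : Vec M) :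
    ∑ k, ‖gradient (J k) w‖ ^ 2 ≤ δ ^ 2 * ‖w - wo‖ ^ 2 := by
  have h1 : ∀ k, ‖gradient (J k) w‖ ^ 2 ≤ 2 * δ * (J k w - J k wo) := by
    intro k
    refine norm_sq_gradient_le_of_quadratic_bound h.delta_pos (hmin k) fun v => ?_
    have hub := h.le_add_inner_gradient w v
    -- Bregman divergences of the convex summands: each one is at most their sum, which is the
    -- divergence of the aggregate.
    have hlb : ∀ j, 0 ≤ J j (w + v) - (J j w + ⟪gradient (J j) w, v⟫) := fun j => by
      have := (hconv j).add_inner_gradient_le (hdiff j).1 w (w + v)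
      simp only [add_sub_cancel_left] at this
      linarith
    have := Finset.single_le_sum (f := fun j => J j (w + v) - (J j w + ⟪gradient (J j) w, v⟫))
      (fun j _ => hlb j) (Finset.mem_univ k)
    simp only [Finset.sum_sub_distrib, Finset.sum_add_distrib] at this
    rw [gradient_aggregateCost hdiff, sum_inner] at hub
    simp only [aggregateCost] at hub
    linarith
  have h2 := Finset.sum_le_sum fun k (_ : k ∈ Finset.univ) => h1 k
  rw [← Finset.mul_sum, Finset.sum_sub_distrib] at h2
  have h3 := mul_le_mul_of_nonneg_left (aggregateCost_sub_le hmin h w)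
    (by linarith [h.delta_pos] : 0 ≤ 2 * δ)
  simp only [aggregateCost] at h3
  linarith

theorem norm_gradient_le (hdiff : ∀ k, TwiceDifferentiable (J k))
    (hconv : ∀ k, ConvexOn ℝ Set.univ (J k)) (hmin : ∀ k, IsMinOn (J k) Set.univ wo)
    (h : CostCond (aggregateCost J) ν δ) (k : Fin N) (w : Vec M) :
    ‖gradient (J k) w‖ ≤ δ * ‖w - wo‖ := by
  refine le_of_sq_le_sq ?_ (mul_nonneg h.delta_pos.le (norm_nonneg _))
  rw [mul_pow]
  exact (Finset.single_le_sum (f := fun j => ‖gradient (J j) w‖ ^ 2) (fun j _ => by positivity)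
    (Finset.mem_univ k)).trans (sum_norm_sq_gradient_le hdiff hconv hmin h w)

theorem isHermitian_hessian {J : Vec M → ℝ} (h : CostCond J ν δ) (w : Vec M) :
    (hessian J w).IsHermitian := by
  have h1 := (h.lower w).isHermitian
  have h2 : (ν • (1 : Matrix (Fin M) (Fin M) ℝ)).IsHermitian := by
    simp [Matrix.IsHermitian]
  simpa using h1.add h2

/-- Along a unit eigenvector of the Hessian at the minimizer, the gradient is linear up to an error
which is both of second and of first order. -/
theorem abs_inner_gradient_sub_le (hmin : ∀ k, IsMinOn (J k) Set.univ wo)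
    (h : CostCond (aggregateCost J) ν δ) {τ r : ℝ} (hτ : 0 ≤ τ) (hr : 0 < r)
    (hL : HessianLipschitzAt (aggregateCost J) wo τ r) {u : Vec M} (hu : ‖u‖ = 1) {l : ℝ}
    (hl : 0 < l) (hlδ : l ≤ δ)
    (hH : ∀ d, ⟪u, fderiv ℝ (gradient (aggregateCost J)) wo d⟫ = l * ⟪u, d⟫) (w : Vec M) :
    |⟪u, gradient (aggregateCost J) w⟫ - l * ⟪u, w - wo⟫| ≤ 2 * δ * ‖w - wo‖ ∧
    |⟪u, gradient (aggregateCost J) w⟫ - l * ⟪u, w - wo⟫| ≤ (τ + 2 * δ / r) * ‖w - wo‖ ^ 2 := by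
  have hδ := h.delta_pos
  have h1 : |⟪u, gradient (aggregateCost J) w⟫ - l * ⟪u, w - wo⟫| ≤ 2 * δ * ‖w - wo‖ := by
    have ha : |⟪u, gradient (aggregateCost J) w⟫| ≤ δ * ‖w - wo‖ := by
      refine (abs_real_inner_le_norm _ _).trans ?_
      rw [hu, one_mul]
      refine le_of_sq_le_sq ?_ (mul_nonneg hδ.le (norm_nonneg _))
      rw [mul_pow]
      exact norm_gradient_aggregate_le hmin h w
    have hb : |l * ⟪u, w - wo⟫| ≤ δ * ‖w - wo‖ := by
      rw [abs_mul, abs_of_pos hl]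
      have := abs_real_inner_le_norm u (w - wo)
      rw [hu, one_mul] at this
      gcongr
    have := abs_sub (⟪u, gradient (aggregateCost J) w⟫) (l * ⟪u, w - wo⟫)
    linarith
  refine ⟨h1, ?_⟩
  by_cases hw : ‖w - wo‖ ≤ r
  -- Mean value inequality on the ball of radius `‖w - wo‖` for the gradient minus its linearization
  -- at `wo`, whose derivative there is at most `τ * ‖w - wo‖`.
  · have hdiff : ∀ x, HasFDerivAt (fun w => gradient (aggregateCost J) w -
        fderiv ℝ (gradient (aggregateCost J)) wo w)
        (fderiv ℝ (gradient (aggregateCost J)) x - fderiv ℝ (gradient (aggregateCost J)) wo) x :=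
      fun x => (h.twiceDiff.2 x).hasFDerivAt.sub (ContinuousLinearMap.hasFDerivAt _)
    have hmv := (convex_closedBall wo ‖w - wo‖).norm_image_sub_le_of_norm_hasFDerivWithin_le
      (C := τ * ‖w - wo‖) (fun x _ => (hdiff x).hasFDerivWithinAt) (fun x hx => by
        rw [Metric.mem_closedBall, dist_eq_norm] at hx
        have := hL (x - wo) (hx.trans hw)
        rw [specNorm, map_sub, toEuclideanCLM_hessian, toEuclideanCLM_hessian,
          add_sub_cancel] at this
        exact this.trans (by gcongr))
      (Metric.mem_closedBall_self (norm_nonneg _)) (y := w)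
      (by rw [Metric.mem_closedBall, dist_eq_norm])
    rw [gradient_eq_zero_of_isMinOn (isMinOn_aggregateCost hmin)] at hmv
    have he : ⟪u, gradient (aggregateCost J) w⟫ - l * ⟪u, w - wo⟫ =
        ⟪u, gradient (aggregateCost J) w - fderiv ℝ (gradient (aggregateCost J)) wo w -
          (0 - fderiv ℝ (gradient (aggregateCost J)) wo wo)⟫ := by
      rw [← hH, ← inner_sub_right, map_sub]
      congr 1
      abel
    rw [he]
    refine (abs_real_inner_le_norm _ _).trans ?_
    rw [hu, one_mul]
    refine hmv.trans ?_
    have : 0 ≤ 2 * δ / r * ‖w - wo‖ ^ 2 := by positivity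
    nlinarith
  -- Outside the ball of radius `r` the first-order bound is already quadratic, since `1 < ‖w - wo‖
  -- / r`.
  · push Not at hw
    refine h1.trans ?_
    have h3 : 2 * δ * ‖w - wo‖ ≤ 2 * δ / r * ‖w - wo‖ ^ 2 := by
      rw [div_mul_eq_mul_div, le_div_iff₀ hr, mul_assoc, pow_two]
      gcongr
    have : 0 ≤ τ * ‖w - wo‖ ^ 2 := by positivity
    linarith

/-- Trace of `A⁻¹ R` in an orthonormal eigenbasis of `A`. -/
theorem Matrix.IsHermitian.trace_inv_mul {A : Matrix (Fin M) (Fin M) ℝ} (hA : A.IsHermitian)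
    (hpos : ∀ a, hA.eigenvalues a ≠ 0) (R : Matrix (Fin M) (Fin M) ℝ) :
    (A⁻¹ * R).trace = ∑ a, (hA.eigenvalues a)⁻¹ *
      ⟪hA.eigenvectorBasis a, Matrix.toEuclideanCLM (n := Fin M) (𝕜 := ℝ) R
        (hA.eigenvectorBasis a)⟫ := by
  have hdet : IsUnit A.det := by
    rw [hA.det_eq_prod_eigenvalues]
    simpa [isUnit_iff_ne_zero, Finset.prod_ne_zero_iff] using hpos
  have htr : (A⁻¹ * R).trace = LinearMap.trace ℝ (Vec M) (Matrix.toEuclideanLin (A⁻¹ * R)) := by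
    rw [LinearMap.trace_eq_matrix_trace ℝ (EuclideanSpace.basisFun (Fin M) ℝ).toBasis]
    congr 1
    ext i j
    simp only [LinearMap.toMatrix_apply, OrthonormalBasis.coe_toBasis,
      EuclideanSpace.basisFun_apply, Matrix.toLpLin_apply, PiLp.ofLp_single,
      Matrix.mulVec_single_one, OrthonormalBasis.coe_toBasis_repr_apply,
      EuclideanSpace.basisFun_repr, Matrix.col_apply]
  rw [htr, LinearMap.trace_eq_sum_inner _ hA.eigenvectorBasis]
  refine Finset.sum_congr rfl fun a _ => ?_
  have hinv : Matrix.mulVec A⁻¹ (hA.eigenvectorBasis a).ofLp =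
      (hA.eigenvalues a)⁻¹ • (hA.eigenvectorBasis a).ofLp := by
    have h1 := congrArg (fun v => Matrix.mulVec A⁻¹ v) (hA.mulVec_eigenvectorBasis a)
    simp only [Matrix.mulVec_mulVec, Matrix.nonsing_inv_mul A hdet, Matrix.one_mulVec,
      Matrix.mulVec_smul] at h1
    rw [eq_inv_smul_iff₀ (hpos a), ← h1]
  rw [← Matrix.coe_toEuclideanCLM_eq_toEuclideanLin, ContinuousLinearMap.coe_coe,
    Matrix.inner_toEuclideanCLM, Matrix.inner_toEuclideanCLM, ← Matrix.mulVec_mulVec,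
    Matrix.dotProduct_mulVec, ← Matrix.mulVec_transpose, ← Matrix.conjTranspose_eq_transpose_of_trivial,
    hA.inv.eq, hinv, smul_dotProduct, smul_eq_mul]

end Costs

/-- A sequence which eventually satisfies `u (n+1) ≤ (1-ρ) u n + ρ b` is eventually below any
number larger than `b`. -/
theorem eventually_le_of_contraction {u : ℕ → ℝ} {ρ b ε : ℝ} (hρ : 0 < ρ) (hρ1 : ρ ≤ 1)
    (hε : 0 < ε) (h : ∀ᶠ n in atTop, u (n + 1) ≤ (1 - ρ) * u n + ρ * b) :
    ∀ᶠ n in atTop, u n ≤ b + ε := by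
  obtain ⟨n₀, hn₀⟩ := eventually_atTop.1 h
  have hk : ∀ k, u (n₀ + k) - b ≤ (1 - ρ) ^ k * |u n₀ - b| := by
    intro k
    induction k with
    | zero => simpa using le_abs_self (u n₀ - b)
    | succ k ih =>
      have h1 := hn₀ (n₀ + k) (by omega)
      have h2 := mul_le_mul_of_nonneg_left ih (sub_nonneg.2 hρ1)
      rw [← add_assoc, pow_succ]
      linarith
  have hlim : Tendsto (fun k => (1 - ρ) ^ k * |u n₀ - b|) atTop (𝓝 0) := by
    simpa using (tendsto_pow_atTop_nhds_zero_of_lt_one (sub_nonneg.2 hρ1)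
      (by linarith)).mul_const |u n₀ - b|
  obtain ⟨k₀, hk₀⟩ := eventually_atTop.1 (hlim.eventually (gt_mem_nhds hε))
  refine eventually_atTop.2 ⟨n₀ + k₀, fun n hn => ?_⟩
  have h1 := hk (n - n₀)
  rw [Nat.add_sub_cancel' (by omega)] at h1
  have h2 := hk₀ (n - n₀) (by omega)
  linarith

/-! ### Moments of one combination step with independent random step-size and weights. -/

section Mixing

open scoped RealInnerProductSpace

variable {Ω : Type*} {mG : MeasurableSpace Ω} {mΩ : MeasurableSpace Ω} {P : Measure Ω} {N : ℕ}
variable {E : Type*} [NormedAddCommGroup E] [InnerProductSpace ℝ E]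

theorem MeasureTheory.MemLp.integrable_real_inner {Y Z : Ω → E} (hY : MemLp Y 2 P)
    (hZ : MemLp Z 2 P) : Integrable (fun ω => ⟪Y ω, Z ω⟫) P :=
  (hY.norm.integrable_mul hZ.norm).mono' (hY.1.inner hZ.1)
    (ae_of_all _ fun _ => abs_real_inner_le_norm _ _)

theorem norm_sq_sum_smul_le (a : Fin N → ℝ) (g : Fin N → E) :
    ‖∑ k, a k • g k‖ ^ 2 ≤ (∑ k, a k ^ 2) * ∑ k, ‖g k‖ ^ 2 := by
  have h1 : ‖∑ k, a k • g k‖ ≤ ∑ k, |a k| * ‖g k‖ :=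
    (norm_sum_le _ _).trans_eq (Finset.sum_congr rfl fun k _ => by
      rw [norm_smul, Real.norm_eq_abs])
  calc ‖∑ k, a k • g k‖ ^ 2 ≤ (∑ k, |a k| * ‖g k‖) ^ 2 := by gcongr
    _ ≤ (∑ k, |a k| ^ 2) * ∑ k, ‖g k‖ ^ 2 := Finset.sum_mul_sq_le_sq_mul_sq _ _ _
    _ = _ := by simp only [sq_abs]

theorem norm_sq_sum_smul_eq (a : Fin N → ℝ) (g : Fin N → E) :
    ‖∑ k, a k • g k‖ ^ 2 = ∑ k, ∑ l, a k * a l * ⟪g k, g l⟫ := by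
  rw [← real_inner_self_eq_norm_sq, sum_inner]
  refine Finset.sum_congr rfl fun k _ => ?_
  rw [inner_sum]
  refine Finset.sum_congr rfl fun l _ => ?_
  rw [real_inner_smul_left, real_inner_smul_right]
  ring

/-- It makes quadratic forms in the moment matrix of the weights accessible to pointwise estimates
in `ω`, and shows that they are nonnegative. -/
theorem sum_integral_mul_inner {a : Fin N → Ω → ℝ} (ha : ∀ k l, Integrable (fun ω => a k ω * a l ω) P)
    (g : Fin N → E) :
    ∑ k, ∑ l, (∫ ω, a k ω * a l ω ∂P) * ⟪g k, g l⟫ = ∫ ω, ‖∑ k, a k ω • g k‖ ^ 2 ∂P := by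
  simp only [norm_sq_sum_smul_eq]
  rw [integral_finsetSum _ fun k _ => integrable_finsetSum _ fun l _ => (ha k l).mul_const _]
  refine Finset.sum_congr rfl fun k _ => ?_
  rw [integral_finsetSum _ fun l _ => (ha k l).mul_const _]
  exact Finset.sum_congr rfl fun l _ => (integral_mul_const _ _).symm

theorem integrable_norm_sq_sum_smul {a : Fin N → Ω → ℝ}
    (ha : ∀ k l, Integrable (fun ω => a k ω * a l ω) P) (g : Fin N → E) :
    Integrable (fun ω => ‖∑ k, a k ω • g k‖ ^ 2) P := by
  simp only [norm_sq_sum_smul_eq]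
  exact integrable_finsetSum _ fun k _ => integrable_finsetSum _ fun l _ => (ha k l).mul_const _

/-- One random combination step: a step-size `μ` and weights `π`, independent of each other and of
the σ-algebra `mG` which carries everything else. -/
structure MixingStep {Ω : Type*} (mG : MeasurableSpace Ω) {mΩ : MeasurableSpace Ω} (P : Measure Ω)
    {N : ℕ} (μ : Ω → ℝ) (π : Fin N → Ω → ℝ) (μbar σμ2 μub : ℝ) (σπ2 : Fin N → ℝ) : Prop where
  le : mG ≤ mΩ
  measurable_step : Measurable μ
  measurable_weight : ∀ k, Measurable (π k)
  indep_step_weight : Indep (MeasurableSpace.comap μ inferInstance)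
    (MeasurableSpace.comap (fun ω k => π k ω) inferInstance) P
  indep : Indep (MeasurableSpace.comap μ inferInstance ⊔
    MeasurableSpace.comap (fun ω k => π k ω) inferInstance) mG P
  bounded : ∀ᵐ ω ∂P, μ ω ∈ Set.Icc 0 μub
  mean : ∫ ω, μ ω ∂P = μbar
  variance : ∫ ω, (μ ω - μbar) ^ 2 ∂P = σμ2
  weight_nonneg : ∀ k, ∀ᵐ ω ∂P, 0 ≤ π k ω
  weight_sum : ∀ᵐ ω ∂P, ∑ k, π k ω = 1
  weight_mean : ∀ k, ∫ ω, π k ω ∂P = 1 / N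
  weight_variance : ∀ k, ∫ ω, (π k ω - 1 / N) ^ 2 ∂P = σπ2 k

namespace MixingStep

variable {μ : Ω → ℝ} {π : Fin N → Ω → ℝ} {μbar σμ2 μub : ℝ} {σπ2 : Fin N → ℝ}

theorem weight_mem (h : MixingStep mG P μ π μbar σμ2 μub σπ2) :
    ∀ᵐ ω ∂P, ∀ k, π k ω ∈ Set.Icc 0 1 := by
  filter_upwards [ae_all_iff.2 h.weight_nonneg, h.weight_sum] with ω h1 h2 k
  exact ⟨h1 k, (Finset.single_le_sum (f := fun j => π j ω) (fun j _ => h1 j) (Finset.mem_univ k)).trans_eq h2⟩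

/-- The indicator of `B` is absorbed into the `mG`-measurable factor, and independence is used
twice. No integrability is needed: the product formula for independent functions holds with the
default value of the integral as well. -/
theorem integral_mul_mul (h : MixingStep mG P μ π μbar σμ2 μub σπ2) {f : ℝ → ℝ}
    {g : (Fin N → ℝ) → ℝ} (hf : Measurable f) (hg : Measurable g) {φ : Ω → ℝ}
    (hφ : Measurable[mG] φ) {B : Set Ω} (hB : MeasurableSet[mG] B) :
    ∫ ω in B, f (μ ω) * g (fun k => π k ω) * φ ω ∂P =
      (∫ ω, f (μ ω) ∂P) * (∫ ω, g (fun k => π k ω) ∂P) * ∫ ω in B, φ ω ∂P := by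
  have hB' := h.le _ hB
  have hπ : Measurable (fun ω k => π k ω) := measurable_pi_lambda _ h.measurable_weight
  rw [← integral_indicator hB', ← integral_indicator hB']
  have e : (B.indicator fun ω => f (μ ω) * g (fun k => π k ω) * φ ω) =
      fun ω => (f (μ ω) * g (fun k => π k ω)) * B.indicator φ ω := by
    ext ω
    by_cases hω : ω ∈ B <;> simp [hω]
  have hφB : Measurable[mG] (B.indicator φ) := hφ.indicator hB
  have i1 : IndepFun (fun ω => f (μ ω) * g (fun k => π k ω)) (B.indicator φ) P := by
    rw [IndepFun_iff_Indep]
    refine indep_of_indep_of_le_left (indep_of_indep_of_le_right h.indep hφB.comap_le) ?_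
    refine Measurable.comap_le (Measurable.mul ?_ ?_)
    · exact hf.comp ((comap_measurable μ).mono le_sup_left le_rfl)
    · exact hg.comp ((comap_measurable (fun ω k => π k ω)).mono le_sup_right le_rfl)
  have i2 : IndepFun (fun ω => f (μ ω)) (fun ω => g (fun k => π k ω)) P := by
    rw [IndepFun_iff_Indep]
    refine indep_of_indep_of_le_left (indep_of_indep_of_le_right h.indep_step_weight ?_) ?_
    · exact Measurable.comap_le (hg.comp (comap_measurable (fun ω k => π k ω)))
    · exact Measurable.comap_le (hf.comp (comap_measurable μ))
  have m1 := hf.comp h.measurable_step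
  have m2 := hg.comp hπ
  rw [e, i1.integral_fun_mul_eq_mul_integral (m1.mul m2).aestronglyMeasurable
    (hφB.mono h.le le_rfl).aestronglyMeasurable,
    i2.integral_fun_mul_eq_mul_integral m1.aestronglyMeasurable m2.aestronglyMeasurable]

theorem integral_step_mul [IsProbabilityMeasure P] (h : MixingStep mG P μ π μbar σμ2 μub σπ2) {f : ℝ → ℝ}
    (hf : Measurable f) {φ : Ω → ℝ} (hφ : Measurable[mG] φ) {B : Set Ω}
    (hB : MeasurableSet[mG] B) :
    ∫ ω in B, f (μ ω) * φ ω ∂P = (∫ ω, f (μ ω) ∂P) * ∫ ω in B, φ ω ∂P := by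
  simpa using h.integral_mul_mul hf (measurable_const (a := (1 : ℝ))) hφ hB

theorem integrable_pow_mul (h : MixingStep mG P μ π μbar σμ2 μub σπ2) (p : ℕ) {φ : Ω → ℝ}
    {B : Set Ω} (hφ : IntegrableOn φ B P) : IntegrableOn (fun ω => μ ω ^ p * φ ω) B P := by
  refine hφ.bdd_mul (c := μub ^ p) (h.measurable_step.pow_const p).aestronglyMeasurable ?_
  filter_upwards [ae_restrict_of_ae h.bounded] with ω hω
  rw [norm_pow, Real.norm_eq_abs, abs_of_nonneg hω.1]
  exact pow_le_pow_left₀ hω.1 hω.2 p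

theorem integrable_weight_mul (h : MixingStep mG P μ π μbar σμ2 μub σπ2) (k : Fin N) {φ : Ω → ℝ}
    {B : Set Ω} (hφ : IntegrableOn φ B P) : IntegrableOn (fun ω => π k ω * φ ω) B P := by
  refine hφ.bdd_mul (c := 1) (h.measurable_weight k).aestronglyMeasurable ?_
  filter_upwards [ae_restrict_of_ae h.weight_mem] with ω hω
  rw [Real.norm_eq_abs, abs_of_nonneg (hω k).1]
  exact (hω k).2

variable [IsProbabilityMeasure P]

theorem integrable_pow (h : MixingStep mG P μ π μbar σμ2 μub σπ2) (p : ℕ) :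
    Integrable (fun ω => μ ω ^ p) P := by
  have := h.integrable_pow_mul p (integrableOn_univ.2 (integrable_const (μ := P) (1 : ℝ)))
  simpa using this

theorem integrable_weight (h : MixingStep mG P μ π μbar σμ2 μub σπ2) (k : Fin N) :
    Integrable (π k) P := by
  have := h.integrable_weight_mul k (integrableOn_univ.2 (integrable_const (μ := P) (1 : ℝ)))
  simpa using this

theorem integrable_weight_mul_weight (h : MixingStep mG P μ π μbar σμ2 μub σπ2) (k l : Fin N) :
    Integrable (fun ω => π k ω * π l ω) P := by
  have := h.integrable_weight_mul k (integrableOn_univ.2 (h.integrable_weight l))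
  simpa using this

theorem integral_sq (h : MixingStep mG P μ π μbar σμ2 μub σπ2) :
    ∫ ω, μ ω ^ 2 ∂P = μbar ^ 2 + σμ2 := by
  have h1 : Integrable μ P := by simpa using h.integrable_pow 1
  have h2 := h.integrable_pow 2
  rw [← h.variance]
  have e : ∀ ω, (μ ω - μbar) ^ 2 = μ ω ^ 2 - (2 * μbar * μ ω - μbar ^ 2) := fun ω => by ring
  have h3 : Integrable (fun ω => 2 * μbar * μ ω - μbar ^ 2) P :=
    (h1.const_mul _).sub (integrable_const _)
  simp only [e]
  rw [integral_sub h2 h3,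
    integral_sub (h1.const_mul _) (integrable_const _), integral_const_mul, h.mean]
  simp
  ring

/-- Only two of the four powers are bounded by `μub`. The remaining second moment keeps a factor
`μbar * μ_x`, so that `μub² ≤ c μ_x` makes the whole of order `μbar * μ_x²`. -/
theorem integral_pow_four_le (h : MixingStep mG P μ π μbar σμ2 μub σπ2) :
    ∫ ω, μ ω ^ 4 ∂P ≤ μub ^ 2 * (μbar ^ 2 + σμ2) := by
  rw [← h.integral_sq, ← integral_const_mul]
  refine integral_mono_ae (h.integrable_pow 4) ((h.integrable_pow 2).const_mul _) ?_
  filter_upwards [h.bounded] with ω hω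
  have : μ ω ^ 2 ≤ μub ^ 2 := pow_le_pow_left₀ hω.1 hω.2 2
  calc μ ω ^ 4 = μ ω ^ 2 * μ ω ^ 2 := by ring
    _ ≤ _ := by gcongr

theorem integral_weight_mul_weight (h : MixingStep mG P μ π μbar σμ2 μub σπ2) (k l : Fin N) :
    ∫ ω, π k ω * π l ω ∂P =
      1 / (N : ℝ) ^ 2 + ∫ ω, (π k ω - 1 / N) * (π l ω - 1 / N) ∂P := by
  have h1 := h.integrable_weight k
  have h2 := h.integrable_weight l
  have e : ∀ ω, (π k ω - 1 / N) * (π l ω - 1 / N) =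
      π k ω * π l ω - (1 / N * π k ω + 1 / N * π l ω - 1 / (N : ℝ) ^ 2) := fun ω => by ring
  have h3 : Integrable (fun ω => 1 / N * π k ω + 1 / N * π l ω) P :=
    (h1.const_mul _).add (h2.const_mul _)
  have h4 : Integrable (fun ω => 1 / N * π k ω + 1 / N * π l ω - 1 / (N : ℝ) ^ 2) P :=
    h3.sub (integrable_const _)
  simp only [e]
  rw [integral_sub (h.integrable_weight_mul_weight k l) h4, integral_sub h3 (integrable_const _),
    integral_add (h1.const_mul _) (h2.const_mul _), integral_const_mul, integral_const_mul,
    h.weight_mean, h.weight_mean]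
  simp
  ring

theorem integral_weight_sq (h : MixingStep mG P μ π μbar σμ2 μub σπ2) (k : Fin N) :
    ∫ ω, π k ω * π k ω ∂P = 1 / (N : ℝ) ^ 2 + σπ2 k := by
  rw [h.integral_weight_mul_weight, ← h.weight_variance k]
  simp only [pow_two]

theorem weight_quadratic_nonneg (h : MixingStep mG P μ π μbar σμ2 μub σπ2) (g : Fin N → E) :
    0 ≤ ∑ k, ∑ l, (∫ ω, π k ω * π l ω ∂P) * ⟪g k, g l⟫ := by
  rw [sum_integral_mul_inner h.integrable_weight_mul_weight]
  positivity

/-- Weights in `[0, 1]` with sum one have `∑ π_k² ≤ 1`, so Cauchy–Schwarz suffices. This crude bound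
serves where only the order of magnitude counts. -/
theorem weight_quadratic_le_sum (h : MixingStep mG P μ π μbar σμ2 μub σπ2) (g : Fin N → E) :
    ∑ k, ∑ l, (∫ ω, π k ω * π l ω ∂P) * ⟪g k, g l⟫ ≤ ∑ k, ‖g k‖ ^ 2 := by
  rw [sum_integral_mul_inner h.integrable_weight_mul_weight]
  calc ∫ ω, ‖∑ k, π k ω • g k‖ ^ 2 ∂P ≤ ∫ _, ∑ k, ‖g k‖ ^ 2 ∂P := by
        refine integral_mono_ae (integrable_norm_sq_sum_smul h.integrable_weight_mul_weight g)
          (integrable_const _) ?_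
        filter_upwards [h.weight_mem, h.weight_sum] with ω h1 h2
        refine (norm_sq_sum_smul_le _ _).trans (mul_le_of_le_one_left (by positivity) ?_)
        rw [← h2]
        exact Finset.sum_le_sum fun k _ => by nlinarith [(h1 k).1, (h1 k).2]
    _ = _ := by simp

/-- Splitting the second moments into means and covariances gives a rank-one part, kept exactly, and
a covariance part estimated by Cauchy–Schwarz. This sharper bound yields the constant in
`alphaCent`. -/
theorem weight_quadratic_le (h : MixingStep mG P μ π μbar σμ2 μub σπ2) (g : Fin N → E) :
    ∑ k, ∑ l, (∫ ω, π k ω * π l ω ∂P) * ⟪g k, g l⟫ ≤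
      1 / (N : ℝ) ^ 2 * ‖∑ k, g k‖ ^ 2 + (∑ k, σπ2 k) * ∑ k, ‖g k‖ ^ 2 := by
  have hint : ∀ k l, Integrable (fun ω => (π k ω - 1 / N) * (π l ω - 1 / N)) P := fun k l => by
    have e : ∀ ω, (π k ω - 1 / N) * (π l ω - 1 / N) =
      π k ω * π l ω - (1 / N * π k ω + 1 / N * π l ω - 1 / (N : ℝ) ^ 2) := fun ω => by ring
    simp only [e]
    exact (h.integrable_weight_mul_weight k l).sub
      ((((h.integrable_weight k).const_mul _).add ((h.integrable_weight l).const_mul _)).sub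
        (integrable_const _))
  simp only [h.integral_weight_mul_weight, add_mul, Finset.sum_add_distrib]
  refine add_le_add (le_of_eq ?_) ?_
  · rw [← real_inner_self_eq_norm_sq, sum_inner]
    simp only [inner_sum, Finset.mul_sum]
  · rw [sum_integral_mul_inner hint g]
    have hint2 : ∀ k, Integrable (fun ω => (π k ω - 1 / N) ^ 2) P := fun k => by
      simpa only [pow_two] using hint k k
    calc ∫ ω, ‖∑ k, (π k ω - 1 / N) • g k‖ ^ 2 ∂P
        ≤ ∫ ω, (∑ k, (π k ω - 1 / N) ^ 2) * ∑ k, ‖g k‖ ^ 2 ∂P := by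
          refine integral_mono (integrable_norm_sq_sum_smul hint g)
            ((integrable_finsetSum _ fun k _ => hint2 k).mul_const _) fun ω => ?_
          exact norm_sq_sum_smul_le _ _
      _ = _ := by
          rw [integral_mul_const, integral_finsetSum _ fun k _ => hint2 k]
          simp only [h.weight_variance]

variable [MeasurableSpace E] [BorelSpace E] [SecondCountableTopology E]

/-- Exact second-moment identity for one step. -/
theorem integral_norm_sq (h : MixingStep mG P μ π μbar σμ2 μub σπ2) {X : Ω → E}
    {G S : Fin N → Ω → E} {B : Set Ω} (hB : MeasurableSet[mG] B)
    (hX : Measurable[mG] X) (hG : ∀ k, Measurable[mG] (G k)) (hS : ∀ k, Measurable[mG] (S k))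
    (hX2 : MemLp X 2 P) (hG2 : ∀ k, MemLp (G k) 2 P) (hS2 : ∀ k, MemLp (S k) 2 P)
    (hXS : ∀ k, ∫ ω in B, ⟪X ω, S k ω⟫ ∂P = 0) (hGS : ∀ k l, ∫ ω in B, ⟪G k ω, S l ω⟫ ∂P = 0)
    (hSS : ∀ k l, k ≠ l → ∫ ω in B, ⟪S k ω, S l ω⟫ ∂P = 0) :
    ∫ ω in B, ‖X ω - μ ω • ∑ k, π k ω • (G k ω + S k ω)‖ ^ 2 ∂P =
      ∫ ω in B, ‖X ω‖ ^ 2 ∂P - 2 * (μbar / N) * ∑ k, ∫ ω in B, ⟪X ω, G k ω⟫ ∂P +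
        (μbar ^ 2 + σμ2) * (∑ k, ∑ l, (∫ ω, π k ω * π l ω ∂P) * ∫ ω in B, ⟪G k ω, G l ω⟫ ∂P +
          ∑ k, (1 / (N : ℝ) ^ 2 + σπ2 k) * ∫ ω in B, ‖S k ω‖ ^ 2 ∂P) := by
  have hD : ∀ k, Measurable[mG] fun ω => G k ω + S k ω := fun k => (hG k).add (hS k)
  have hD2 : ∀ k, MemLp (fun ω => G k ω + S k ω) 2 P := fun k => (hG2 k).add (hS2 k)
  have hin : ∀ {Y Z : Ω → E}, MemLp Y 2 P → MemLp Z 2 P →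
      IntegrableOn (fun ω => ⟪Y ω, Z ω⟫) B P := fun hY hZ => (hY.integrable_real_inner hZ).integrableOn
  have hlin : ∀ k, IntegrableOn (fun ω => μ ω ^ 1 * (π k ω * ⟪X ω, G k ω + S k ω⟫)) B P :=
    fun k => h.integrable_pow_mul 1 (h.integrable_weight_mul k (hin hX2 (hD2 k)))
  have hquad : ∀ k l, IntegrableOn
      (fun ω => μ ω ^ 2 * (π k ω * (π l ω * ⟪G k ω + S k ω, G l ω + S l ω⟫))) B P :=
    fun k l => h.integrable_pow_mul 2 (h.integrable_weight_mul k
      (h.integrable_weight_mul l (hin (hD2 k) (hD2 l))))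
  have hexp : ∀ ω, ‖X ω - μ ω • ∑ k, π k ω • (G k ω + S k ω)‖ ^ 2 =
      ‖X ω‖ ^ 2 - 2 * (∑ k, μ ω ^ 1 * (π k ω * ⟪X ω, G k ω + S k ω⟫)) +
      ∑ k, ∑ l, μ ω ^ 2 * (π k ω * (π l ω * ⟪G k ω + S k ω, G l ω + S l ω⟫)) := by
    intro ω
    rw [norm_sub_sq_real, norm_smul, mul_pow, norm_sq_sum_smul_eq, real_inner_smul_right, inner_sum,
      Real.norm_eq_abs, sq_abs]
    simp only [Finset.mul_sum, real_inner_smul_right, pow_one, mul_assoc]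
  simp only [hexp]
  have hX2' : IntegrableOn (fun ω => ‖X ω‖ ^ 2) B P := by
    have := hin hX2 hX2
    simpa only [real_inner_self_eq_norm_sq] using this
  have I1 : IntegrableOn (fun ω => 2 * ∑ k, μ ω ^ 1 * (π k ω * ⟪X ω, G k ω + S k ω⟫)) B P :=
    (integrable_finsetSum _ fun k _ => hlin k).const_mul 2
  have I2 : IntegrableOn (fun ω => ∑ k, ∑ l,
      μ ω ^ 2 * (π k ω * (π l ω * ⟪G k ω + S k ω, G l ω + S l ω⟫))) B P :=
    integrable_finsetSum _ fun k _ => integrable_finsetSum _ fun l _ => hquad k l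
  have I0 : IntegrableOn (fun ω => ‖X ω‖ ^ 2 -
      2 * ∑ k, μ ω ^ 1 * (π k ω * ⟪X ω, G k ω + S k ω⟫)) B P := hX2'.sub I1
  rw [integral_add I0 I2, integral_sub hX2' I1, integral_const_mul,
    integral_finsetSum _ fun k _ => hlin k,
    integral_finsetSum _ fun k _ => integrable_finsetSum _ fun l _ => hquad k l]
  have E1 : ∀ k, ∫ ω in B, μ ω ^ 1 * (π k ω * ⟪X ω, G k ω + S k ω⟫) ∂P =
      μbar / N * ∫ ω in B, ⟪X ω, G k ω⟫ ∂P := by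
    intro k
    have := h.integral_mul_mul (f := fun x => x) (g := fun p => p k) measurable_id
      (measurable_pi_apply k) (hX.inner (hD k)) hB
    simp only [pow_one, ← mul_assoc]
    rw [this, h.mean, h.weight_mean]
    simp only [inner_add_right]
    rw [integral_add (hin hX2 (hG2 k)) (hin hX2 (hS2 k)), hXS, add_zero]
    ring
  have E2 : ∀ k l, ∫ ω in B, μ ω ^ 2 * (π k ω * (π l ω * ⟪G k ω + S k ω, G l ω + S l ω⟫)) ∂P =
      (μbar ^ 2 + σμ2) * ((∫ ω, π k ω * π l ω ∂P) *
        (∫ ω in B, ⟪G k ω, G l ω⟫ ∂P + ∫ ω in B, ⟪S k ω, S l ω⟫ ∂P)) := by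
    intro k l
    have := h.integral_mul_mul (f := fun x => x ^ 2) (g := fun p => p k * p l)
      (measurable_id.pow_const 2) ((measurable_pi_apply k).mul (measurable_pi_apply l))
      ((hD k).inner (hD l)) hB
    have e : ∀ ω, μ ω ^ 2 * (π k ω * (π l ω * ⟪G k ω + S k ω, G l ω + S l ω⟫)) =
        μ ω ^ 2 * (π k ω * π l ω) * ⟪G k ω + S k ω, G l ω + S l ω⟫ := fun ω => by ring
    simp only [e]
    rw [this, h.integral_sq, mul_assoc]
    simp only [inner_add_right, inner_add_left]
    have hSG : ∫ ω in B, ⟪S k ω, G l ω⟫ ∂P = 0 := by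
      rw [← hGS l k]
      simp only [real_inner_comm]
    have i1 : IntegrableOn (fun ω => ⟪G k ω, G l ω⟫ + ⟪S k ω, G l ω⟫) B P :=
      (hin (hG2 k) (hG2 l)).add (hin (hS2 k) (hG2 l))
    have i2 : IntegrableOn (fun ω => ⟪G k ω, S l ω⟫ + ⟪S k ω, S l ω⟫) B P :=
      (hin (hG2 k) (hS2 l)).add (hin (hS2 k) (hS2 l))
    rw [integral_add i1 i2,
      integral_add (hin (hG2 k) (hG2 l)) (hin (hS2 k) (hG2 l)),
      integral_add (hin (hG2 k) (hS2 l)) (hin (hS2 k) (hS2 l)), hGS, hSG]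
    ring
  -- Correlations between different weights disappear here because the noises of different agents
  -- are orthogonal; only `E[π_k²]` survives.
  have hdiag : ∀ k, ∑ l, (∫ ω, π k ω * π l ω ∂P) * ∫ ω in B, ⟪S k ω, S l ω⟫ ∂P =
      (1 / (N : ℝ) ^ 2 + σπ2 k) * ∫ ω in B, ‖S k ω‖ ^ 2 ∂P := by
    intro k
    rw [Finset.sum_eq_single k (fun l _ hl => by rw [hSS k l hl.symm, mul_zero])
      (fun hk => absurd (Finset.mem_univ k) hk), h.integral_weight_sq]
    simp only [real_inner_self_eq_norm_sq]
  have E3 : ∀ k, ∫ ω in B, ∑ l,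
      μ ω ^ 2 * (π k ω * (π l ω * ⟪G k ω + S k ω, G l ω + S l ω⟫)) ∂P = (μbar ^ 2 + σμ2) *
      (∑ l, (∫ ω, π k ω * π l ω ∂P) * ∫ ω in B, ⟪G k ω, G l ω⟫ ∂P +
        (1 / (N : ℝ) ^ 2 + σπ2 k) * ∫ ω in B, ‖S k ω‖ ^ 2 ∂P) := by
    intro k
    rw [integral_finsetSum _ fun l _ => hquad k l, ← hdiag, ← Finset.sum_add_distrib,
      Finset.mul_sum]
    exact Finset.sum_congr rfl fun l _ => by rw [E2, mul_add]
  rw [Finset.sum_congr rfl fun k _ => E3 k, Finset.sum_congr rfl fun k _ => E1 k,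
    ← Finset.mul_sum, ← Finset.mul_sum, Finset.sum_add_distrib]
  ring

end MixingStep

end Mixing

/-- Convex costs with a common minimizer and a strongly convex, smooth aggregate. -/
structure CostSystem {M N : ℕ} (J : Fin N → Vec M → ℝ) (wo : Vec M) (ν δ : ℝ) : Prop where
  diff : ∀ k, TwiceDifferentiable (J k)
  conv : ∀ k, ConvexOn ℝ Set.univ (J k)
  min : ∀ k, IsMinOn (J k) Set.univ wo
  cost : CostCond (aggregateCost J) ν δ

/-! ### Testing conditional moment conditions on events of the past. -/

section CondExp

open scoped RealInnerProductSpace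

variable {Ω : Type*} {m : MeasurableSpace Ω} {mΩ : MeasurableSpace Ω} {P : Measure Ω}
  [IsFiniteMeasure P]

theorem integral_inner_eq_zero_of_condExp {F : Type*} [NormedAddCommGroup F]
    [InnerProductSpace ℝ F] [CompleteSpace F] (hm : m ≤ mΩ) {y s : Ω → F}
    (hy : StronglyMeasurable[m] y) (hys : Integrable (fun ω => ⟪y ω, s ω⟫) P)
    (hs : Integrable s P) (h0 : P[s | m] =ᵐ[P] 0) : ∫ ω, ⟪y ω, s ω⟫ ∂P = 0 := by
  have h1 := condExp_bilin_of_stronglyMeasurable_left (B := innerSL ℝ) hy hys hs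
  rw [← integral_condExp hm]
  refine integral_eq_zero_of_ae ?_
  filter_upwards [h1, h0] with ω h2 h3
  refine h2.trans ?_
  rw [h3]
  simp

theorem setIntegral_inner_eq_zero_of_condExp {F : Type*} [NormedAddCommGroup F]
    [InnerProductSpace ℝ F] [CompleteSpace F] (hm : m ≤ mΩ) {y s : Ω → F} {B : Set Ω}
    (hB : MeasurableSet[m] B)
    (hy : StronglyMeasurable[m] y) (hys : IntegrableOn (fun ω => ⟪y ω, s ω⟫) B P)
    (hs : Integrable s P) (h0 : P[s | m] =ᵐ[P] 0) : ∫ ω in B, ⟪y ω, s ω⟫ ∂P = 0 := by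
  have e : ∀ ω, B.indicator (fun ω => ⟪y ω, s ω⟫) ω = ⟪B.indicator y ω, s ω⟫ := fun ω => by
    by_cases hω : ω ∈ B <;> simp [hω]
  rw [← integral_indicator (hm _ hB)]
  simp only [e]
  refine integral_inner_eq_zero_of_condExp hm (hy.indicator hB) ?_ hs h0
  simpa only [← funext e] using hys.integrable_indicator (hm _ hB)

/-- The indicator of `B` and the factor `f` are both `m`-measurable and are pulled out together. The
function `h` itself need not be integrable, only `f * h` on `B`; this is needed for fourth moments
that are finite only on `B`. -/
theorem setIntegral_mul_le_of_condExp_le (hm : m ≤ mΩ) {f g h : Ω → ℝ} {B : Set Ω}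
    (hB : MeasurableSet[m] B) (hf : StronglyMeasurable[m] f) (hf0 : ∀ ω, 0 ≤ f ω)
    (hfg : IntegrableOn (fun ω => f ω * g ω) B P) (hg : Integrable g P)
    (hfh : IntegrableOn (fun ω => f ω * h ω) B P) (hle : P[g | m] ≤ᵐ[P] h) :
    ∫ ω in B, f ω * g ω ∂P ≤ ∫ ω in B, f ω * h ω ∂P := by
  have hB' := hm _ hB
  have e : ∀ (g : Ω → ℝ) (ω : Ω), B.indicator (fun ω => f ω * g ω) ω = B.indicator f ω * g ω :=
    fun g ω => by by_cases hω : ω ∈ B <;> simp [hω]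
  have i1 : Integrable (fun ω => B.indicator f ω * g ω) P := by
    simpa only [← funext (e g)] using hfg.integrable_indicator hB'
  have i2 : Integrable (fun ω => B.indicator f ω * h ω) P := by
    simpa only [← funext (e h)] using hfh.integrable_indicator hB'
  rw [← integral_indicator hB', ← integral_indicator hB']
  simp only [e]
  have h1 := condExp_mul_of_stronglyMeasurable_left (μ := P) (hf.indicator hB) i1 hg
  rw [← integral_condExp hm]
  refine integral_mono_ae integrable_condExp i2 ?_
  filter_upwards [h1, hle] with ω h2 h3
  refine h2.trans_le ?_
  exact mul_le_mul_of_nonneg_left h3 (Set.indicator_nonneg (fun ω _ => hf0 ω) ω)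

end CondExp

/-! ### The information available before each step, and measurability of the iterates. -/

namespace CentralizedAlgorithm

variable {M N : ℕ} {Ω : Type*}

/-- The σ-algebra of the data and of all step-sizes and fusion coefficients before time `i`. -/
@[reducible] def info (A : CentralizedAlgorithm M N Ω) (D : MeasurableSpace Ω) (i : ℕ) :
    MeasurableSpace Ω :=
  ⨆ s ∈ {s : Option (ℕ ⊕ ℕ) | ∀ t, s = some t → Sum.elim id id t < i}, A.source D s

variable {A : CentralizedAlgorithm M N Ω} {D : MeasurableSpace Ω}

theorem le_info (i : ℕ) : D ≤ A.info D i :=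
  le_iSup₂_of_le (f := fun s (_ : s ∈ {s : Option (ℕ ⊕ ℕ) | ∀ t, s = some t →
    Sum.elim id id t < i}) => A.source D s) none (by simp) le_rfl

theorem info_mono {i j : ℕ} (hij : i ≤ j) : A.info D i ≤ A.info D j :=
  biSup_mono fun _ hs t ht => (hs t ht).trans_le hij

theorem measurable_step_info (i : ℕ) : Measurable[A.info D (i + 1)] (A.step i) := by
  refine measurable_iff_comap_le.2 ?_
  exact le_iSup₂_of_le (f := fun s (_ : s ∈ {s : Option (ℕ ⊕ ℕ) | ∀ t, s = some t →
    Sum.elim id id t < i + 1}) => A.source D s) (some (Sum.inl i))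
    (by simp) le_rfl

theorem measurable_fusion_info (i : ℕ) (k : Fin N) :
    Measurable[A.info D (i + 1)] (A.fusion i k) := by
  have : Measurable[A.info D (i + 1)] (fun ω k => A.fusion i k ω) := by
    refine measurable_iff_comap_le.2 ?_
    exact le_iSup₂_of_le (f := fun s (_ : s ∈ {s : Option (ℕ ⊕ ℕ) | ∀ t, s = some t →
      Sum.elim id id t < i + 1}) => A.source D s) (some (Sum.inr i))
      (by simp) le_rfl
  exact (measurable_pi_apply k).comp this

/-- The random field is jointly measurable in the point and in `D`, and `D` belongs to the
information at all times. Evaluating the field of time `i` at a known random point therefore reveals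
nothing about the current step-size and weights. -/
theorem measurable_approxGrad_comp
    (hg : ∀ i k, Measurable[(inferInstance : MeasurableSpace (Vec M)).prod D]
      (fun p : Vec M × Ω => A.approxGrad i k p.1 p.2)) {i : ℕ} (k : Fin N) {v : Ω → Vec M}
    (hv : Measurable[A.info D i] v) :
    Measurable[A.info D i] (fun ω => A.approxGrad i k (v ω) ω) := by
  have h1 : @Measurable _ _ (A.info D i) ((inferInstance : MeasurableSpace (Vec M)).prod D)
      (fun ω => (v ω, ω)) :=
    Measurable.prodMk hv (measurable_id'' (le_info i))
  exact (hg i k).comp h1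

theorem measurable_iter_info (hinit : Measurable[D] A.init)
    (hg : ∀ i k, Measurable[(inferInstance : MeasurableSpace (Vec M)).prod D]
      (fun p : Vec M × Ω => A.approxGrad i k p.1 p.2)) (i : ℕ) :
    Measurable[A.info D i] (A.iter i) := by
  induction i with
  | zero => exact hinit.mono (le_info 0) le_rfl
  | succ i ih =>
    have hle : A.info D i ≤ A.info D (i + 1) := info_mono (Nat.le_succ i)
    refine (ih.mono hle le_rfl).sub ((measurable_step_info i).smul ?_)
    refine Finset.measurable_fun_sum _ fun k _ => (measurable_fusion_info i k).smul ?_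
    exact (measurable_approxGrad_comp hg k ih).mono hle le_rfl

theorem past_le_info (hinit : Measurable[D] A.init)
    (hg : ∀ i k, Measurable[(inferInstance : MeasurableSpace (Vec M)).prod D]
      (fun p : Vec M × Ω => A.approxGrad i k p.1 p.2)) (i : ℕ) : A.past i ≤ A.info D i :=
  iSup₂_le fun j hj => ((measurable_iter_info hinit hg j).mono (info_mono hj) le_rfl).comap_le

theorem measurable_iter_past (i : ℕ) : Measurable[A.past i] (A.iter i) := by
  refine measurable_iff_comap_le.2 ?_
  exact le_iSup₂_of_le (f := fun j (_ : j ∈ Set.Iic i) =>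
    MeasurableSpace.comap (A.iter j) inferInstance) i (Set.mem_Iic.2 le_rfl) le_rfl

theorem past_mono {i j : ℕ} (hij : i ≤ j) : A.past i ≤ A.past j :=
  biSup_mono fun _ hk => le_trans hk hij

theorem source_le {mΩ : MeasurableSpace Ω} (hD : D ≤ mΩ) (hs : ∀ i, Measurable (A.step i))
    (hf : ∀ i k, Measurable (A.fusion i k)) (s : Option (ℕ ⊕ ℕ)) : A.source D s ≤ mΩ := by
  rcases s with _ | i | i
  · exact hD
  · exact (hs i).comap_le
  · exact (measurable_pi_lambda _ (hf i)).comap_le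

end CentralizedAlgorithm

/-! ### Integrability of the iterates and the mean-square recursion. -/

section Model

set_option linter.unusedSectionVars false

open scoped RealInnerProductSpace

variable {M N : ℕ} {Ω : Type*} {mΩ : MeasurableSpace Ω} {P : Measure Ω}
  {A : CentralizedAlgorithm M N Ω} {J : Fin N → Vec M → ℝ} {wo : Vec M}
  {β2 σs2 σπ2 : Fin N → ℝ} {μbar σμ2 μub : ℝ} {ν δ : ℝ}

namespace AsyncCentralizedModel

theorem iter_succ_sub (i : ℕ) (ω : Ω) : A.iter (i + 1) ω - wo = (A.iter i ω - wo) -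
    A.step i ω • ∑ k, A.fusion i k ω •
      (gradient (J k) (A.iter i ω) + A.noise J i k (A.iter i) ω) := by
  simp only [CentralizedAlgorithm.iter, CentralizedAlgorithm.noise, add_sub_cancel]
  abel

theorem memLp_coord {x : Ω → Vec M} {p : ENNReal} (hx : MemLp x p P) (a : Fin M) :
    MemLp (fun ω => x ω a) p P :=
  hx.of_le ((EuclideanSpace.proj (𝕜 := ℝ) a).continuous.comp_aestronglyMeasurable hx.1)
    (ae_of_all _ fun ω => PiLp.norm_apply_le (x ω) a)

theorem variance_nonneg (h : AsyncCentralizedModel P A J wo β2 σs2 σπ2 μbar σμ2 μub) :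
    0 ≤ σμ2 := h.step.variance 0 ▸ integral_nonneg fun _ => sq_nonneg _

theorem fusion_variance_nonneg (h : AsyncCentralizedModel P A J wo β2 σs2 σπ2 μbar σμ2 μub)
    (k : Fin N) : 0 ≤ σπ2 k := h.fusion.variance 0 k ▸ integral_nonneg fun _ => sq_nonneg _

/-- The second moment of the step-size, factored so that `μbar` matches the contraction rate and
`μ_x` is what remains in steady state. -/
theorem mul_muX (h : AsyncCentralizedModel P A J wo β2 σs2 σπ2 μbar σμ2 μub) :
    μbar * muX μbar σμ2 = μbar ^ 2 + σμ2 := by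
  have := h.step.mean_pos
  rw [muX]
  field_simp

theorem le_muX (h : AsyncCentralizedModel P A J wo β2 σs2 σπ2 μbar σμ2 μub) :
    μbar ≤ muX μbar σμ2 :=
  le_add_of_nonneg_right (div_nonneg h.variance_nonneg h.step.mean_pos.le)

theorem muX_pos (h : AsyncCentralizedModel P A J wo β2 σs2 σπ2 μbar σμ2 μub) :
    0 < muX μbar σμ2 := h.step.mean_pos.trans_le h.le_muX

variable [IsProbabilityMeasure P]

/-- The σ-algebra is generated by `D` and by the step-sizes and weights of times before `i`. It is
independent of those of time `i` because the index sets are disjoint. It is larger than the past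
since the noise of time `i` must be measurable for it too. -/
theorem exists_mixingStep (h : AsyncCentralizedModel P A J wo β2 σs2 σπ2 μbar σμ2 μub)
    (hJ : CostSystem J wo ν δ) (i : ℕ) : ∃ mG : MeasurableSpace Ω,
      MixingStep mG P (A.step i) (A.fusion i) μbar σμ2 μub σπ2 ∧ A.past i ≤ mG ∧
      ∀ k v, Measurable[mG] v → Measurable[mG] (A.noise J i k v) := by
  have hstep := h.step
  have hfusion := h.fusion
  have hmeas := hstep.measurable
  have hmeas' := hfusion.measurable
  have hb := hstep.bounded i
  have hmean := hstep.mean i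
  have hvar := hstep.variance i
  have hn := hfusion.nonneg i
  have hsum := hfusion.sum_eq_one i
  have hfm := hfusion.mean i
  have hfv := hfusion.variance i
  obtain ⟨D, hD, hinit, hg, hind⟩ := h.indep
  have hsrc := CentralizedAlgorithm.source_le hD hmeas hmeas'
  refine ⟨A.info D i, ?_, CentralizedAlgorithm.past_le_info hinit hg i, fun k v hv => ?_⟩
  · refine ⟨iSup₂_le fun s _ => hsrc s, hmeas i, hmeas' i, ?_, ?_, hb, hmean, hvar,
      hn, hsum, hfm, hfv⟩
    · exact hind.indep (i := some (Sum.inl i)) (j := some (Sum.inr i)) (by simp)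
    · have hdis : Disjoint {some (Sum.inl i), some (Sum.inr i)}
          {s : Option (ℕ ⊕ ℕ) | ∀ t, s = some t → Sum.elim id id t < i} := by
        rw [Set.disjoint_left]
        rintro s (rfl | rfl) hs
        · exact absurd (hs _ rfl) (by simp)
        · exact absurd (hs _ rfl) (by simp)
      refine indep_of_indep_of_le_left (indep_iSup_of_disjoint hsrc hind hdis) (sup_le ?_ ?_)
      · exact le_iSup₂_of_le (f := fun s (_ : s ∈ ({some (Sum.inl i), some (Sum.inr i)} :
          Set (Option (ℕ ⊕ ℕ)))) => A.source D s) (some (Sum.inl i)) (by simp) le_rfl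
      · exact le_iSup₂_of_le (f := fun s (_ : s ∈ ({some (Sum.inl i), some (Sum.inr i)} :
          Set (Option (ℕ ⊕ ℕ)))) => A.source D s) (some (Sum.inr i)) (by simp) le_rfl
  · exact (CentralizedAlgorithm.measurable_approxGrad_comp hg k hv).sub
      ((hJ.diff k).continuous_gradient.measurable.comp hv)

theorem past_le (h : AsyncCentralizedModel P A J wo β2 σs2 σπ2 μbar σμ2 μub)
    (hJ : CostSystem J wo ν δ) (i : ℕ) : A.past i ≤ mΩ := by
  obtain ⟨mG, h1, h2, -⟩ := h.exists_mixingStep hJ i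
  exact h2.trans h1.le

theorem measurable_iter (h : AsyncCentralizedModel P A J wo β2 σs2 σπ2 μbar σμ2 μub)
    (hJ : CostSystem J wo ν δ) (i : ℕ) : Measurable (A.iter i) :=
  (A.measurable_iter_past i).mono (h.past_le hJ i) le_rfl

theorem memLp_gradient (hJ : CostSystem J wo ν δ) {i : ℕ} {p : ENNReal} {B : Set Ω}
    (h : AsyncCentralizedModel P A J wo β2 σs2 σπ2 μbar σμ2 μub)
    (hX : MemLp (fun ω => A.iter i ω - wo) p (P.restrict B)) (k : Fin N) :
    MemLp (fun ω => gradient (J k) (A.iter i ω)) p (P.restrict B) := by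
  refine hX.of_le_mul (c := δ) ?_ (ae_of_all _ fun ω => ?_)
  · exact ((hJ.diff k).continuous_gradient.measurable.comp
      (h.measurable_iter hJ i)).aestronglyMeasurable
  · exact norm_gradient_le hJ.diff hJ.conv hJ.min hJ.cost k _

/-- Used with exponent 2 on the whole space, and with exponent 4 on an event where the initial error
is bounded. -/
theorem memLp_iter_succ (h : AsyncCentralizedModel P A J wo β2 σs2 σπ2 μbar σμ2 μub)
    (hJ : CostSystem J wo ν δ) {i : ℕ} {p : ENNReal} {B : Set Ω}
    (hX : MemLp (fun ω => A.iter i ω - wo) p (P.restrict B))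
    (hS : ∀ k, MemLp (A.noise J i k (A.iter i)) p (P.restrict B)) :
    MemLp (fun ω => A.iter (i + 1) ω - wo) p (P.restrict B) := by
  have hfm := h.fusion.measurable i
  have hsm := h.step.measurable i
  obtain ⟨mG, hmix, -, -⟩ := h.exists_mixingStep hJ i
  have h1 : ∀ k, MemLp (fun ω => A.fusion i k ω •
      (gradient (J k) (A.iter i ω) + A.noise J i k (A.iter i) ω)) p (P.restrict B) := by
    intro k
    have hD := (h.memLp_gradient hJ hX k).add (hS k)
    refine hD.of_le_mul (c := 1)
      ((hfm k).aestronglyMeasurable.smul hD.1) ?_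
    filter_upwards [ae_restrict_of_ae hmix.weight_mem] with ω hω
    rw [norm_smul, Real.norm_eq_abs, abs_of_nonneg (hω k).1]
    exact mul_le_mul_of_nonneg_right (hω k).2 (norm_nonneg _)
  have h2 : MemLp (fun ω => ∑ k, A.fusion i k ω •
      (gradient (J k) (A.iter i ω) + A.noise J i k (A.iter i) ω)) p (P.restrict B) :=
    memLp_finsetSum _ fun k _ => h1 k
  have h3 : MemLp (fun ω => A.step i ω • ∑ k, A.fusion i k ω •
      (gradient (J k) (A.iter i ω) + A.noise J i k (A.iter i) ω)) p (P.restrict B) := by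
    refine h2.of_le_mul (c := μub) (hsm.aestronglyMeasurable.smul h2.1) ?_
    filter_upwards [ae_restrict_of_ae hmix.bounded] with ω hω
    rw [norm_smul, Real.norm_eq_abs, abs_of_nonneg hω.1]
    exact mul_le_mul_of_nonneg_right hω.2 (norm_nonneg _)
  have h4 := hX.sub h3
  refine h4.congr_norm ?_ (ae_of_all _ fun ω => ?_)
  · exact ((h.measurable_iter hJ (i + 1)).sub_const wo).aestronglyMeasurable
  · rw [iter_succ_sub (J := J)]
    rfl

theorem memLp_iter_sub (h : AsyncCentralizedModel P A J wo β2 σs2 σπ2 μbar σμ2 μub)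
    (hJ : CostSystem J wo ν δ) (i : ℕ) : MemLp (fun ω => A.iter i ω - wo) 2 P := by
  induction i with
  | zero => exact h.init_memLp.sub (memLp_const wo)
  | succ i ih =>
    rw [← Measure.restrict_univ (μ := P)] at ih ⊢
    exact h.memLp_iter_succ hJ ih fun k => by
      rw [Measure.restrict_univ]; exact h.noise.memLp i k

theorem memLp_iter (h : AsyncCentralizedModel P A J wo β2 σs2 σπ2 μbar σμ2 μub)
    (hJ : CostSystem J wo ν δ) (i : ℕ) : MemLp (A.iter i) 2 P := by
  have := (h.memLp_iter_sub hJ i).add (memLp_const wo)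
  exact this.ae_eq (ae_of_all _ fun ω => sub_add_cancel _ _)

theorem integrable_norm_sq (h : AsyncCentralizedModel P A J wo β2 σs2 σπ2 μbar σμ2 μub)
    (hJ : CostSystem J wo ν δ) (i : ℕ) : Integrable (fun ω => ‖A.iter i ω - wo‖ ^ 2) P :=
  (h.memLp_iter_sub hJ i).integrable_norm_pow two_ne_zero

theorem setIntegral_inner_noise (h : AsyncCentralizedModel P A J wo β2 σs2 σπ2 μbar σμ2 μub)
    (hJ : CostSystem J wo ν δ) {i : ℕ} {B : Set Ω} (hB : MeasurableSet[A.past i] B)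
    {y : Ω → Vec M} (hy : Measurable[A.past i] y) (k : Fin N)
    (hys : IntegrableOn (fun ω => ⟪y ω, A.noise J i k (A.iter i) ω⟫) B P) :
    ∫ ω in B, ⟪y ω, A.noise J i k (A.iter i) ω⟫ ∂P = 0 :=
  setIntegral_inner_eq_zero_of_condExp (h.past_le hJ i) hB hy.stronglyMeasurable hys
    ((h.noise.memLp i k).integrable (by norm_num)) (h.noise.mean_zero i k)

theorem setIntegral_noise_mul (h : AsyncCentralizedModel P A J wo β2 σs2 σπ2 μbar σμ2 μub)
    (hJ : CostSystem J wo ν δ) {i : ℕ} {B : Set Ω} (hB : MeasurableSet[A.past i] B) {k l : Fin N}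
    (hkl : k ≠ l) (a b : Fin M) :
    ∫ ω in B, A.noise J i k (A.iter i) ω a * A.noise J i l (A.iter i) ω b ∂P = 0 := by
  have hi : Integrable (fun ω => A.noise J i k (A.iter i) ω a * A.noise J i l (A.iter i) ω b) P :=
    (memLp_coord (h.noise.memLp i k) a).integrable_mul (memLp_coord (h.noise.memLp i l) b)
  rw [← setIntegral_condExp (h.past_le hJ i) hi hB]
  refine integral_eq_zero_of_ae (ae_restrict_of_ae ?_)
  filter_upwards [h.noise.uncorrelated i k l hkl] with ω hω
  exact congrFun (congrFun hω a) b

theorem setIntegral_inner_mul_inner_noise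
    (h : AsyncCentralizedModel P A J wo β2 σs2 σπ2 μbar σμ2 μub)
    (hJ : CostSystem J wo ν δ) {i : ℕ} {B : Set Ω} (hB : MeasurableSet[A.past i] B) {k l : Fin N}
    (hkl : k ≠ l) (u : Vec M) :
    ∫ ω in B, ⟪u, A.noise J i k (A.iter i) ω⟫ * ⟪u, A.noise J i l (A.iter i) ω⟫ ∂P = 0 := by
  have hi : ∀ a b, Integrable
      (fun ω => A.noise J i k (A.iter i) ω a * A.noise J i l (A.iter i) ω b) P := fun a b =>
    (memLp_coord (h.noise.memLp i k) a).integrable_mul (memLp_coord (h.noise.memLp i l) b)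
  have e : ∀ ω, ⟪u, A.noise J i k (A.iter i) ω⟫ * ⟪u, A.noise J i l (A.iter i) ω⟫ =
      ∑ a, ∑ b, u a * u b * (A.noise J i k (A.iter i) ω a * A.noise J i l (A.iter i) ω b) := by
    intro ω
    simp only [PiLp.inner_apply, RCLike.inner_apply, conj_trivial, Finset.sum_mul_sum]
    exact Finset.sum_congr rfl fun a _ => Finset.sum_congr rfl fun b _ => by ring
  simp only [e]
  rw [integral_finsetSum _ fun a _ => integrable_finsetSum _ fun b _ =>
    ((hi a b).const_mul _).integrableOn]
  refine Finset.sum_eq_zero fun a _ => ?_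
  rw [integral_finsetSum _ fun b _ => ((hi a b).const_mul _).integrableOn]
  refine Finset.sum_eq_zero fun b _ => ?_
  rw [integral_const_mul, h.setIntegral_noise_mul hJ hB hkl, mul_zero]

theorem setIntegral_inner_noise_noise
    (h : AsyncCentralizedModel P A J wo β2 σs2 σπ2 μbar σμ2 μub)
    (hJ : CostSystem J wo ν δ) {i : ℕ} {B : Set Ω} (hB : MeasurableSet[A.past i] B) {k l : Fin N}
    (hkl : k ≠ l) :
    ∫ ω in B, ⟪A.noise J i k (A.iter i) ω, A.noise J i l (A.iter i) ω⟫ ∂P = 0 := by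
  simp only [PiLp.inner_apply, RCLike.inner_apply, conj_trivial]
  have hi : ∀ a, IntegrableOn
      (fun ω => A.noise J i l (A.iter i) ω a * A.noise J i k (A.iter i) ω a) B P := fun a =>
    ((memLp_coord (h.noise.memLp i l) a).integrable_mul
      (memLp_coord (h.noise.memLp i k) a)).integrableOn
  rw [integral_finsetSum _ fun a _ => hi a]
  exact Finset.sum_eq_zero fun a _ => h.setIntegral_noise_mul hJ hB hkl.symm a a

theorem setIntegral_norm_sq_noise_le
    (h : AsyncCentralizedModel P A J wo β2 σs2 σπ2 μbar σμ2 μub)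
    (hJ : CostSystem J wo ν δ) {i : ℕ} {B : Set Ω} (hB : MeasurableSet[A.past i] B) (k : Fin N) :
    ∫ ω in B, ‖A.noise J i k (A.iter i) ω‖ ^ 2 ∂P ≤
      β2 k * ∫ ω in B, ‖A.iter i ω - wo‖ ^ 2 ∂P + σs2 k * P.real B := by
  have hX := (h.integrable_norm_sq hJ i).integrableOn (s := B)
  have hi : Integrable (fun ω => β2 k * ‖wo - A.iter i ω‖ ^ 2 + σs2 k) P := by
    simp only [norm_sub_rev wo]
    exact ((h.integrable_norm_sq hJ i).const_mul _).add (integrable_const _)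
  have := setIntegral_mul_le_of_condExp_le (h.past_le hJ i) hB (f := fun _ => 1)
    stronglyMeasurable_const (fun _ => zero_le_one)
    (by simpa using ((h.noise.memLp i k).integrable_norm_pow two_ne_zero).integrableOn)
    ((h.noise.memLp i k).integrable_norm_pow two_ne_zero)
    (by simpa using hi.integrableOn) (h.noise.var_le i k)
  simp only [one_mul, norm_sub_rev wo] at this
  refine this.trans_eq ?_
  rw [integral_add (hX.const_mul _) (integrable_const _), integral_const_mul]
  simp [mul_comm]

/-- Mean-square error recursion, localized to an event of the past. -/
theorem setIntegral_norm_sq_succ_le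
    (h : AsyncCentralizedModel P A J wo β2 σs2 σπ2 μbar σμ2 μub)
    (hJ : CostSystem J wo ν δ) {i : ℕ} {B : Set Ω} (hB : MeasurableSet[A.past i] B) :
    ∫ ω in B, ‖A.iter (i + 1) ω - wo‖ ^ 2 ∂P ≤
      alphaCent ν δ β2 σπ2 μbar σμ2 * ∫ ω in B, ‖A.iter i ω - wo‖ ^ 2 ∂P +
        sigmaS2 σs2 σπ2 * (μbar ^ 2 + σμ2) / (N : ℝ) ^ 2 * P.real B := by
  have hS2 := h.noise.memLp i
  have hμpos := h.step.mean_pos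
  obtain ⟨mG, hmix, hle, hmeas⟩ := h.exists_mixingStep hJ i
  have hiterP := A.measurable_iter_past i
  have hiter : Measurable[mG] (A.iter i) := hiterP.mono hle le_rfl
  have hX2 := h.memLp_iter_sub hJ i
  have hG2 : ∀ k, MemLp (fun ω => gradient (J k) (A.iter i ω)) 2 P := fun k => by
    have := h.memLp_gradient (B := Set.univ) hJ (by rwa [Measure.restrict_univ]) k
    rwa [Measure.restrict_univ] at this
  have hGP : ∀ k, Measurable[A.past i] (fun ω => gradient (J k) (A.iter i ω)) := fun k =>
    (hJ.diff k).continuous_gradient.measurable.comp hiterP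
  have hXP : Measurable[A.past i] (fun ω => A.iter i ω - wo) := hiterP.sub_const wo
  simp only [iter_succ_sub (J := J) (wo := wo) i]
  rw [hmix.integral_norm_sq (hle _ hB) (hXP.mono hle le_rfl) (fun k => (hGP k).mono hle le_rfl)
    (fun k => hmeas k _ hiter) hX2 hG2 hS2
    (fun k => h.setIntegral_inner_noise hJ hB hXP k
      (hX2.integrable_real_inner (hS2 k)).integrableOn)
    (fun k l => h.setIntegral_inner_noise hJ hB (hGP k) l
      ((hG2 k).integrable_real_inner (hS2 l)).integrableOn)
    (fun k l hkl => h.setIntegral_inner_noise_noise hJ hB hkl)]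
  have hXi := (h.integrable_norm_sq hJ i).integrableOn (s := B)
  have hGi : ∀ k l, IntegrableOn
      (fun ω => ⟪gradient (J k) (A.iter i ω), gradient (J l) (A.iter i ω)⟫) B P := fun k l =>
    ((hG2 k).integrable_real_inner (hG2 l)).integrableOn
  have hXGi : ∀ k, IntegrableOn (fun ω => ⟪A.iter i ω - wo, gradient (J k) (A.iter i ω)⟫) B P :=
    fun k => (hX2.integrable_real_inner (hG2 k)).integrableOn
  have hlin : ν * ∫ ω in B, ‖A.iter i ω - wo‖ ^ 2 ∂P ≤
      ∑ k, ∫ ω in B, ⟪A.iter i ω - wo, gradient (J k) (A.iter i ω)⟫ ∂P := by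
    rw [← integral_finsetSum _ fun k _ => hXGi k, ← integral_const_mul]
    refine integral_mono (hXi.const_mul _) (integrable_finsetSum _ fun k _ => hXGi k) fun ω => ?_
    refine (inner_gradient_aggregate_ge hJ.min hJ.cost _).trans_eq ?_
    rw [gradient_aggregateCost hJ.diff, inner_sum]
  have hquad : ∑ k, ∑ l, (∫ ω, A.fusion i k ω * A.fusion i l ω ∂P) *
      ∫ ω in B, ⟪gradient (J k) (A.iter i ω), gradient (J l) (A.iter i ω)⟫ ∂P ≤
      (1 / (N : ℝ) ^ 2 * δ ^ 2 + (∑ k, σπ2 k) * δ ^ 2) * ∫ ω in B, ‖A.iter i ω - wo‖ ^ 2 ∂P := by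
    have e : ∑ k, ∑ l, (∫ ω, A.fusion i k ω * A.fusion i l ω ∂P) *
        ∫ ω in B, ⟪gradient (J k) (A.iter i ω), gradient (J l) (A.iter i ω)⟫ ∂P =
        ∫ ω in B, ∑ k, ∑ l, (∫ ω, A.fusion i k ω * A.fusion i l ω ∂P) *
          ⟪gradient (J k) (A.iter i ω), gradient (J l) (A.iter i ω)⟫ ∂P := by
      rw [integral_finsetSum _ fun k _ => integrable_finsetSum _ fun l _ => (hGi k l).const_mul _]
      refine Finset.sum_congr rfl fun k _ => ?_
      rw [integral_finsetSum _ fun l _ => (hGi k l).const_mul _]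
      exact Finset.sum_congr rfl fun l _ => (integral_const_mul _ _).symm
    rw [e, ← integral_const_mul]
    refine integral_mono (integrable_finsetSum _ fun k _ => integrable_finsetSum _ fun l _ =>
      (hGi k l).const_mul _) (hXi.const_mul _) fun ω => ?_
    refine (hmix.weight_quadratic_le fun k => gradient (J k) (A.iter i ω)).trans ?_
    have h1 := sum_norm_sq_gradient_le hJ.diff hJ.conv hJ.min hJ.cost (A.iter i ω)
    have h2 := norm_gradient_aggregate_le hJ.min hJ.cost (A.iter i ω)
    rw [gradient_aggregateCost hJ.diff] at h2
    have h3 : 0 ≤ ∑ k, σπ2 k := Finset.sum_nonneg fun k _ => h.fusion_variance_nonneg k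
    have h4 := mul_le_mul_of_nonneg_left h1 h3
    have h5 := mul_le_mul_of_nonneg_left h2 (by positivity : 0 ≤ 1 / (N : ℝ) ^ 2)
    linarith
  have hnoise : ∑ k, (1 / (N : ℝ) ^ 2 + σπ2 k) * ∫ ω in B, ‖A.noise J i k (A.iter i) ω‖ ^ 2 ∂P ≤
      ∑ k, (1 / (N : ℝ) ^ 2 + σπ2 k) *
        (β2 k * ∫ ω in B, ‖A.iter i ω - wo‖ ^ 2 ∂P + σs2 k * P.real B) :=
    Finset.sum_le_sum fun k _ => mul_le_mul_of_nonneg_left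
      (h.setIntegral_norm_sq_noise_le hJ hB k)
      (add_nonneg (by positivity) (h.fusion_variance_nonneg k))
  have hm2 : 0 ≤ μbar ^ 2 + σμ2 := add_nonneg (sq_nonneg _) h.variance_nonneg
  have hμN : 0 ≤ 2 * (μbar / N) := by positivity
  have f1 := mul_le_mul_of_nonneg_left hlin hμN
  have f2 := mul_le_mul_of_nonneg_left (add_le_add hquad hnoise) hm2
  refine (add_le_add (sub_le_sub_left f1 _) f2).trans_eq ?_
  -- With no agents all sums are empty and division by zero gives zero, so both sides agree.
  rcases Nat.eq_zero_or_pos N with rfl | hN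
  · simp [alphaCent, sigmaS2, betaC2]
  have hN' : (N : ℝ) ≠ 0 := by positivity
  generalize ∫ ω in B, ‖A.iter i ω - wo‖ ^ 2 ∂P = x
  -- The subtracted `(∑ σπ2) * δ²` is the covariance part of the gradient form; together they make
  -- up `betaC2 / N²`.
  have g1 : ∑ k, (1 / (N : ℝ) ^ 2 + σπ2 k) * (β2 k * x + σs2 k * P.real B) =
      (betaC2 δ β2 σπ2 / (N : ℝ) ^ 2 - (∑ k, σπ2 k) * δ ^ 2) * x +
        sigmaS2 σs2 σπ2 / (N : ℝ) ^ 2 * P.real B := by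
    rw [betaC2, sigmaS2, Finset.sum_div, Finset.sum_div, Finset.sum_mul, Finset.sum_mul,
      ← Finset.sum_sub_distrib, Finset.sum_mul, ← Finset.sum_add_distrib]
    refine Finset.sum_congr rfl fun k _ => ?_
    field_simp
    ring
  rw [g1, alphaCent]
  ring

end AsyncCentralizedModel

end Model

/-! ### Contraction factor, steady-state mean-square error and the fourth-moment recursion. -/

namespace AsyncCentralizedModel

open scoped RealInnerProductSpace

set_option linter.unusedSectionVars false

variable {M N : ℕ} {Ω : Type*} {mΩ : MeasurableSpace Ω} {P : Measure Ω} [IsProbabilityMeasure P]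
  {A : CentralizedAlgorithm M N Ω} {J : Fin N → Vec M → ℝ} {wo : Vec M}
  {β2 σs2 σπ2 : Fin N → ℝ} {μbar σμ2 μub : ℝ} {ν δ : ℝ}

theorem mse_eq (n : ℕ) : mse P A wo n = ∫ ω, ‖A.iter n ω - wo‖ ^ 2 ∂P := by
  simp only [mse, norm_sub_rev wo]

theorem mse_nonneg (n : ℕ) : 0 ≤ mse P A wo n := integral_nonneg fun _ => sq_nonneg _

theorem mse_succ_le (h : AsyncCentralizedModel P A J wo β2 σs2 σπ2 μbar σμ2 μub)
    (hJ : CostSystem J wo ν δ) (n : ℕ) :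
    mse P A wo (n + 1) ≤ alphaCent ν δ β2 σπ2 μbar σμ2 * mse P A wo n +
      sigmaS2 σs2 σπ2 * (μbar ^ 2 + σμ2) / (N : ℝ) ^ 2 := by
  have := h.setIntegral_norm_sq_succ_le hJ (i := n) (B := Set.univ) MeasurableSet.univ
  simpa [mse_eq] using this

theorem betaC2_nonneg (h : AsyncCentralizedModel P A J wo β2 σs2 σπ2 μbar σμ2 μub)
    (hβ2 : ∀ k, 0 ≤ β2 k) : 0 ≤ betaC2 δ β2 σπ2 :=
  Finset.sum_nonneg fun k _ => add_nonneg (hβ2 k)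
    (mul_nonneg (mul_nonneg (sq_nonneg _) (h.fusion_variance_nonneg k))
      (add_nonneg (hβ2 k) (sq_nonneg _)))

theorem sigmaS2_nonneg (h : AsyncCentralizedModel P A J wo β2 σs2 σπ2 μbar σμ2 μub)
    (hσs2 : ∀ k, 0 ≤ σs2 k) : 0 ≤ sigmaS2 σs2 σπ2 :=
  Finset.sum_nonneg fun k _ => mul_nonneg (add_nonneg zero_le_one
    (mul_nonneg (sq_nonneg _) (h.fusion_variance_nonneg k))) (hσs2 k)

/-- Completing the square in `ν μbar / N` leaves nonnegative terms because `ν ≤ δ`. -/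
theorem alphaCent_nonneg (h : AsyncCentralizedModel P A J wo β2 σs2 σπ2 μbar σμ2 μub)
    (hJ : CostSystem J wo ν δ) (hβ2 : ∀ k, 0 ≤ β2 k) : 0 ≤ alphaCent ν δ β2 σπ2 μbar σμ2 := by
  have h1 : 0 ≤ betaC2 δ β2 σπ2 * (μbar ^ 2 + σμ2) / (N : ℝ) ^ 2 := by
    have := h.betaC2_nonneg (δ := δ) hβ2
    have := h.variance_nonneg
    positivity
  have h2 : ν ^ 2 ≤ δ ^ 2 := pow_le_pow_left₀ hJ.cost.nu_pos.le hJ.cost.nu_le 2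
  have h3 : ν ^ 2 * (μbar / N) ^ 2 ≤ δ ^ 2 * (μbar / N) ^ 2 := by gcongr
  have h4 : 0 ≤ δ ^ 2 * σμ2 / (N : ℝ) ^ 2 := by
    have := h.variance_nonneg
    positivity
  have e : alphaCent ν δ β2 σπ2 μbar σμ2 = (1 - ν * (μbar / N)) ^ 2 +
      (δ ^ 2 * (μbar / N) ^ 2 - ν ^ 2 * (μbar / N) ^ 2) + δ ^ 2 * σμ2 / (N : ℝ) ^ 2 +
      betaC2 δ β2 σπ2 * (μbar ^ 2 + σμ2) / (N : ℝ) ^ 2 := by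
    rw [alphaCent]
    ring
  rw [e]
  have := sq_nonneg (1 - ν * (μbar / N))
  linarith

theorem alphaCent_eq (h : AsyncCentralizedModel P A J wo β2 σs2 σπ2 μbar σμ2 μub) :
    alphaCent ν δ β2 σπ2 μbar σμ2 = 1 - μbar / N *
      (2 * ν - (δ ^ 2 + betaC2 δ β2 σπ2) * (muX μbar σμ2 / N)) := by
  rw [alphaCent, ← h.mul_muX]
  ring

theorem alphaCent_lt_one (h : AsyncCentralizedModel P A J wo β2 σs2 σπ2 μbar σμ2 μub) (hN : 0 < N)
    (hJ : CostSystem J wo ν δ) (hβ2 : ∀ k, 0 ≤ β2 k)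
    (hμ : muX μbar σμ2 / N < 2 * ν / (δ ^ 2 + betaC2 δ β2 σπ2)) :
    alphaCent ν δ β2 σπ2 μbar σμ2 < 1 := by
  have hpos : 0 < δ ^ 2 + betaC2 δ β2 σπ2 :=
    add_pos_of_pos_of_nonneg (pow_pos hJ.cost.delta_pos 2) (h.betaC2_nonneg hβ2)
  rw [lt_div_iff₀ hpos] at hμ
  rw [h.alphaCent_eq]
  have h1 : 0 < μbar / N := div_pos h.step.mean_pos (by positivity)
  have := mul_pos h1 (show 0 < 2 * ν - (δ ^ 2 + betaC2 δ β2 σπ2) * (muX μbar σμ2 / N) by linarith)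
  linarith

/-- The threshold is half of that for `alphaCent < 1`, so the quadratic terms consume at most half
of the drift `2ν μbar / N`. The absolute value keeps the threshold positive for arbitrary `σπ2`,
since it is fixed before any model forces these variances to be nonnegative. -/
theorem alphaCent_le (h : AsyncCentralizedModel P A J wo β2 σs2 σπ2 μbar σμ2 μub) (hN : 0 < N)
    (hJ : CostSystem J wo ν δ) (hβ2 : ∀ k, 0 ≤ β2 k)
    (hμ : muX μbar σμ2 ≤ N * ν / (δ ^ 2 + |betaC2 δ β2 σπ2|)) :
    alphaCent ν δ β2 σπ2 μbar σμ2 ≤ 1 - ν * μbar / N ∧ ν * μbar / N ≤ 1 := by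
  have hN' : (0 : ℝ) < N := by positivity
  have hb := h.betaC2_nonneg (δ := δ) hβ2
  have hν := hJ.cost.nu_pos
  have hδ := hJ.cost.delta_pos
  rw [abs_of_nonneg hb, le_div_iff₀ (by positivity)] at hμ
  have h1 : 0 < μbar / N := div_pos h.step.mean_pos hN'
  have h2 : (δ ^ 2 + betaC2 δ β2 σπ2) * (muX μbar σμ2 / N) ≤ ν := by
    rw [← mul_div_assoc, div_le_iff₀ hN']
    linarith
  constructor
  · rw [h.alphaCent_eq]
    have := mul_le_mul_of_nonneg_left h2 h1.le
    have e : ν * μbar / N = μbar / N * ν := by ring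
    rw [e]
    linarith
  · have h3 : ν ^ 2 ≤ δ ^ 2 := pow_le_pow_left₀ hν.le hJ.cost.nu_le 2
    have h4 : ν ^ 2 * (muX μbar σμ2 / N) ≤ ν := by
      refine le_trans ?_ h2
      have := h.muX_pos
      gcongr
      linarith
    have h5 : ν * (muX μbar σμ2 / N) ≤ 1 := by
      by_contra! hc
      have := mul_lt_mul_of_pos_left hc hν
      nlinarith
    refine le_trans ?_ h5
    rw [mul_div_assoc]
    have := h.le_muX
    gcongr

/-- Steady-state mean-square error on an event known at the start. -/
theorem eventually_setIntegral_norm_sq_le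
    (h : AsyncCentralizedModel P A J wo β2 σs2 σπ2 μbar σμ2 μub) (hN : 0 < N)
    (hJ : CostSystem J wo ν δ) (hβ2 : ∀ k, 0 ≤ β2 k)
    (hμ : muX μbar σμ2 ≤ N * ν / (δ ^ 2 + |betaC2 δ β2 σπ2|)) {B : Set Ω}
    (hB : MeasurableSet[A.past 0] B) {ε : ℝ} (hε : 0 < ε) :
    ∀ᶠ n in atTop, ∫ ω in B, ‖A.iter n ω - wo‖ ^ 2 ∂P ≤
      sigmaS2 σs2 σπ2 / (N * ν) * muX μbar σμ2 * P.real B + ε := by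
  obtain ⟨h1, h2⟩ := h.alphaCent_le hN hJ hβ2 hμ
  have hν := hJ.cost.nu_pos
  have hμpos := h.step.mean_pos
  refine eventually_le_of_contraction (ρ := ν * μbar / N) (by positivity) h2 hε
    (Eventually.of_forall fun n => ?_)
  refine (h.setIntegral_norm_sq_succ_le hJ
    (CentralizedAlgorithm.past_mono (Nat.zero_le n) _ hB)).trans ?_
  refine add_le_add (mul_le_mul_of_nonneg_right h1 (integral_nonneg fun _ => sq_nonneg _)) ?_
  rw [← h.mul_muX]
  apply le_of_eq
  field_simp

theorem eventually_mse_le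
    (h : AsyncCentralizedModel P A J wo β2 σs2 σπ2 μbar σμ2 μub) (hN : 0 < N)
    (hJ : CostSystem J wo ν δ) (hβ2 : ∀ k, 0 ≤ β2 k)
    (hμ : muX μbar σμ2 ≤ N * ν / (δ ^ 2 + |betaC2 δ β2 σπ2|)) {ε : ℝ} (hε : 0 < ε) :
    ∀ᶠ n in atTop, mse P A wo n ≤ sigmaS2 σs2 σπ2 / (N * ν) * muX μbar σμ2 + ε := by
  simpa [mse_eq] using h.eventually_setIntegral_norm_sq_le hN hJ hβ2 hμ MeasurableSet.univ hε

/-- Guarantees that the real-valued limsup is not a default value. -/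
theorem bddAbove_mse
    (h : AsyncCentralizedModel P A J wo β2 σs2 σπ2 μbar σμ2 μub) (hN : 0 < N)
    (hJ : CostSystem J wo ν δ) (hβ2 : ∀ k, 0 ≤ β2 k)
    (hμ : muX μbar σμ2 ≤ N * ν / (δ ^ 2 + |betaC2 δ β2 σπ2|)) :
    BddAbove (Set.range (mse P A wo)) :=
  Filter.IsBoundedUnder.bddAbove_range (Filter.isBoundedUnder_of_eventually_le
    (h.eventually_mse_le hN hJ hβ2 hμ one_pos))

theorem limsup_mse_le
    (h : AsyncCentralizedModel P A J wo β2 σs2 σπ2 μbar σμ2 μub) (hN : 0 < N)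
    (hJ : CostSystem J wo ν δ) (hβ2 : ∀ k, 0 ≤ β2 k)
    (hμ : muX μbar σμ2 ≤ N * ν / (δ ^ 2 + |betaC2 δ β2 σπ2|)) :
    limsup (mse P A wo) atTop ≤ sigmaS2 σs2 σπ2 / (N * ν) * muX μbar σμ2 := by
  refine le_of_forall_pos_le_add fun ε hε => ?_
  exact limsup_le_of_le (isCoboundedUnder_le_of_le atTop (x := 0) fun n => mse_nonneg n)
    (h.eventually_mse_le hN hJ hβ2 hμ hε)

/-- With `a = ‖x‖²`, `b = t⟪x,d⟫` and `c = t²‖d‖²`, the left side is `(a - 2b + c)²`. The term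
`-4bc` is at most `2b² + 2c²`, and the resulting `6b²` is at most `6ac` by Cauchy–Schwarz. The
linear term stays exact, as it carries the contraction. -/
theorem norm_sub_smul_pow_four_le {E : Type*} [NormedAddCommGroup E] [InnerProductSpace ℝ E]
    (x d : E) (t : ℝ) : ‖x - t • d‖ ^ 4 ≤ ‖x‖ ^ 4 - 4 * (t * (‖x‖ ^ 2 * ⟪x, d⟫)) +
      8 * (t ^ 2 * (‖x‖ ^ 2 * ‖d‖ ^ 2)) + 3 * (t ^ 4 * ‖d‖ ^ 4) := by
  have h1 : ‖x - t • d‖ ^ 2 = ‖x‖ ^ 2 - 2 * (t * ⟪x, d⟫) + t ^ 2 * ‖d‖ ^ 2 := by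
    rw [norm_sub_sq_real, norm_smul, mul_pow, real_inner_smul_right, Real.norm_eq_abs, sq_abs]
  have h2 : ⟪x, d⟫ ^ 2 ≤ ‖x‖ ^ 2 * ‖d‖ ^ 2 := by
    rw [← mul_pow, ← sq_abs]
    exact pow_le_pow_left₀ (abs_nonneg _) (abs_real_inner_le_norm x d) 2
  have h3 := mul_le_mul_of_nonneg_left h2 (sq_nonneg t)
  have h4 := sq_nonneg (t * ⟪x, d⟫ + t ^ 2 * ‖d‖ ^ 2)
  have e1 : ‖x - t • d‖ ^ 4 = (‖x - t • d‖ ^ 2) ^ 2 := by ring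
  rw [e1, h1]
  nlinarith

theorem memLp_four_iter (h : AsyncCentralizedModel P A J wo β2 σs2 σπ2 μbar σμ2 μub)
    (hJ : CostSystem J wo ν δ) {β4 σ4 : Fin N → ℝ} (h4 : FourthMomentCond P A J wo β4 σ4)
    {B : Set Ω} (hX : MemLp (fun ω => A.iter 0 ω - wo) 4 (P.restrict B)) (n : ℕ) :
    MemLp (fun ω => A.iter n ω - wo) 4 (P.restrict B) := by
  induction n with
  | zero => exact hX
  | succ n ih => exact h.memLp_iter_succ hJ ih fun k => (h4 n k).1.restrict B

theorem _root_.MeasureTheory.MemLp.integrable_norm_sq_mul_norm_sq {E F : Type*}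
    [NormedAddCommGroup E] [NormedAddCommGroup F] {Q : Measure Ω} {X : Ω → E}
    {Y : Ω → F} (hX : MemLp X 4 Q) (hY : MemLp Y 4 Q) :
    Integrable (fun ω => ‖X ω‖ ^ 2 * ‖Y ω‖ ^ 2) Q := by
  have h1 := hX.integrable_norm_pow (p := 4) (by norm_num)
  have h2 := hY.integrable_norm_pow (p := 4) (by norm_num)
  refine (h1.add h2).mono' ((hX.1.norm.pow 2).mul (hY.1.norm.pow 2)) (ae_of_all _ fun ω => ?_)
  rw [Real.norm_eq_abs, abs_of_nonneg (by positivity)]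
  simp only [Pi.add_apply]
  nlinarith [sq_nonneg (‖X ω‖ ^ 2 - ‖Y ω‖ ^ 2), sq_nonneg (‖X ω‖ ^ 2), sq_nonneg (‖Y ω‖ ^ 2)]

theorem setIntegral_norm_pow_four_noise_le
    (h : AsyncCentralizedModel P A J wo β2 σs2 σπ2 μbar σμ2 μub)
    (hJ : CostSystem J wo ν δ) {β4 σ4 : Fin N → ℝ} (h4 : FourthMomentCond P A J wo β4 σ4)
    (hσ4 : ∀ k, 0 ≤ σ4 k) {i : ℕ}
    {B : Set Ω} (hB : MeasurableSet[A.past i] B)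
    (hX : MemLp (fun ω => A.iter i ω - wo) 4 (P.restrict B)) (k : Fin N) :
    ∫ ω in B, ‖A.noise J i k (A.iter i) ω‖ ^ 4 ∂P ≤
      β4 k * ∫ ω in B, ‖A.iter i ω - wo‖ ^ 4 ∂P + σ4 k := by
  have hX4 : IntegrableOn (fun ω => ‖A.iter i ω - wo‖ ^ 4) B P :=
    hX.integrable_norm_pow (p := 4) (by norm_num)
  have hS4 := (h4 i k).1.integrable_norm_pow (p := 4) (by norm_num)
  have hi : IntegrableOn (fun ω => β4 k * ‖wo - A.iter i ω‖ ^ 4 + σ4 k) B P := by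
    simp only [norm_sub_rev wo]
    exact (hX4.const_mul _).add (integrable_const _)
  have := setIntegral_mul_le_of_condExp_le (h.past_le hJ i) hB (f := fun _ => 1)
    stronglyMeasurable_const (fun _ => zero_le_one)
    (by simpa using hS4.integrableOn) hS4 (by simpa using hi) (h4 i k).2
  simp only [one_mul, norm_sub_rev wo] at this
  refine this.trans ?_
  rw [integral_add (hX4.const_mul _) (integrable_const _), integral_const_mul]
  have : P.real B * σ4 k ≤ 1 * σ4 k := mul_le_mul_of_nonneg_right measureReal_le_one (hσ4 k)
  simp
  linarith

theorem setIntegral_norm_sq_mul_norm_sq_noise_le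
    (h : AsyncCentralizedModel P A J wo β2 σs2 σπ2 μbar σμ2 μub)
    (hJ : CostSystem J wo ν δ) {i : ℕ} {B : Set Ω} (hB : MeasurableSet[A.past i] B) (k : Fin N)
    (hX : MemLp (fun ω => A.iter i ω - wo) 4 (P.restrict B))
    (hS : MemLp (A.noise J i k (A.iter i)) 4 P) :
    ∫ ω in B, ‖A.iter i ω - wo‖ ^ 2 * ‖A.noise J i k (A.iter i) ω‖ ^ 2 ∂P ≤
      β2 k * ∫ ω in B, ‖A.iter i ω - wo‖ ^ 4 ∂P +
        σs2 k * ∫ ω in B, ‖A.iter i ω - wo‖ ^ 2 ∂P := by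
  have hX4 : IntegrableOn (fun ω => ‖A.iter i ω - wo‖ ^ 4) B P :=
    hX.integrable_norm_pow (p := 4) (by norm_num)
  have hX2 := (h.integrable_norm_sq hJ i).integrableOn (s := B)
  have e : ∀ ω, ‖A.iter i ω - wo‖ ^ 2 * (β2 k * ‖wo - A.iter i ω‖ ^ 2 + σs2 k) =
      β2 k * ‖A.iter i ω - wo‖ ^ 4 + σs2 k * ‖A.iter i ω - wo‖ ^ 2 := fun ω => by
    rw [norm_sub_rev wo]; ring
  have hi : IntegrableOn (fun ω => β2 k * ‖A.iter i ω - wo‖ ^ 4 +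
      σs2 k * ‖A.iter i ω - wo‖ ^ 2) B P := (hX4.const_mul _).add (hX2.const_mul _)
  have := setIntegral_mul_le_of_condExp_le (h.past_le hJ i) hB
    (f := fun ω => ‖A.iter i ω - wo‖ ^ 2)
    ((measurable_norm.comp ((A.measurable_iter_past i).sub_const wo)).pow_const 2).stronglyMeasurable
    (fun ω => by positivity) (hX.integrable_norm_sq_mul_norm_sq (hS.restrict B))
    ((h.noise.memLp i k).integrable_norm_pow two_ne_zero)
    (by simpa only [e] using hi) (h.noise.var_le i k)
  refine this.trans_eq ?_
  simp only [e]
  rw [integral_add (hX4.const_mul _) (hX2.const_mul _), integral_const_mul, integral_const_mul]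

/-- Fourth-moment recursion, localized to an event of the past on which the fourth moment of the
error is finite. -/
theorem setIntegral_norm_pow_four_succ_le
    (h : AsyncCentralizedModel P A J wo β2 σs2 σπ2 μbar σμ2 μub)
    (hJ : CostSystem J wo ν δ) {β4 σ4 : Fin N → ℝ} (h4 : FourthMomentCond P A J wo β4 σ4)
    (hσ4 : ∀ k, 0 ≤ σ4 k) {i : ℕ}
    {B : Set Ω} (hB : MeasurableSet[A.past i] B)
    (hX : MemLp (fun ω => A.iter i ω - wo) 4 (P.restrict B)) :
    ∫ ω in B, ‖A.iter (i + 1) ω - wo‖ ^ 4 ∂P ≤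
      (1 - 4 * ν * (μbar / N)) * ∫ ω in B, ‖A.iter i ω - wo‖ ^ 4 ∂P +
      (μbar ^ 2 + σμ2) *
        (16 * ((δ ^ 2 + ∑ k, β2 k) * ∫ ω in B, ‖A.iter i ω - wo‖ ^ 4 ∂P +
          (∑ k, σs2 k) * ∫ ω in B, ‖A.iter i ω - wo‖ ^ 2 ∂P) +
        24 * μub ^ 2 * ((δ ^ 4 + N * ∑ k, β4 k) * ∫ ω in B, ‖A.iter i ω - wo‖ ^ 4 ∂P +
          N * ∑ k, σ4 k)) := by
  have hS4 := fun k => (h4 i k).1.restrict B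
  have hX2 := (h.integrable_norm_sq hJ i).integrableOn (s := B)
  have hX' := h.memLp_iter_succ hJ hX hS4
  have hG4 := fun k => h.memLp_gradient hJ hX k
  have hS4i : ∀ k, IntegrableOn (fun ω => ‖A.noise J i k (A.iter i) ω‖ ^ 4) B P := fun k =>
    (hS4 k).integrable_norm_pow (p := 4) (by norm_num)
  have hSint := h.setIntegral_norm_pow_four_noise_le hJ h4 hσ4 hB hX
  have hXSint := fun k => h.setIntegral_norm_sq_mul_norm_sq_noise_le hJ hB k hX (h4 i k).1
  have hm2 : 0 ≤ μbar ^ 2 + σμ2 := add_nonneg (sq_nonneg _) h.variance_nonneg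
  have hμpos := h.step.mean_pos
  have hiterP := A.measurable_iter_past i
  have hXP : Measurable[A.past i] (fun ω => A.iter i ω - wo) := hiterP.sub_const wo
  have hX4 : IntegrableOn (fun ω => ‖A.iter i ω - wo‖ ^ 4) B P :=
    hX.integrable_norm_pow (p := 4) (by norm_num)
  have hX4' : IntegrableOn (fun ω => ‖A.iter (i + 1) ω - wo‖ ^ 4) B P :=
    hX'.integrable_norm_pow (p := 4) (by norm_num)
  have hXS : ∀ k, IntegrableOn (fun ω => ‖A.iter i ω - wo‖ ^ 2 *
      ‖A.noise J i k (A.iter i) ω‖ ^ 2) B P := fun k =>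
    hX.integrable_norm_sq_mul_norm_sq (hS4 k)
  -- By Cauchy–Schwarz the integrand is at most `‖x‖³‖Z‖`, hence at most `‖x‖²‖Z‖² + ‖x‖⁴`.
  have hcub : ∀ {Z : Ω → Vec M}, MemLp Z 4 (P.restrict B) →
      IntegrableOn (fun ω => ‖A.iter i ω - wo‖ ^ 2 * ⟪A.iter i ω - wo, Z ω⟫) B P := by
    intro Z hZ
    refine ((hX.integrable_norm_sq_mul_norm_sq hZ).add hX4).mono'
      ((hX.1.norm.pow 2).mul (hX.1.inner hZ.1)) (ae_of_all _ fun ω => ?_)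
    rw [norm_mul, norm_pow, norm_norm, Real.norm_eq_abs]
    refine (mul_le_mul_of_nonneg_left (abs_real_inner_le_norm _ _) (sq_nonneg _)).trans ?_
    simp only [Pi.add_apply]
    nlinarith [mul_nonneg (sq_nonneg ‖A.iter i ω - wo‖)
      (sq_nonneg (‖A.iter i ω - wo‖ - ‖Z ω‖)), sq_nonneg (‖A.iter i ω - wo‖ ^ 2),
      mul_nonneg (sq_nonneg ‖A.iter i ω - wo‖) (sq_nonneg ‖Z ω‖)]
  have hzero : ∀ k, ∫ ω in B, ‖A.iter i ω - wo‖ ^ 2 *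
      ⟪A.iter i ω - wo, A.noise J i k (A.iter i) ω⟫ ∂P = 0 := by
    intro k
    have := h.setIntegral_inner_noise hJ hB
      (y := fun ω => ‖A.iter i ω - wo‖ ^ 2 • (A.iter i ω - wo))
      (((measurable_norm.comp hXP).pow_const 2).smul hXP) k
      (by simpa only [real_inner_smul_left] using hcub (hS4 k))
    simpa only [real_inner_smul_left] using this
  have hlin : ν * ∫ ω in B, ‖A.iter i ω - wo‖ ^ 4 ∂P ≤
      ∑ k, ∫ ω in B, ‖A.iter i ω - wo‖ ^ 2 *
        ⟪A.iter i ω - wo, gradient (J k) (A.iter i ω)⟫ ∂P := by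
    rw [← integral_finsetSum _ fun k _ => hcub (hG4 k), ← integral_const_mul]
    refine integral_mono (hX4.const_mul _)
      (integrable_finsetSum _ fun k _ => hcub (hG4 k)) fun ω => ?_
    have h1 := inner_gradient_aggregate_ge hJ.min hJ.cost (A.iter i ω)
    rw [gradient_aggregateCost hJ.diff, inner_sum] at h1
    have h2 := mul_le_mul_of_nonneg_left h1 (sq_nonneg ‖A.iter i ω - wo‖)
    rw [Finset.mul_sum] at h2
    linarith
  obtain ⟨mG, hmix, hle, hmeas⟩ := h.exists_mixingStep hJ i
  have hiter : Measurable[mG] (A.iter i) := hiterP.mono hle le_rfl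
  have hXm : Measurable[mG] (fun ω => A.iter i ω - wo) := hXP.mono hle le_rfl
  have hSm : ∀ k, Measurable[mG] (A.noise J i k (A.iter i)) := fun k => hmeas k _ hiter
  have hGm : ∀ k, Measurable[mG] (fun ω => gradient (J k) (A.iter i ω)) := fun k =>
    (hJ.diff k).continuous_gradient.measurable.comp hiter
  -- `φ₀` is the exact linear term, while `φ₁` and `φ₂` dominate `‖x‖²‖d‖²` and `‖d‖⁴` for the
  -- combined direction `d`. None involves the current step-size or weights, so the moments of the
  -- step-size factor out by independence.
  set φ₀ : Fin N → Ω → ℝ := fun k ω => ‖A.iter i ω - wo‖ ^ 2 *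
    ⟪A.iter i ω - wo, gradient (J k) (A.iter i ω) + A.noise J i k (A.iter i) ω⟫ with hφ₀
  set φ₁ : Ω → ℝ := fun ω => 2 * δ ^ 2 * ‖A.iter i ω - wo‖ ^ 4 +
    2 * ∑ k, ‖A.iter i ω - wo‖ ^ 2 * ‖A.noise J i k (A.iter i) ω‖ ^ 2 with hφ₁
  set φ₂ : Ω → ℝ := fun ω => 8 * δ ^ 4 * ‖A.iter i ω - wo‖ ^ 4 +
    8 * N * ∑ k, ‖A.noise J i k (A.iter i) ω‖ ^ 4 with hφ₂
  have hφ₀m : ∀ k, Measurable[mG] (φ₀ k) := fun k =>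
    (hXm.norm.pow_const 2).mul (hXm.inner ((hGm k).add (hSm k)))
  have hφ₁m : Measurable[mG] φ₁ := ((hXm.norm.pow_const 4).const_mul _).add
    ((Finset.measurable_fun_sum _ fun k _ =>
      (hXm.norm.pow_const 2).mul ((hSm k).norm.pow_const 2)).const_mul _)
  have hφ₂m : Measurable[mG] φ₂ := ((hXm.norm.pow_const 4).const_mul _).add
    ((Finset.measurable_fun_sum _ fun k _ => (hSm k).norm.pow_const 4).const_mul _)
  have hφ₀i : ∀ k, IntegrableOn (φ₀ k) B P := fun k => hcub ((hG4 k).add (hS4 k))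
  have hφ₁i : IntegrableOn φ₁ B P :=
    (hX4.const_mul _).add ((integrable_finsetSum _ fun k _ => hXS k).const_mul _)
  have hφ₂i : IntegrableOn φ₂ B P :=
    (hX4.const_mul _).add ((integrable_finsetSum _ fun k _ => hS4i k).const_mul _)
  have hpt : ∀ᵐ ω ∂P, ‖A.iter (i + 1) ω - wo‖ ^ 4 ≤ ‖A.iter i ω - wo‖ ^ 4 -
      4 * (∑ k, A.step i ω ^ 1 * (A.fusion i k ω * φ₀ k ω)) + 8 * (A.step i ω ^ 2 * φ₁ ω) +
      3 * (A.step i ω ^ 4 * φ₂ ω) := by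
    filter_upwards [hmix.weight_mem, hmix.weight_sum] with ω hω hω1
    rw [iter_succ_sub (J := J)]
    refine (norm_sub_smul_pow_four_le _ _ _).trans ?_
    set x := A.iter i ω - wo with hx
    set d := ∑ k, A.fusion i k ω •
      (gradient (J k) (A.iter i ω) + A.noise J i k (A.iter i) ω) with hd
    have e1 : A.step i ω * (‖x‖ ^ 2 * ⟪x, d⟫) =
        ∑ k, A.step i ω ^ 1 * (A.fusion i k ω * φ₀ k ω) := by
      rw [hd, inner_sum, Finset.mul_sum, Finset.mul_sum]
      refine Finset.sum_congr rfl fun k _ => ?_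
      rw [real_inner_smul_right, pow_one]
      ring
    have hπ : ∑ k, A.fusion i k ω ^ 2 ≤ 1 := by
      rw [← hω1]
      exact Finset.sum_le_sum fun k _ => by nlinarith [(hω k).1, (hω k).2]
    have hd2 : ‖d‖ ^ 2 ≤ 2 * δ ^ 2 * ‖x‖ ^ 2 + 2 * ∑ k, ‖A.noise J i k (A.iter i) ω‖ ^ 2 := by
      refine (norm_sq_sum_smul_le _ _).trans ?_
      refine (mul_le_of_le_one_left (by positivity) hπ).trans ?_
      have h1 : ∀ k, ‖gradient (J k) (A.iter i ω) + A.noise J i k (A.iter i) ω‖ ^ 2 ≤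
          2 * ‖gradient (J k) (A.iter i ω)‖ ^ 2 + 2 * ‖A.noise J i k (A.iter i) ω‖ ^ 2 := by
        intro k
        have := pow_le_pow_left₀ (norm_nonneg _)
          (norm_add_le (gradient (J k) (A.iter i ω)) (A.noise J i k (A.iter i) ω)) 2
        nlinarith [sq_nonneg (‖gradient (J k) (A.iter i ω)‖ - ‖A.noise J i k (A.iter i) ω‖)]
      refine (Finset.sum_le_sum fun k _ => h1 k).trans ?_
      rw [Finset.sum_add_distrib, ← Finset.mul_sum, ← Finset.mul_sum]
      have := sum_norm_sq_gradient_le hJ.diff hJ.conv hJ.min hJ.cost (A.iter i ω)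
      linarith
    have hd2' : ‖x‖ ^ 2 * ‖d‖ ^ 2 ≤ φ₁ ω := by
      refine (mul_le_mul_of_nonneg_left hd2 (sq_nonneg _)).trans_eq ?_
      simp only [hφ₁, ← Finset.mul_sum]
      ring
    have hd4 : ‖d‖ ^ 4 ≤ φ₂ ω := by
      have h1 : ‖d‖ ^ 4 ≤
          (2 * δ ^ 2 * ‖x‖ ^ 2 + 2 * ∑ k, ‖A.noise J i k (A.iter i) ω‖ ^ 2) ^ 2 := by
        calc ‖d‖ ^ 4 = (‖d‖ ^ 2) ^ 2 := by ring
          _ ≤ _ := pow_le_pow_left₀ (sq_nonneg _) hd2 2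
      have h2 : (∑ k, ‖A.noise J i k (A.iter i) ω‖ ^ 2) ^ 2 ≤
          N * ∑ k, ‖A.noise J i k (A.iter i) ω‖ ^ 4 := by
        have := sq_sum_le_card_mul_sum_sq (s := Finset.univ)
          (f := fun k => ‖A.noise J i k (A.iter i) ω‖ ^ 2)
        simpa only [Finset.card_univ, Fintype.card_fin, ← pow_mul, Nat.reduceMul] using this
      simp only [hφ₂]
      nlinarith [sq_nonneg (2 * δ ^ 2 * ‖x‖ ^ 2 - 2 * ∑ k, ‖A.noise J i k (A.iter i) ω‖ ^ 2)]
    rw [e1]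
    have p2 := mul_le_mul_of_nonneg_left hd2' (sq_nonneg (A.step i ω))
    have p4 := mul_le_mul_of_nonneg_left hd4 (by positivity : 0 ≤ A.step i ω ^ 4)
    linarith
  have i0 : ∀ k, IntegrableOn (fun ω => A.step i ω ^ 1 * (A.fusion i k ω * φ₀ k ω)) B P :=
    fun k => hmix.integrable_pow_mul 1 (hmix.integrable_weight_mul k (hφ₀i k))
  have i1 := (hmix.integrable_pow_mul 2 hφ₁i).const_mul 8
  have i2 := (hmix.integrable_pow_mul 4 hφ₂i).const_mul 3
  have i3 : IntegrableOn (fun ω => 4 * ∑ k, A.step i ω ^ 1 * (A.fusion i k ω * φ₀ k ω)) B P :=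
    (integrable_finsetSum _ fun k _ => i0 k).const_mul 4
  have i4 : IntegrableOn (fun ω => ‖A.iter i ω - wo‖ ^ 4 -
      4 * (∑ k, A.step i ω ^ 1 * (A.fusion i k ω * φ₀ k ω))) B P := hX4.sub i3
  have i5 : IntegrableOn (fun ω => ‖A.iter i ω - wo‖ ^ 4 -
      4 * (∑ k, A.step i ω ^ 1 * (A.fusion i k ω * φ₀ k ω)) +
      8 * (A.step i ω ^ 2 * φ₁ ω)) B P := i4.add i1
  have E0 : ∀ k, ∫ ω in B, A.step i ω ^ 1 * (A.fusion i k ω * φ₀ k ω) ∂P =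
      μbar / N * ∫ ω in B, ‖A.iter i ω - wo‖ ^ 2 *
        ⟪A.iter i ω - wo, gradient (J k) (A.iter i ω)⟫ ∂P := by
    intro k
    have := hmix.integral_mul_mul (f := fun x => x) (g := fun p => p k) measurable_id
      (measurable_pi_apply k) (hφ₀m k) (hle _ hB)
    simp only [pow_one, ← mul_assoc]
    rw [this, hmix.mean, hmix.weight_mean]
    simp only [hφ₀, inner_add_right, mul_add]
    rw [integral_add (hcub (hG4 k)) (hcub (hS4 k)), hzero, add_zero]
    ring
  have E1 : ∫ ω in B, A.step i ω ^ 2 * φ₁ ω ∂P = (μbar ^ 2 + σμ2) * ∫ ω in B, φ₁ ω ∂P := by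
    rw [hmix.integral_step_mul (f := fun x => x ^ 2) (measurable_id.pow_const 2) hφ₁m (hle _ hB),
      hmix.integral_sq]
  have E2 : ∫ ω in B, A.step i ω ^ 4 * φ₂ ω ∂P ≤
      μub ^ 2 * (μbar ^ 2 + σμ2) * ∫ ω in B, φ₂ ω ∂P := by
    rw [hmix.integral_step_mul (f := fun x => x ^ 4) (measurable_id.pow_const 4) hφ₂m (hle _ hB)]
    exact mul_le_mul_of_nonneg_right hmix.integral_pow_four_le
      (integral_nonneg fun ω => by simp only [hφ₂]; positivity)
  have E3 : ∫ ω in B, φ₁ ω ∂P ≤ 2 * ((δ ^ 2 + ∑ k, β2 k) * ∫ ω in B, ‖A.iter i ω - wo‖ ^ 4 ∂P +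
      (∑ k, σs2 k) * ∫ ω in B, ‖A.iter i ω - wo‖ ^ 2 ∂P) := by
    simp only [hφ₁]
    rw [integral_add (hX4.const_mul _) ((integrable_finsetSum _ fun k _ => hXS k).const_mul _),
      integral_const_mul, integral_const_mul, integral_finsetSum _ fun k _ => hXS k]
    have := Finset.sum_le_sum fun k (_ : k ∈ Finset.univ) => hXSint k
    rw [Finset.sum_add_distrib, ← Finset.sum_mul, ← Finset.sum_mul] at this
    linarith
  have E4 : ∫ ω in B, φ₂ ω ∂P ≤ 8 * ((δ ^ 4 + N * ∑ k, β4 k) *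
      ∫ ω in B, ‖A.iter i ω - wo‖ ^ 4 ∂P + N * ∑ k, σ4 k) := by
    simp only [hφ₂]
    rw [integral_add (hX4.const_mul _) ((integrable_finsetSum _ fun k _ => hS4i k).const_mul _),
      integral_const_mul, integral_const_mul, integral_finsetSum _ fun k _ => hS4i k]
    have := Finset.sum_le_sum fun k (_ : k ∈ Finset.univ) => hSint k
    rw [Finset.sum_add_distrib, ← Finset.sum_mul] at this
    have := mul_le_mul_of_nonneg_left this (by positivity : (0 : ℝ) ≤ N)
    linarith
  have key := integral_mono_ae hX4' (i5.add i2) (ae_restrict_of_ae hpt)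
  have key2 : ∫ ω in B, (‖A.iter i ω - wo‖ ^ 4 -
      4 * (∑ k, A.step i ω ^ 1 * (A.fusion i k ω * φ₀ k ω)) + 8 * (A.step i ω ^ 2 * φ₁ ω) +
      3 * (A.step i ω ^ 4 * φ₂ ω)) ∂P = ∫ ω in B, ‖A.iter i ω - wo‖ ^ 4 ∂P -
      4 * (μbar / N * ∑ k, ∫ ω in B, ‖A.iter i ω - wo‖ ^ 2 *
        ⟪A.iter i ω - wo, gradient (J k) (A.iter i ω)⟫ ∂P) +
      8 * ∫ ω in B, A.step i ω ^ 2 * φ₁ ω ∂P + 3 * ∫ ω in B, A.step i ω ^ 4 * φ₂ ω ∂P := by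
    rw [integral_add i5 i2, integral_add i4 i1, integral_sub hX4 i3, integral_const_mul,
      integral_const_mul, integral_const_mul, integral_finsetSum _ fun k _ => i0 k,
      Finset.sum_congr rfl fun k _ => E0 k, ← Finset.mul_sum]
  refine (key.trans_eq key2).trans ?_
  have hμN : 0 ≤ μbar / N := by positivity
  have q0 := mul_le_mul_of_nonneg_left hlin hμN
  have q1 := mul_le_mul_of_nonneg_left E3 hm2
  have q2 := mul_le_mul_of_nonneg_left E4 (mul_nonneg (sq_nonneg μub) hm2)
  rw [E1]
  linarith

end AsyncCentralizedModel

/-- Smallness conditions on `x = μ_x` for the steady-state analysis. -/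
structure SmallStep (N : ℕ) (ν δ : ℝ) (β2 σπ2 β4 : Fin N → ℝ) (c x : ℝ) : Prop where
  le_one : x ≤ 1
  abs_mul_le : |c| * x ≤ 1
  mean_square : x ≤ N * ν / (δ ^ 2 + |betaC2 δ β2 σπ2|)
  fourth : (16 * (δ ^ 2 + ∑ k, β2 k) + 24 * (δ ^ 4 + N * ∑ k, β4 k)) * x ≤ 3 * ν / N
  contraction : 2 * δ * x ≤ N

theorem SmallStep.exists_pos {N : ℕ} (hN : 0 < N) {ν δ : ℝ} (hν : 0 < ν) (hδ : 0 < δ)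
    (β2 σπ2 β4 : Fin N → ℝ) (c : ℝ) :
    ∃ μ₁ : ℝ, 0 < μ₁ ∧ ∀ x, 0 ≤ x → x ≤ μ₁ → SmallStep N ν δ β2 σπ2 β4 c x := by
  have hN' : (0 : ℝ) < N := by positivity
  have key : ∀ a b : ℝ, 0 < b → ∃ y : ℝ, 0 < y ∧ ∀ x, 0 ≤ x → x ≤ y → a * x ≤ b := by
    intro a b hb
    refine ⟨b / (|a| + 1), by positivity, fun x hx0 hx => ?_⟩
    rw [le_div_iff₀ (by positivity)] at hx
    nlinarith [le_abs_self a]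
  obtain ⟨y1, hy1, h1⟩ := key |c| 1 one_pos
  obtain ⟨y2, hy2, h2⟩ := key (16 * (δ ^ 2 + ∑ k, β2 k) + 24 * (δ ^ 4 + N * ∑ k, β4 k))
    (3 * ν / N) (by positivity)
  obtain ⟨y3, hy3, h3⟩ := key (2 * δ) N hN'
  have hy4 : 0 < N * ν / (δ ^ 2 + |betaC2 δ β2 σπ2|) := by positivity
  refine ⟨min 1 (min y1 (min y2 (min y3 (N * ν / (δ ^ 2 + |betaC2 δ β2 σπ2|))))), by positivity,
    fun x hx0 hx => ?_⟩
  simp only [le_min_iff] at hx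
  exact ⟨hx.1, h1 x hx0 hx.2.1, hx.2.2.2.2, h2 x hx0 hx.2.2.1, h3 x hx0 hx.2.2.2.1⟩

/-! ### Steady-state fourth moments and the nonlinear remainder. -/

namespace AsyncCentralizedModel

open scoped RealInnerProductSpace

set_option linter.unusedSectionVars false

variable {M N : ℕ} {Ω : Type*} {mΩ : MeasurableSpace Ω} {P : Measure Ω} [IsProbabilityMeasure P]
  {A : CentralizedAlgorithm M N Ω} {J : Fin N → Vec M → ℝ} {wo : Vec M}
  {β2 σs2 σπ2 : Fin N → ℝ} {μbar σμ2 μub : ℝ} {ν δ : ℝ} {β4 σ4 : Fin N → ℝ} {c : ℝ}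

/-- The margin is taken equal to `μ_x` and absorbed into the constant as `+ 1`. -/
theorem eventually_mse_le_mul
    (h : AsyncCentralizedModel P A J wo β2 σs2 σπ2 μbar σμ2 μub) (hN : 0 < N)
    (hJ : CostSystem J wo ν δ) (hβ2 : ∀ k, 0 ≤ β2 k)
    (hμ : SmallStep N ν δ β2 σπ2 β4 c (muX μbar σμ2)) :
    ∀ᶠ n in atTop, mse P A wo n ≤ (sigmaS2 σs2 σπ2 / (N * ν) + 1) * muX μbar σμ2 := by
  filter_upwards [h.eventually_mse_le hN hJ hβ2 hμ.mean_square h.muX_pos] with n hn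
  linarith

/-- Steady-state fourth moment on an event known at the start. -/
theorem eventually_setIntegral_norm_pow_four_le
    (h : AsyncCentralizedModel P A J wo β2 σs2 σπ2 μbar σμ2 μub) (hN : 0 < N)
    (hJ : CostSystem J wo ν δ) (hβ2 : ∀ k, 0 ≤ β2 k) (hσs2 : ∀ k, 0 ≤ σs2 k)
    (h4 : FourthMomentCond P A J wo β4 σ4) (hβ4 : ∀ k, 0 ≤ β4 k) (hσ4 : ∀ k, 0 ≤ σ4 k)
    (hc : μub ^ 2 ≤ c * muX μbar σμ2) (hμ : SmallStep N ν δ β2 σπ2 β4 c (muX μbar σμ2))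
    {B : Set Ω} (hB : MeasurableSet[A.past 0] B)
    (hX : MemLp (fun ω => A.iter 0 ω - wo) 4 (P.restrict B)) :
    ∀ᶠ n in atTop, ∫ ω in B, ‖A.iter n ω - wo‖ ^ 4 ∂P ≤
      (N / ν * (16 * (∑ k, σs2 k) * (sigmaS2 σs2 σπ2 / (N * ν) + 1) +
        24 * |c| * (N * ∑ k, σ4 k)) + 1) * muX μbar σμ2 ^ 2 := by
  have hν := hJ.cost.nu_pos
  have hμpos := h.step.mean_pos
  have hxpos := h.muX_pos
  have hc' : μub ^ 2 ≤ |c| * muX μbar σμ2 :=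
    hc.trans (mul_le_mul_of_nonneg_right (le_abs_self c) hxpos.le)
  have hub : μub ^ 2 ≤ 1 := hc'.trans hμ.abs_mul_le
  have hsig4 : 0 ≤ N * ∑ k, σ4 k := mul_nonneg (by positivity) (Finset.sum_nonneg fun k _ => hσ4 k)
  have hbet4 : 0 ≤ N * ∑ k, β4 k := mul_nonneg (by positivity) (Finset.sum_nonneg fun k _ => hβ4 k)
  have hsig2 : 0 ≤ ∑ k, σs2 k := Finset.sum_nonneg fun k _ => hσs2 k
  rw [add_mul, one_mul]
  refine eventually_le_of_contraction (ρ := ν * μbar / N) (by positivity)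
    (h.alphaCent_le hN hJ hβ2 hμ.mean_square).2 (by positivity) ?_
  filter_upwards [h.eventually_mse_le_mul hN hJ hβ2 hμ] with n hn
  have hrec := h.setIntegral_norm_pow_four_succ_le hJ h4 hσ4
    (CentralizedAlgorithm.past_mono (Nat.zero_le n) _ hB) (h.memLp_four_iter hJ h4 hX n)
  have hX2 : ∫ ω in B, ‖A.iter n ω - wo‖ ^ 2 ∂P ≤
      (sigmaS2 σs2 σπ2 / (N * ν) + 1) * muX μbar σμ2 := by
    refine le_trans ?_ hn
    rw [mse_eq]
    exact setIntegral_le_integral (h.integrable_norm_sq hJ n) (ae_of_all _ fun ω => sq_nonneg _)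
  have hY0 : 0 ≤ ∫ ω in B, ‖A.iter n ω - wo‖ ^ 4 ∂P := integral_nonneg fun ω => by positivity
  refine hrec.trans ?_
  rw [← h.mul_muX]
  generalize ∫ ω in B, ‖A.iter n ω - wo‖ ^ 4 ∂P = Y at *
  generalize ∫ ω in B, ‖A.iter n ω - wo‖ ^ 2 ∂P = X at *
  generalize sigmaS2 σs2 σπ2 / (N * ν) + 1 = K at *
  set x := muX μbar σμ2 with hx
  have a1 : 24 * μub ^ 2 * ((δ ^ 4 + N * ∑ k, β4 k) * Y + N * ∑ k, σ4 k) ≤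
      24 * (δ ^ 4 + N * ∑ k, β4 k) * Y + 24 * |c| * (N * ∑ k, σ4 k) * x := by
    have b1 : μub ^ 2 * ((δ ^ 4 + N * ∑ k, β4 k) * Y) ≤ 1 * ((δ ^ 4 + N * ∑ k, β4 k) * Y) :=
      mul_le_mul_of_nonneg_right hub (by positivity)
    have b2 := mul_le_mul_of_nonneg_right hc' hsig4
    linarith
  have a2 : (∑ k, σs2 k) * X ≤ (∑ k, σs2 k) * (K * x) := mul_le_mul_of_nonneg_left hX2 hsig2
  -- The condition `fourth` lets the higher-order terms use up three of the four units `ν μbar / N`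
  -- of drift; the last one is the contraction rate.
  have a3 := mul_le_mul_of_nonneg_right hμ.fourth hY0
  have a4 : μbar * x * (16 * ((δ ^ 2 + ∑ k, β2 k) * Y + (∑ k, σs2 k) * X) +
      24 * μub ^ 2 * ((δ ^ 4 + N * ∑ k, β4 k) * Y + N * ∑ k, σ4 k)) ≤
      μbar * (3 * ν / N * Y + x * (16 * (∑ k, σs2 k) * K + 24 * |c| * (N * ∑ k, σ4 k)) * x) := by
    rw [mul_assoc]
    refine mul_le_mul_of_nonneg_left ?_ hμpos.le
    have b1 := mul_le_mul_of_nonneg_left (add_le_add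
      (mul_le_mul_of_nonneg_left (add_le_add_right a2 ((δ ^ 2 + ∑ k, β2 k) * Y))
        (by norm_num : (0 : ℝ) ≤ 16)) a1) hxpos.le
    refine b1.trans ?_
    linarith
  have a5 : ν * μbar / N * (N / ν * (16 * (∑ k, σs2 k) * K + 24 * |c| * (N * ∑ k, σ4 k)) * x ^ 2) =
      μbar * (x * (16 * (∑ k, σs2 k) * K + 24 * |c| * (N * ∑ k, σ4 k)) * x) := by
    field_simp
  rw [a5]
  have a6 : (1 - ν * μbar / N) * Y = (1 - 4 * ν * (μbar / N)) * Y + μbar * (3 * ν / N * Y) := by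
    ring
  rw [a6]
  linarith

/-- Chebyshev's inequality for the initial error, which may lack a fourth moment. The event belongs
to the initial σ-algebra, hence to every later past, so that all recursions can be localized to it.
Adding one to the initial error keeps the radius positive. -/
theorem exists_event_bounded_init (h : AsyncCentralizedModel P A J wo β2 σs2 σπ2 μbar σμ2 μub)
    (hJ : CostSystem J wo ν δ) {ε : ℝ} (hε : 0 < ε) :
    ∃ B, MeasurableSet[A.past 0] B ∧ MemLp (fun ω => A.iter 0 ω - wo) 4 (P.restrict B) ∧
      P.real Bᶜ ≤ ε := by
  have h0 : 0 < mse P A wo 0 + 1 := add_pos_of_nonneg_of_pos (mse_nonneg 0) one_pos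
  set R := (mse P A wo 0 + 1) / ε with hR
  have hRpos : 0 < R := by positivity
  have hmeas : Measurable[A.past 0] (fun ω => ‖A.iter 0 ω - wo‖ ^ 2) :=
    (measurable_norm.comp ((A.measurable_iter_past 0).sub_const wo)).pow_const 2
  have hB : MeasurableSet[A.past 0] {ω | ‖A.iter 0 ω - wo‖ ^ 2 < R} :=
    hmeas measurableSet_Iio
  refine ⟨_, hB, ?_, ?_⟩
  · refine MemLp.of_bound ((h.measurable_iter hJ 0).sub_const wo).aestronglyMeasurable
      (Real.sqrt R) ?_
    refine (ae_restrict_iff' (h.past_le hJ 0 _ hB)).2 (ae_of_all _ fun ω hω => ?_)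
    exact Real.le_sqrt_of_sq_le (le_of_lt hω)
  · have h1 := mul_meas_ge_le_integral_of_nonneg (μ := P)
      (ae_of_all _ fun ω => sq_nonneg ‖A.iter 0 ω - wo‖) (h.integrable_norm_sq hJ 0) R
    rw [← mse_eq] at h1
    have h2 : {ω | ‖A.iter 0 ω - wo‖ ^ 2 < R}ᶜ = {ω | R ≤ ‖A.iter 0 ω - wo‖ ^ 2} := by
      ext ω
      simp
    rw [h2]
    by_contra! hc
    have h3 := mul_lt_mul_of_pos_left hc hRpos
    have h4 : R * ε = mse P A wo 0 + 1 := by rw [hR]; field_simp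
    linarith

/-- The steady-state contribution of the nonlinear part of the gradient is of order `μ_x^{3/2}`. -/
theorem eventually_integral_nonlinear_le
    (h : AsyncCentralizedModel P A J wo β2 σs2 σπ2 μbar σμ2 μub) (hN : 0 < N)
    (hJ : CostSystem J wo ν δ) (hβ2 : ∀ k, 0 ≤ β2 k) (hσs2 : ∀ k, 0 ≤ σs2 k)
    (h4 : FourthMomentCond P A J wo β4 σ4) (hβ4 : ∀ k, 0 ≤ β4 k) (hσ4 : ∀ k, 0 ≤ σ4 k)
    (hc : μub ^ 2 ≤ c * muX μbar σμ2) (hμ : SmallStep N ν δ β2 σπ2 β4 c (muX μbar σμ2))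
    {a b : ℝ} (ha : 0 ≤ a) (hb : 0 ≤ b) {f : Vec M → ℝ} (hf : Measurable f)
    (hf1 : ∀ w, |f w| ≤ a * ‖w - wo‖ ^ 2) (hf2 : ∀ w, |f w| ≤ b * ‖w - wo‖ ^ 3) :
    ∀ᶠ n in atTop, |∫ ω, f (A.iter n ω) ∂P| ≤
      (b * ((sigmaS2 σs2 σπ2 / (N * ν) + 1) +
        (N / ν * (16 * (∑ k, σs2 k) * (sigmaS2 σs2 σπ2 / (N * ν) + 1) +
          24 * |c| * (N * ∑ k, σ4 k)) + 1)) + a * (sigmaS2 σs2 σπ2 / (N * ν) + 1)) *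
      (muX μbar σμ2 * Real.sqrt (muX μbar σμ2)) := by
  have hx := h.muX_pos
  have hν := hJ.cost.nu_pos
  have hs : 0 < Real.sqrt (muX μbar σμ2) := Real.sqrt_pos.2 hx
  have hss : Real.sqrt (muX μbar σμ2) ^ 2 = muX μbar σμ2 := Real.sq_sqrt hx.le
  -- The exceptional probability `√μ_x` is chosen so that the mean-square error on the complement is
  -- `O(μ_x * √μ_x)`. The event may depend on the model, since only the eventual bound has to be
  -- uniform.
  obtain ⟨B, hB, hX, hPB⟩ := h.exists_event_bounded_init hJ hs
  have hSN : 0 ≤ sigmaS2 σs2 σπ2 / (N * ν) :=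
    div_nonneg (h.sigmaS2_nonneg hσs2) (by positivity)
  filter_upwards [h.eventually_mse_le_mul hN hJ hβ2 hμ,
    h.eventually_setIntegral_norm_pow_four_le hN hJ hβ2 hσs2 h4 hβ4 hσ4 hc hμ hB hX,
    h.eventually_setIntegral_norm_sq_le hN hJ hβ2 hμ.mean_square hB.compl (mul_pos hx hs)]
    with n h1 h2 h3
  have hBm : MeasurableSet B := h.past_le hJ 0 _ hB
  have hX2 := h.integrable_norm_sq hJ n
  have hX4 : IntegrableOn (fun ω => ‖A.iter n ω - wo‖ ^ 4) B P :=
    (h.memLp_four_iter hJ h4 hX n).integrable_norm_pow (p := 4) (by norm_num)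
  have hfi : Integrable (fun ω => f (A.iter n ω)) P :=
    (hX2.const_mul a).mono' (hf.comp (h.measurable_iter hJ n)).aestronglyMeasurable
      (ae_of_all _ fun ω => hf1 _)
  have hX2B : ∫ ω in B, ‖A.iter n ω - wo‖ ^ 2 ∂P ≤
      (sigmaS2 σs2 σπ2 / (N * ν) + 1) * muX μbar σμ2 := by
    refine le_trans ?_ h1
    rw [mse_eq]
    exact setIntegral_le_integral hX2 (ae_of_all _ fun ω => sq_nonneg _)
  rw [← integral_add_compl hBm hfi]
  have g1 : |∫ ω in B, f (A.iter n ω) ∂P| ≤ b *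
      (Real.sqrt (muX μbar σμ2) * ∫ ω in B, ‖A.iter n ω - wo‖ ^ 2 ∂P +
        (Real.sqrt (muX μbar σμ2))⁻¹ * ∫ ω in B, ‖A.iter n ω - wo‖ ^ 4 ∂P) := by
    rw [← integral_const_mul, ← integral_const_mul,
      ← integral_add (hX2.integrableOn.const_mul _) (hX4.const_mul _), ← integral_const_mul]
    refine (abs_integral_le_integral_abs).trans (integral_mono hfi.integrableOn.abs
      (((hX2.integrableOn.const_mul _).add (hX4.const_mul _)).const_mul b) fun ω => ?_)
    refine (hf2 _).trans (mul_le_mul_of_nonneg_left ?_ hb)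
    generalize ‖A.iter n ω - wo‖ = t
    -- Interpolation of the cubic moment, `2t³ ≤ s t² + s⁻¹ t⁴`; with `s = √μ_x` both terms are of
    -- order `μ_x^{3/2}`.
    have e : Real.sqrt (muX μbar σμ2) * t ^ 2 + (Real.sqrt (muX μbar σμ2))⁻¹ * t ^ 4 - 2 * t ^ 3 =
        (Real.sqrt (muX μbar σμ2))⁻¹ * (t * (Real.sqrt (muX μbar σμ2) - t)) ^ 2 := by
      field_simp
      ring
    have e0 : 0 ≤ (Real.sqrt (muX μbar σμ2))⁻¹ * (t * (Real.sqrt (muX μbar σμ2) - t)) ^ 2 := by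
      positivity
    have e1 : 0 ≤ Real.sqrt (muX μbar σμ2) * t ^ 2 + (Real.sqrt (muX μbar σμ2))⁻¹ * t ^ 4 := by
      positivity
    linarith
  have g2 : |∫ ω in Bᶜ, f (A.iter n ω) ∂P| ≤ a * ∫ ω in Bᶜ, ‖A.iter n ω - wo‖ ^ 2 ∂P := by
    rw [← integral_const_mul]
    exact (abs_integral_le_integral_abs).trans (integral_mono hfi.integrableOn.abs
      (hX2.integrableOn.const_mul a) fun ω => hf1 _)
  have g3 : ∫ ω in Bᶜ, ‖A.iter n ω - wo‖ ^ 2 ∂P ≤ (sigmaS2 σs2 σπ2 / (N * ν) + 1) *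
      (muX μbar σμ2 * Real.sqrt (muX μbar σμ2)) := by
    refine h3.trans ?_
    have := mul_le_mul_of_nonneg_left hPB (mul_nonneg hSN hx.le)
    linarith
  set s := Real.sqrt (muX μbar σμ2) with hsdef
  have g4 : s⁻¹ * muX μbar σμ2 ^ 2 = muX μbar σμ2 * s := by
    rw [← hss]
    field_simp
  have g5 := mul_le_mul_of_nonneg_left hX2B hs.le
  have g6 := mul_le_mul_of_nonneg_left h2 (inv_nonneg.2 hs.le)
  have g7 := mul_le_mul_of_nonneg_left (add_le_add g5 g6) hb
  have g8 := mul_le_mul_of_nonneg_left g3 ha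
  refine (abs_add_le _ _).trans ?_
  refine (add_le_add (g1.trans g7) (g2.trans g8)).trans_eq ?_
  rw [mul_left_comm s⁻¹, g4]
  ring

end AsyncCentralizedModel

/-! ### Conditional covariance matrices as quadratic forms. -/

section CondCross

open scoped RealInnerProductSpace

variable {M : ℕ} {Ω : Type*} {mΩ : MeasurableSpace Ω} {P : Measure Ω} [IsProbabilityMeasure P]

theorem inner_toEuclideanCLM_eq_sum (B : Matrix (Fin M) (Fin M) ℝ) (u : Vec M) :
    ⟪u, Matrix.toEuclideanCLM (n := Fin M) (𝕜 := ℝ) B u⟫ = ∑ a, ∑ b, u a * u b * B a b := by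
  rw [Matrix.inner_toEuclideanCLM]
  simp only [dotProduct, Matrix.mulVec, Finset.mul_sum]
  exact Finset.sum_congr rfl fun a _ => Finset.sum_congr rfl fun b _ => by ring

theorem condExp_inner_sq {Ω : Type*} (m : MeasurableSpace Ω) {mΩ : MeasurableSpace Ω}
    {P : Measure Ω} [IsProbabilityMeasure P] {x : Ω → Vec M} (hx : MemLp x 2 P) (u : Vec M) :
    P[fun ω => ⟪u, x ω⟫ ^ 2 | m] =ᵐ[P] fun ω =>
      ⟪u, Matrix.toEuclideanCLM (n := Fin M) (𝕜 := ℝ) (condCross P m x x ω) u⟫ := by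
  have hi : ∀ a b, Integrable (fun ω => x ω a * x ω b) P := fun a b =>
    (AsyncCentralizedModel.memLp_coord hx a).integrable_mul (AsyncCentralizedModel.memLp_coord hx b)
  have e : (fun ω => ⟪u, x ω⟫ ^ 2) =
      ∑ p : Fin M × Fin M, (u p.1 * u p.2) • fun ω => x ω p.1 * x ω p.2 := by
    ext ω
    simp only [PiLp.inner_apply, RCLike.inner_apply, conj_trivial, pow_two, Finset.sum_mul_sum,
      Finset.sum_apply, Pi.smul_apply, smul_eq_mul, Fintype.sum_prod_type]
    exact Finset.sum_congr rfl fun a _ => Finset.sum_congr rfl fun b _ => by ring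
  rw [e]
  have h1 := condExp_finsetSum (μ := P) (s := Finset.univ)
    (f := fun p : Fin M × Fin M => (u p.1 * u p.2) • fun ω => x ω p.1 * x ω p.2)
    (fun p _ => (hi p.1 p.2).smul _) m
  have h2 : ∀ᵐ ω ∂P, ∀ p : Fin M × Fin M,
      (P[(u p.1 * u p.2) • fun ω => x ω p.1 * x ω p.2 | m]) ω =
        (u p.1 * u p.2) * (P[fun ω => x ω p.1 * x ω p.2 | m]) ω :=
    ae_all_iff.2 fun p => condExp_smul (u p.1 * u p.2) (fun ω => x ω p.1 * x ω p.2) m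
  filter_upwards [h1, h2] with ω h3 h4
  rw [h3, inner_toEuclideanCLM_eq_sum, Finset.sum_apply, Fintype.sum_prod_type]
  exact Finset.sum_congr rfl fun a _ => Finset.sum_congr rfl fun b _ => h4 (a, b)

theorem abs_inner_toEuclideanCLM_sub_le {B C : Matrix (Fin M) (Fin M) ℝ} {u : Vec M}
    (hu : ‖u‖ = 1) :
    |⟪u, Matrix.toEuclideanCLM (n := Fin M) (𝕜 := ℝ) B u⟫ -
      ⟪u, Matrix.toEuclideanCLM (n := Fin M) (𝕜 := ℝ) C u⟫| ≤ specNorm (B - C) := by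
  rw [← inner_sub_right, ← sub_apply, ← map_sub]
  refine (abs_real_inner_le_norm _ _).trans ?_
  rw [hu, one_mul, specNorm]
  refine (ContinuousLinearMap.le_opNorm _ _).trans_eq ?_
  rw [hu, mul_one]

/-- Replaces the exponent `κ` by the first and second moments, the only ones available without
localization. -/
theorem Real.rpow_le_add_sq {t κ : ℝ} (ht : 0 ≤ t) (h1 : 1 ≤ κ) (h2 : κ ≤ 2) :
    t ^ κ ≤ t + t ^ 2 := by
  rcases le_total t 1 with h | h
  · have := Real.rpow_le_rpow_of_exponent_ge' ht h zero_le_one h1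
    rw [Real.rpow_one] at this
    nlinarith
  · have := Real.rpow_le_rpow_of_exponent_le h h2
    rw [Real.rpow_two] at this
    linarith

end CondCross

/-! ### The noise variance along a direction in steady state. -/

namespace AsyncCentralizedModel

open scoped RealInnerProductSpace

set_option linter.unusedSectionVars false

variable {M N : ℕ} {Ω : Type*} {mΩ : MeasurableSpace Ω} {P : Measure Ω} [IsProbabilityMeasure P]
  {A : CentralizedAlgorithm M N Ω} {J : Fin N → Vec M → ℝ} {wo : Vec M}
  {β2 σs2 σπ2 : Fin N → ℝ} {μbar σμ2 μub : ℝ} {ν δ : ℝ} {τ₂ κ r : ℝ}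
  {Rs : Fin N → Matrix (Fin M) (Fin M) ℝ}

theorem abs_inner_le_of_norm_eq_one {u x : Vec M} (hu : ‖u‖ = 1) : |⟪u, x⟫| ≤ ‖x‖ := by
  simpa [hu] using abs_real_inner_le_norm u x

theorem inner_sq_le_of_norm_eq_one {u x : Vec M} (hu : ‖u‖ = 1) : ⟪u, x⟫ ^ 2 ≤ ‖x‖ ^ 2 := by
  rw [← sq_abs]
  exact pow_le_pow_left₀ (abs_nonneg _) (abs_inner_le_of_norm_eq_one hu) 2

theorem memLp_inner {x : Ω → Vec M} {p : ENNReal} (hx : MemLp x p P) (u : Vec M) :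
    MemLp (fun ω => ⟪u, x ω⟫) p P := hx.const_inner u

theorem integrable_inner_sq {x : Ω → Vec M} (hx : MemLp x 2 P) (u : Vec M) :
    Integrable (fun ω => ⟪u, x ω⟫ ^ 2) P := (memLp_inner hx u).integrable_sq

/-- In the neighbourhood of `wo` on which the covariance is smooth, the quadratic form of the
conditional noise covariance at `wo` is bounded. -/
theorem exists_local_comparison
    (h : AsyncCentralizedModel P A J wo β2 σs2 σπ2 μbar σμ2 μub)
    (hJ : CostSystem J wo ν δ) (hβ2 : ∀ k, 0 ≤ β2 k) (hτ₂ : 0 ≤ τ₂) (h1κ : 1 ≤ κ) (hκ2 : κ ≤ 2)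
    (hr : 0 < r) (hS : CovarianceSmooth P A J wo τ₂ κ r) (hL : CovarianceLimit P A J wo Rs)
    {u : Vec M} (hu : ‖u‖ = 1) (k : Fin N) (n : ℕ) :
    (∀ᵐ ω ∂P, ‖A.iter n ω - wo‖ ≤ r →
      |(P[fun ω => ⟪u, A.noise J n k (A.iter n) ω⟫ ^ 2 | A.past n]) ω -
        ⟪u, Matrix.toEuclideanCLM (n := Fin M) (𝕜 := ℝ) (condCross P (A.past n)
          (A.noise J n k fun _ => wo) (A.noise J n k fun _ => wo) ω) u⟫| ≤
        τ₂ * (‖A.iter n ω - wo‖ + ‖A.iter n ω - wo‖ ^ 2)) ∧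
    (∀ᵐ ω ∂P, ‖A.iter n ω - wo‖ ≤ r →
      |⟪u, Matrix.toEuclideanCLM (n := Fin M) (𝕜 := ℝ) (condCross P (A.past n)
          (A.noise J n k fun _ => wo) (A.noise J n k fun _ => wo) ω) u⟫| ≤
        β2 k * r ^ 2 + σs2 k + τ₂ * (r + r ^ 2)) := by
  classical
  have hm := h.past_le hJ n
  have hXm : Measurable[A.past n] (fun ω => ‖A.iter n ω - wo‖) :=
    measurable_norm.comp ((A.measurable_iter_past n).sub_const wo)
  have hA : MeasurableSet[A.past n] {ω | ‖A.iter n ω - wo‖ ≤ r} := hXm measurableSet_Iic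
  set B : Set Ω := {ω | ‖A.iter n ω - wo‖ ≤ r} with hBdef
  -- The smoothness condition requires a point within `r` of `wo` for every `ω`, so the iterate is
  -- replaced by `wo` off `B`. On `B` the noises coincide, and conditioning commutes with the
  -- indicator of `B`.
  set v : Ω → Vec M := B.piecewise (A.iter n) (fun _ => wo) with hv
  have hvB : ∀ ω ∈ B, v ω = A.iter n ω := fun ω hω => Set.piecewise_eq_of_mem _ _ _ hω
  have hvm : Measurable[A.past n] v :=
    Measurable.piecewise hA (A.measurable_iter_past n) measurable_const
  have hvr : ∀ ω, ‖v ω - wo‖ ≤ r := by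
    intro ω
    by_cases hω : ω ∈ B
    · rw [hvB ω hω]; exact hω
    · rw [hv, Set.piecewise_eq_of_notMem _ _ _ hω, sub_self, norm_zero]; exact hr.le
  obtain ⟨hv2, hsm⟩ := hS n k v hvm hvr
  have hind : B.indicator (fun ω => ⟪u, A.noise J n k (A.iter n) ω⟫ ^ 2) =
      B.indicator (fun ω => ⟪u, A.noise J n k v ω⟫ ^ 2) := by
    ext ω
    by_cases hω : ω ∈ B
    · simp only [Set.indicator_of_mem hω, CentralizedAlgorithm.noise, hvB ω hω]
    · simp only [Set.indicator_of_notMem hω]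
  have c1 := condExp_indicator (m := A.past n) (integrable_inner_sq (h.noise.memLp n k) u) hA
  have c2 := condExp_indicator (m := A.past n) (integrable_inner_sq hv2 u) hA
  rw [← hind] at c2
  have c3 := condExp_inner_sq (A.past n) hv2 u
  have hfirst : ∀ᵐ ω ∂P, ω ∈ B →
      |(P[fun ω => ⟪u, A.noise J n k (A.iter n) ω⟫ ^ 2 | A.past n]) ω -
        ⟪u, Matrix.toEuclideanCLM (n := Fin M) (𝕜 := ℝ) (condCross P (A.past n)
          (A.noise J n k fun _ => wo) (A.noise J n k fun _ => wo) ω) u⟫| ≤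
        τ₂ * (‖A.iter n ω - wo‖ + ‖A.iter n ω - wo‖ ^ 2) := by
    filter_upwards [c1, c2, c3, hsm] with ω d1 d2 d3 d4 hω
    rw [d1, Set.indicator_of_mem hω, Set.indicator_of_mem hω] at d2
    rw [d2, d3]
    refine (abs_inner_toEuclideanCLM_sub_le hu).trans (d4.trans ?_)
    rw [hvB ω hω]
    exact mul_le_mul_of_nonneg_left (Real.rpow_le_add_sq (norm_nonneg _) h1κ hκ2) hτ₂
  refine ⟨hfirst, ?_⟩
  -- The covariance form at `wo` is nonnegative and exceeds the one at the iterate by at most the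
  -- smoothness error; the latter form is at most the conditional noise variance.
  have hmono : P[fun ω => ⟪u, A.noise J n k (A.iter n) ω⟫ ^ 2 | A.past n] ≤ᵐ[P]
      P[fun ω => ‖A.noise J n k (A.iter n) ω‖ ^ 2 | A.past n] :=
    condExp_mono (integrable_inner_sq (h.noise.memLp n k) u)
      ((h.noise.memLp n k).integrable_norm_pow two_ne_zero)
      (ae_of_all _ fun ω => inner_sq_le_of_norm_eq_one hu)
  have hwo0 : 0 ≤ᵐ[P] P[fun ω => ⟪u, A.noise J n k (fun _ => wo) ω⟫ ^ 2 | A.past n] :=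
    condExp_nonneg (ae_of_all _ fun ω => sq_nonneg _)
  filter_upwards [hfirst, hmono, h.noise.var_le n k, hwo0,
    condExp_inner_sq (A.past n) ((hL k).1 n) u] with ω e1 e2 e3 e4 e5 hω
  rw [e5] at e4
  rw [abs_of_nonneg e4]
  have f1 := (abs_le.1 (e1 hω)).1
  have hωr : ‖A.iter n ω - wo‖ ≤ r := hω
  have hsq : ‖A.iter n ω - wo‖ ^ 2 ≤ r ^ 2 := pow_le_pow_left₀ (norm_nonneg _) hωr 2
  have f2 : τ₂ * (‖A.iter n ω - wo‖ + ‖A.iter n ω - wo‖ ^ 2) ≤ τ₂ * (r + r ^ 2) :=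
    mul_le_mul_of_nonneg_left (add_le_add hωr hsq) hτ₂
  rw [norm_sub_rev wo] at e3
  have f3 := mul_le_mul_of_nonneg_left hsq (hβ2 k)
  linarith

/-- In steady state the noise variance along a direction is the limiting one up to an error of
order `μ_x^{1/2}`. -/
theorem eventually_integral_inner_noise_sq
    (h : AsyncCentralizedModel P A J wo β2 σs2 σπ2 μbar σμ2 μub)
    (hJ : CostSystem J wo ν δ) (hβ2 : ∀ k, 0 ≤ β2 k) (hσs2 : ∀ k, 0 ≤ σs2 k)
    (hτ₂ : 0 ≤ τ₂) (h1κ : 1 ≤ κ) (hκ2 : κ ≤ 2)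
    (hr : 0 < r) (hS : CovarianceSmooth P A J wo τ₂ κ r) (hL : CovarianceLimit P A J wo Rs)
    {u : Vec M} (hu : ‖u‖ = 1) (k : Fin N) {K x : ℝ} (hx : 0 < x) (hx1 : x ≤ 1) (hK : 0 ≤ K)
    (hmse : ∀ᶠ n in atTop, mse P A wo n ≤ K * x) :
    ∀ᶠ n in atTop, |∫ ω, ⟪u, A.noise J n k (A.iter n) ω⟫ ^ 2 ∂P -
        ⟪u, Matrix.toEuclideanCLM (n := Fin M) (𝕜 := ℝ) (Rs k) u⟫| ≤
      (τ₂ * (1 + 2 * K) + 1 + (β2 k + σs2 k / r ^ 2 +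
        |⟪u, Matrix.toEuclideanCLM (n := Fin M) (𝕜 := ℝ) (Rs k) u⟫| / r ^ 2) * K) *
          Real.sqrt x := by
  set ρ := ⟪u, Matrix.toEuclideanCLM (n := Fin M) (𝕜 := ℝ) (Rs k) u⟫ with hρ
  set Q : ℕ → Ω → ℝ := fun n ω => ⟪u, Matrix.toEuclideanCLM (n := Fin M) (𝕜 := ℝ)
    (condCross P (A.past n) (A.noise J n k fun _ => wo) (A.noise J n k fun _ => wo) ω) u⟫ with hQ
  set B : ℕ → Set Ω := fun n => {ω | ‖A.iter n ω - wo‖ ≤ r} with hBdef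
  have hBp : ∀ n, MeasurableSet[A.past n] (B n) := fun n =>
    (measurable_norm.comp ((A.measurable_iter_past n).sub_const wo)) measurableSet_Iic
  have hBm : ∀ n, MeasurableSet (B n) := fun n => h.past_le hJ n _ (hBp n)
  have hQi : ∀ n, Integrable (Q n) P := fun n =>
    integrable_condExp.congr (condExp_inner_sq (A.past n) ((hL k).1 n) u)
  have hcomp := fun n => h.exists_local_comparison hJ hβ2 hτ₂ h1κ hκ2 hr hS hL hu k n
  have hs : 0 < Real.sqrt x := Real.sqrt_pos.2 hx
  have hss : Real.sqrt x ^ 2 = x := Real.sq_sqrt hx.le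
  have hxs : x ≤ Real.sqrt x := by
    have : Real.sqrt x ≤ 1 := Real.sqrt_le_one.2 hx1
    nlinarith
  -- the covariance at `wo` converges in mean on the events `B n`
  have hlim : Tendsto (fun n => ∫ ω, (B n).indicator (fun ω => Q n ω - ρ) ω ∂P) atTop (𝓝 0) := by
    rw [← integral_zero Ω ℝ (μ := P)]
    -- The dominating constant comes from the local comparison and does not depend on `n`. No such
    -- bound is available off `B n`, which is why the indicator is kept.
    refine tendsto_integral_of_dominated_convergence
      (fun _ => (β2 k * r ^ 2 + σs2 k + τ₂ * (r + r ^ 2)) + |ρ|)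
      (fun n => ((hQi n).sub (integrable_const ρ)).1.indicator (hBm n)) (integrable_const _)
      (fun n => ?_) ?_
    · filter_upwards [(hcomp n).2] with ω hω
      by_cases hωB : ω ∈ B n
      · rw [Set.indicator_of_mem hωB, Real.norm_eq_abs]
        exact (abs_sub _ _).trans (add_le_add_left (hω hωB) _)
      · rw [Set.indicator_of_notMem hωB, norm_zero]
        have := hβ2 k
        have := hσs2 k
        positivity
    · filter_upwards [(hL k).2] with ω hω
      have hconv : Tendsto (fun n => Q n ω - ρ) atTop (𝓝 0) := by
        rw [← sub_self ρ]
        refine Tendsto.sub_const ?_ ρ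
        simp only [hQ, hρ, inner_toEuclideanCLM_eq_sum]
        exact tendsto_finsetSum _ fun a _ => tendsto_finsetSum _ fun b _ =>
          (hω a b).const_mul _
      refine squeeze_zero_norm (fun n => ?_) (by simpa using hconv.abs)
      rw [Real.norm_eq_abs]
      by_cases hωB : ω ∈ B n
      · rw [Set.indicator_of_mem hωB]
      · rw [Set.indicator_of_notMem hωB, abs_zero]
        exact abs_nonneg _
  have hsmall : ∀ᶠ n in atTop,
      |∫ ω, (B n).indicator (fun ω => Q n ω - ρ) ω ∂P| < Real.sqrt x := by
    have := hlim.abs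
    rw [abs_zero] at this
    exact this.eventually (gt_mem_nhds hs)
  filter_upwards [hmse, hsmall] with n h1 h2
  have hX2 := h.integrable_norm_sq hJ n
  have hX1 : Integrable (fun ω => ‖A.iter n ω - wo‖) P :=
    (h.memLp_iter_sub hJ n).integrable (by norm_num) |>.norm
  have hf : Integrable (fun ω => ⟪u, A.noise J n k (A.iter n) ω⟫ ^ 2) P :=
    integrable_inner_sq (h.noise.memLp n k) u
  rw [integral_indicator (hBm n), integral_sub (hQi n).integrableOn (integrable_const ρ).integrableOn]
    at h2
  simp only [integral_const, MeasurableSet.univ, measureReal_restrict_apply, Set.univ_inter,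
    smul_eq_mul] at h2
  have hPsum : P.real (B n) + P.real (B n)ᶜ = 1 := by
    rw [measureReal_add_measureReal_compl (hBm n)]
    simp
  -- Chebyshev's inequality: the iterate is farther than `r` from `wo` with probability `O(x)`.
  have hPc : P.real (B n)ᶜ * r ^ 2 ≤ K * x := by
    refine le_trans ?_ h1
    have g1 := mul_meas_ge_le_integral_of_nonneg (μ := P)
      (ae_of_all _ fun ω => sq_nonneg ‖A.iter n ω - wo‖) hX2 (r ^ 2)
    rw [← mse_eq] at g1
    refine le_trans ?_ g1
    rw [mul_comm]
    refine mul_le_mul_of_nonneg_left (measureReal_mono fun ω hω => ?_) (sq_nonneg r)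
    have : r < ‖A.iter n ω - wo‖ := by simpa [B] using hω
    exact pow_le_pow_left₀ hr.le this.le 2
  have hPc' : P.real (B n)ᶜ ≤ K * x / r ^ 2 := by
    rw [le_div_iff₀ (by positivity)]
    exact hPc
  have hn2 : Integrable (fun ω => ‖A.noise J n k (A.iter n) ω‖ ^ 2) P :=
    (h.noise.memLp n k).integrable_norm_pow two_ne_zero
  -- outside of `B n`
  have hout0 : 0 ≤ ∫ ω in (B n)ᶜ, ⟪u, A.noise J n k (A.iter n) ω⟫ ^ 2 ∂P :=
    integral_nonneg fun ω => sq_nonneg _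
  have hout : ∫ ω in (B n)ᶜ, ⟪u, A.noise J n k (A.iter n) ω⟫ ^ 2 ∂P ≤
      β2 k * (K * x) + σs2 k * (K * x / r ^ 2) := by
    calc ∫ ω in (B n)ᶜ, ⟪u, A.noise J n k (A.iter n) ω⟫ ^ 2 ∂P
        ≤ ∫ ω in (B n)ᶜ, ‖A.noise J n k (A.iter n) ω‖ ^ 2 ∂P :=
          integral_mono hf.integrableOn hn2.integrableOn
            fun ω => inner_sq_le_of_norm_eq_one hu
      _ ≤ β2 k * ∫ ω in (B n)ᶜ, ‖A.iter n ω - wo‖ ^ 2 ∂P + σs2 k * P.real (B n)ᶜ :=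
          h.setIntegral_norm_sq_noise_le hJ (hBp n).compl k
      _ ≤ _ := by
          refine add_le_add (mul_le_mul_of_nonneg_left (le_trans ?_ h1) (hβ2 k))
            (mul_le_mul_of_nonneg_left hPc' (hσs2 k))
          rw [mse_eq]
          exact setIntegral_le_integral hX2 (ae_of_all _ fun ω => sq_nonneg _)
  -- inside of `B n`
  have hin : |∫ ω in B n, ⟪u, A.noise J n k (A.iter n) ω⟫ ^ 2 ∂P - ∫ ω in B n, Q n ω ∂P| ≤
      τ₂ * ((1 + 2 * K) * Real.sqrt x) := by
    rw [← setIntegral_condExp (h.past_le hJ n) hf (hBp n),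
      ← integral_sub integrable_condExp.integrableOn (hQi n).integrableOn]
    refine (abs_integral_le_integral_abs).trans ?_
    have g1 : ∫ ω in B n, |(P[fun ω => ⟪u, A.noise J n k (A.iter n) ω⟫ ^ 2 | A.past n]) ω -
        Q n ω| ∂P ≤ ∫ ω in B n, τ₂ * (Real.sqrt x + (Real.sqrt x)⁻¹ * ‖A.iter n ω - wo‖ ^ 2 +
          ‖A.iter n ω - wo‖ ^ 2) ∂P := by
      refine integral_mono_ae (integrable_condExp.integrableOn.sub (hQi n).integrableOn).abs
        ((((integrable_const _).add (hX2.const_mul _)).add hX2).const_mul τ₂).integrableOn ?_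
      refine (ae_restrict_iff' (hBm n)).2 ?_
      filter_upwards [(hcomp n).1] with ω hω hωB
      refine (hω hωB).trans (mul_le_mul_of_nonneg_left (add_le_add_left ?_ _) hτ₂)
      generalize ‖A.iter n ω - wo‖ = t
      -- Weighted mean inequality `2t ≤ √x + t²/√x`, balanced for a second moment of order `x`.
      have e : Real.sqrt x + (Real.sqrt x)⁻¹ * t ^ 2 - 2 * t =
          (Real.sqrt x)⁻¹ * (Real.sqrt x - t) ^ 2 := by
        field_simp
        ring
      have e0 : 0 ≤ (Real.sqrt x)⁻¹ * (Real.sqrt x - t) ^ 2 := by positivity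
      have e1 : 0 ≤ Real.sqrt x + (Real.sqrt x)⁻¹ * t ^ 2 := by positivity
      linarith
    refine g1.trans ?_
    rw [integral_const_mul]
    refine mul_le_mul_of_nonneg_left ?_ hτ₂
    have i1 : Integrable (fun ω => Real.sqrt x + (Real.sqrt x)⁻¹ * ‖A.iter n ω - wo‖ ^ 2) P :=
      (integrable_const _).add (hX2.const_mul _)
    calc ∫ ω in B n, (Real.sqrt x + (Real.sqrt x)⁻¹ * ‖A.iter n ω - wo‖ ^ 2 +
          ‖A.iter n ω - wo‖ ^ 2) ∂P
        ≤ ∫ ω, (Real.sqrt x + (Real.sqrt x)⁻¹ * ‖A.iter n ω - wo‖ ^ 2 +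
          ‖A.iter n ω - wo‖ ^ 2) ∂P :=
          setIntegral_le_integral (i1.add hX2) (ae_of_all _ fun ω => by
            simp only [Pi.zero_apply]; positivity)
      _ = Real.sqrt x + (Real.sqrt x)⁻¹ * mse P A wo n + mse P A wo n := by
          rw [integral_add i1 hX2, integral_add (integrable_const _) (hX2.const_mul _),
            integral_const_mul, ← mse_eq]
          simp
      _ ≤ Real.sqrt x + (Real.sqrt x)⁻¹ * (K * x) + K * x := by gcongr
      _ ≤ (1 + 2 * K) * Real.sqrt x := by
          have e : (Real.sqrt x)⁻¹ * (K * x) = K * Real.sqrt x := by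
            nth_rewrite 2 [← hss]
            field_simp
          rw [e]
          have := mul_le_mul_of_nonneg_left hxs hK
          linarith
  rw [← integral_add_compl (hBm n) hf]
  have hρe : ρ = P.real (B n) * ρ + P.real (B n)ᶜ * ρ := by rw [← add_mul, hPsum, one_mul]
  have hρc : |P.real (B n)ᶜ * ρ| ≤ K * x / r ^ 2 * |ρ| := by
    rw [abs_mul, abs_of_nonneg measureReal_nonneg]
    exact mul_le_mul_of_nonneg_right hPc' (abs_nonneg _)
  have hKx : (β2 k + σs2 k / r ^ 2 + |ρ| / r ^ 2) * K * x ≤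
      (β2 k + σs2 k / r ^ 2 + |ρ| / r ^ 2) * K * Real.sqrt x := by
    have := hβ2 k
    have := hσs2 k
    gcongr
  have hKe : β2 k * (K * x) + σs2 k * (K * x / r ^ 2) + K * x / r ^ 2 * |ρ| =
      (β2 k + σs2 k / r ^ 2 + |ρ| / r ^ 2) * K * x := by ring
  have a1 := abs_le.1 hin
  have a2 := abs_le.1 h2.le
  have a3 := abs_le.1 hρc
  rw [abs_le]
  constructor
  · linarith [a1.1, a2.1, a3.2]
  · linarith [a1.2, a2.2, a3.1]

end AsyncCentralizedModel

/-! ### Eigenvectors of the Hessian. -/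

section Eigen

open scoped RealInnerProductSpace

variable {M : ℕ} {J : Vec M → ℝ} {ν δ : ℝ}

theorem CostCond.inner_eigenvector_hessian (h : CostCond J ν δ) (w : Vec M) (a : Fin M)
    (d : Vec M) :
    ⟪(isHermitian_hessian h w).eigenvectorBasis a, fderiv ℝ (gradient J) w d⟫ =
      (isHermitian_hessian h w).eigenvalues a *
        ⟪(isHermitian_hessian h w).eigenvectorBasis a, d⟫ := by
  set hH := isHermitian_hessian h w
  rw [← toEuclideanCLM_hessian, Matrix.inner_toEuclideanCLM, Matrix.dotProduct_mulVec,
    ← Matrix.mulVec_transpose, ← Matrix.conjTranspose_eq_transpose_of_trivial, hH.eq,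
    hH.mulVec_eigenvectorBasis, smul_dotProduct, smul_eq_mul, real_inner_comm,
    EuclideanSpace.inner_eq_star_dotProduct]
  simp

theorem CostCond.eigenvalues_mem (h : CostCond J ν δ) (w : Vec M) (a : Fin M) :
    (isHermitian_hessian h w).eigenvalues a ∈ Set.Icc ν δ := by
  have h1 := h.le_inner_hessian w ((isHermitian_hessian h w).eigenvectorBasis a)
  have h2 := h.inner_hessian_le w ((isHermitian_hessian h w).eigenvectorBasis a)
  rw [real_inner_comm, h.inner_eigenvector_hessian, real_inner_self_eq_norm_sq,
    (isHermitian_hessian h w).eigenvectorBasis.norm_eq_one] at h1 h2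
  constructor <;> linarith

end Eigen

/-! ### The affine recursion along an eigenvector and its fixed point. -/

namespace AsyncCentralizedModel

open scoped RealInnerProductSpace

set_option linter.unusedSectionVars false

variable {M N : ℕ} {Ω : Type*} {mΩ : MeasurableSpace Ω} {P : Measure Ω} [IsProbabilityMeasure P]
  {A : CentralizedAlgorithm M N Ω} {J : Fin N → Vec M → ℝ} {wo : Vec M}
  {β2 σs2 σπ2 : Fin N → ℝ} {μbar σμ2 μub : ℝ} {ν δ : ℝ}

/-- One step of the second moment of the error along a unit direction. -/
theorem integral_inner_sq_succ (h : AsyncCentralizedModel P A J wo β2 σs2 σπ2 μbar σμ2 μub)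
    (hJ : CostSystem J wo ν δ) {u : Vec M} (hu : ‖u‖ = 1) (i : ℕ) :
    ∃ q, 0 ≤ q ∧ q ≤ δ ^ 2 * mse P A wo i ∧
      ∫ ω, ⟪u, A.iter (i + 1) ω - wo⟫ ^ 2 ∂P = ∫ ω, ⟪u, A.iter i ω - wo⟫ ^ 2 ∂P -
        2 * (μbar / N) * ∫ ω, ⟪u, A.iter i ω - wo⟫ *
          ⟪u, gradient (aggregateCost J) (A.iter i ω)⟫ ∂P +
        (μbar ^ 2 + σμ2) * (q + ∑ k, (1 / (N : ℝ) ^ 2 + σπ2 k) *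
          ∫ ω, ⟪u, A.noise J i k (A.iter i) ω⟫ ^ 2 ∂P) := by
  have hS2 := h.noise.memLp i
  have hiterP := A.measurable_iter_past i
  have hX2 := h.memLp_iter_sub hJ i
  have hG2 : ∀ k, MemLp (fun ω => gradient (J k) (A.iter i ω)) 2 P := fun k => by
    have := h.memLp_gradient (B := Set.univ) hJ (by rwa [Measure.restrict_univ]) k
    rwa [Measure.restrict_univ] at this
  have hXP : Measurable[A.past i] (fun ω => A.iter i ω - wo) := hiterP.sub_const wo
  have hGP : ∀ k, Measurable[A.past i] (fun ω => gradient (J k) (A.iter i ω)) := fun k =>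
    (hJ.diff k).continuous_gradient.measurable.comp hiterP
  have hinner : Measurable (fun y : Vec M => ⟪u, y⟫) := by fun_prop
  -- Testing the noise against the vector `⟪u, Y⟫ • u` turns vector orthogonality into that of the
  -- scalar projections.
  have hzero : ∀ (Y : Ω → Vec M), Measurable[A.past i] Y → MemLp Y 2 P → ∀ k,
      ∫ ω in Set.univ, ⟪⟪u, Y ω⟫, ⟪u, A.noise J i k (A.iter i) ω⟫⟫ ∂P = 0 := by
    intro Y hY hY2 k
    have hy2 : MemLp (fun ω => ⟪u, Y ω⟫ • u) 2 P :=
      (memLp_inner hY2 u).of_le_mul (c := ‖u‖)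
        ((memLp_inner hY2 u).1.smul_const u) (ae_of_all _ fun ω => by
          rw [norm_smul, mul_comm])
    have := h.setIntegral_inner_noise hJ (i := i) (B := Set.univ) MeasurableSet.univ
      (y := fun ω => ⟪u, Y ω⟫ • u) ((hinner.comp hY).smul_const u) k
      (hy2.integrable_real_inner (hS2 k)).integrableOn
    simp only [real_inner_smul_left] at this
    simpa only [RCLike.inner_apply, conj_trivial, mul_comm] using this
  have hSS : ∀ k l, k ≠ l → ∫ ω in Set.univ, ⟪⟪u, A.noise J i k (A.iter i) ω⟫,
      ⟪u, A.noise J i l (A.iter i) ω⟫⟫ ∂P = 0 := fun k l hkl => by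
    have := h.setIntegral_inner_mul_inner_noise hJ (i := i) (B := Set.univ) MeasurableSet.univ
      hkl.symm u
    simpa only [RCLike.inner_apply, conj_trivial] using this
  have hXz := fun k => hzero _ hXP hX2 k
  have hGz := fun k l => hzero _ (hGP k) (hG2 k) l
  have hmse := h.integrable_norm_sq hJ i
  obtain ⟨mG, hmix, hle, hmeas⟩ := h.exists_mixingStep hJ i
  have hiter : Measurable[mG] (A.iter i) := hiterP.mono hle le_rfl
  -- The vector identity is reused with the inner product space `ℝ`.
  have key := hmix.integral_norm_sq (X := fun ω => ⟪u, A.iter i ω - wo⟫)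
    (G := fun k ω => ⟪u, gradient (J k) (A.iter i ω)⟫)
    (S := fun k ω => ⟪u, A.noise J i k (A.iter i) ω⟫) (B := Set.univ) MeasurableSet.univ
    (hinner.comp (hXP.mono hle le_rfl)) (fun k => hinner.comp ((hGP k).mono hle le_rfl))
    (fun k => hinner.comp (hmeas k _ hiter)) (memLp_inner hX2 u) (fun k => memLp_inner (hG2 k) u)
    (fun k => memLp_inner (hS2 k) u) hXz hGz hSS
  have hstep : ∀ ω, ⟪u, A.iter (i + 1) ω - wo⟫ = ⟪u, A.iter i ω - wo⟫ -
      A.step i ω • ∑ k, A.fusion i k ω • (⟪u, gradient (J k) (A.iter i ω)⟫ +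
        ⟪u, A.noise J i k (A.iter i) ω⟫) := fun ω => by
    rw [iter_succ_sub (J := J), inner_sub_right, real_inner_smul_right, inner_sum]
    simp only [real_inner_smul_right, inner_add_right, smul_eq_mul]
  simp only [← hstep, setIntegral_univ, Real.norm_eq_abs, sq_abs] at key
  have hGi : ∀ k l, Integrable (fun ω => ⟪⟪u, gradient (J k) (A.iter i ω)⟫,
      ⟪u, gradient (J l) (A.iter i ω)⟫⟫) P := fun k l =>
    (memLp_inner (hG2 k) u).integrable_real_inner (memLp_inner (hG2 l) u)
  have hq : ∑ k, ∑ l, (∫ ω, A.fusion i k ω * A.fusion i l ω ∂P) *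
      ∫ ω, ⟪⟪u, gradient (J k) (A.iter i ω)⟫, ⟪u, gradient (J l) (A.iter i ω)⟫⟫ ∂P =
      ∫ ω, ∑ k, ∑ l, (∫ ω, A.fusion i k ω * A.fusion i l ω ∂P) *
        ⟪⟪u, gradient (J k) (A.iter i ω)⟫, ⟪u, gradient (J l) (A.iter i ω)⟫⟫ ∂P := by
    rw [integral_finsetSum _ fun k _ => integrable_finsetSum _ fun l _ => (hGi k l).const_mul _]
    refine Finset.sum_congr rfl fun k _ => ?_
    rw [integral_finsetSum _ fun l _ => (hGi k l).const_mul _]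
    exact Finset.sum_congr rfl fun l _ => (integral_const_mul _ _).symm
  have hlin : ∑ k, ∫ ω, ⟪⟪u, A.iter i ω - wo⟫, ⟪u, gradient (J k) (A.iter i ω)⟫⟫ ∂P =
      ∫ ω, ⟪u, A.iter i ω - wo⟫ * ⟪u, gradient (aggregateCost J) (A.iter i ω)⟫ ∂P := by
    rw [← integral_finsetSum _ fun k _ =>
      (memLp_inner hX2 u).integrable_real_inner (memLp_inner (hG2 k) u)]
    simp only [gradient_aggregateCost hJ.diff, inner_sum, Finset.mul_sum, RCLike.inner_apply,
      conj_trivial, mul_comm]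
  rw [hlin] at key
  refine ⟨_, ?_, ?_, key⟩
  · rw [hq]
    exact integral_nonneg fun ω => hmix.weight_quadratic_nonneg _
  · rw [hq, mse_eq, ← integral_const_mul]
    refine integral_mono (integrable_finsetSum _ fun k _ => integrable_finsetSum _ fun l _ =>
      (hGi k l).const_mul _) (hmse.const_mul _) fun ω => ?_
    refine (hmix.weight_quadratic_le_sum _).trans ?_
    refine le_trans (Finset.sum_le_sum fun k _ => ?_)
      (sum_norm_sq_gradient_le hJ.diff hJ.conv hJ.min hJ.cost (A.iter i ω))
    rw [Real.norm_eq_abs, sq_abs]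
    exact inner_sq_le_of_norm_eq_one hu

end AsyncCentralizedModel

/-- One step of a perturbed scalar affine recursion towards its fixed point. -/
theorem abs_affine_step_sub_le {n m x s ν l p e q V W K₃ Kq KS : ℝ} (hn : 0 < n) (hm : 0 < m)
    (hx : 0 < x) (hν : 0 < ν) (hνl : ν ≤ l) (hl1 : 0 ≤ 1 - 2 * (m / n) * l)
    (he : |e| ≤ K₃ * (x * s)) (hq0 : 0 ≤ q) (hq : q ≤ Kq * s) (hV : |V - W| ≤ KS * s) :
    |p - 2 * (m / n) * (l * p + e) + m * x * (q + V) - x / (2 * n) * (l⁻¹ * (n ^ 2 * W))| ≤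
      (1 - ν * m / n) * |p - x / (2 * n) * (l⁻¹ * (n ^ 2 * W))| +
        ν * m / n * (n / ν * (2 / n * K₃ + Kq + KS) * (x * s)) := by
  have hl : 0 < l := hν.trans_le hνl
  -- Without `e` and `q`, and with `V = W`, stationarity reads `2 (m/n) l p = m x W`, whose solution
  -- is the subtracted constant.
  have hid : p - 2 * (m / n) * (l * p + e) + m * x * (q + V) -
      x / (2 * n) * (l⁻¹ * (n ^ 2 * W)) =
      (1 - 2 * (m / n) * l) * (p - x / (2 * n) * (l⁻¹ * (n ^ 2 * W))) +
        m * (x * (q + (V - W)) - 2 / n * e) := by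
    field_simp
    ring
  rw [hid]
  have herr : |x * (q + (V - W)) - 2 / n * e| ≤ (2 / n * K₃ + Kq + KS) * (x * s) := by
    have h5 : |q + (V - W)| ≤ (Kq + KS) * s := by
      refine (abs_add_le _ _).trans ?_
      rw [abs_of_nonneg hq0]
      linarith
    refine (abs_sub _ _).trans ?_
    rw [abs_mul, abs_mul, abs_of_pos hx, abs_of_pos (by positivity : (0 : ℝ) < 2 / n)]
    have h6 := mul_le_mul_of_nonneg_left h5 hx.le
    have h7 := mul_le_mul_of_nonneg_left he (by positivity : (0 : ℝ) ≤ 2 / n)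
    linarith
  have hcoef : 1 - 2 * (m / n) * l ≤ 1 - ν * m / n := by
    have h6 : 0 ≤ m / n := by positivity
    have h7 := mul_le_mul_of_nonneg_left hνl h6
    have h8 : ν * m / n = m / n * ν := by ring
    have h9 : 0 ≤ m / n * l := by positivity
    rw [h8]
    linarith
  refine (abs_add_le _ _).trans ?_
  rw [abs_mul, abs_mul, abs_of_nonneg hl1, abs_of_pos hm]
  have g1 := mul_le_mul_of_nonneg_right hcoef
    (abs_nonneg (p - x / (2 * n) * (l⁻¹ * (n ^ 2 * W))))
  have g2 := mul_le_mul_of_nonneg_left herr hm.le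
  have g3 : ν * m / n * (n / ν * (2 / n * K₃ + Kq + KS) * (x * s)) =
      m * ((2 / n * K₃ + Kq + KS) * (x * s)) := by
    field_simp
  rw [g3]
  linarith

open scoped RealInnerProductSpace in
/-- Steady-state second moment of the error along an eigenvector of the Hessian. -/
theorem exists_eventually_abs_integral_inner_sq_sub_le {M N : ℕ} (hN : 0 < N)
    {J : Fin N → Vec M → ℝ} {wo : Vec M} {ν δ : ℝ} (hJ : CostSystem J wo ν δ)
    {β2 σs2 σπ2 : Fin N → ℝ} (hβ2 : ∀ k, 0 ≤ β2 k) (hσs2 : ∀ k, 0 ≤ σs2 k)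
    (Rs : Fin N → Matrix (Fin M) (Fin M) ℝ) {τ τ₂ κ r : ℝ} {β4 σ4 : Fin N → ℝ} (c : ℝ)
    (hτ : 0 ≤ τ) (hτ₂ : 0 ≤ τ₂) (h1κ : 1 ≤ κ) (hκ2 : κ ≤ 2) (hr : 0 < r)
    (hβ4 : ∀ k, 0 ≤ β4 k) (hσ4 : ∀ k, 0 ≤ σ4 k)
    (hL : HessianLipschitzAt (aggregateCost J) wo τ r) (a : Fin M) :
    ∃ K : ℝ, ∀ (Ω : Type u) [MeasurableSpace Ω] (P : Measure Ω) [IsProbabilityMeasure P]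
      (A : CentralizedAlgorithm M N Ω) (μbar σμ2 μub : ℝ),
      AsyncCentralizedModel P A J wo β2 σs2 σπ2 μbar σμ2 μub →
      CovarianceSmooth P A J wo τ₂ κ r → CovarianceLimit P A J wo Rs →
      FourthMomentCond P A J wo β4 σ4 → μub ^ 2 ≤ c * muX μbar σμ2 →
      SmallStep N ν δ β2 σπ2 β4 c (muX μbar σμ2) →
      ∀ᶠ n in atTop, |∫ ω, ⟪(isHermitian_hessian hJ.cost wo).eigenvectorBasis a,
          A.iter n ω - wo⟫ ^ 2 ∂P -
        muX μbar σμ2 / (2 * N) * (((isHermitian_hessian hJ.cost wo).eigenvalues a)⁻¹ *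
          ∑ k, (1 + (N : ℝ) ^ 2 * σπ2 k) * ⟪(isHermitian_hessian hJ.cost wo).eigenvectorBasis a,
            Matrix.toEuclideanCLM (n := Fin M) (𝕜 := ℝ) (Rs k)
              ((isHermitian_hessian hJ.cost wo).eigenvectorBasis a)⟫)| ≤
        K * (muX μbar σμ2 * Real.sqrt (muX μbar σμ2)) := by
  have hν := hJ.cost.nu_pos
  have hδ := hJ.cost.delta_pos
  have hN' : (0 : ℝ) < N := by positivity
  obtain ⟨hlν, hlδ⟩ := hJ.cost.eigenvalues_mem wo a
  have hH := hJ.cost.inner_eigenvector_hessian wo a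
  have hu : ‖(isHermitian_hessian hJ.cost wo).eigenvectorBasis a‖ = 1 :=
    (isHermitian_hessian hJ.cost wo).eigenvectorBasis.norm_eq_one a
  generalize (isHermitian_hessian hJ.cost wo).eigenvectorBasis a = u at *
  generalize (isHermitian_hessian hJ.cost wo).eigenvalues a = l at *
  have hl : 0 < l := hν.trans_le hlν
  have hdev := abs_inner_gradient_sub_le hJ.min hJ.cost hτ hr hL hu hl hlδ hH
  -- Deviation of the drift from its linearization: the cubic bound serves on the event with bounded
  -- initial error, the quadratic one on its complement.
  set f : Vec M → ℝ := fun w => ⟪u, w - wo⟫ *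
    (⟪u, gradient (aggregateCost J) w⟫ - l * ⟪u, w - wo⟫) with hf
  have hfm : Measurable f := by
    have : Continuous (gradient (aggregateCost J)) := hJ.cost.twiceDiff.continuous_gradient
    exact Continuous.measurable (by fun_prop)
  have hux : ∀ w, |⟪u, w - wo⟫| ≤ ‖w - wo‖ := fun w =>
    AsyncCentralizedModel.abs_inner_le_of_norm_eq_one hu
  have hf1 : ∀ w, |f w| ≤ 2 * δ * ‖w - wo‖ ^ 2 := fun w => by
    rw [hf, abs_mul]
    refine (mul_le_mul (hux w) (hdev w).1 (abs_nonneg _) (norm_nonneg _)).trans_eq ?_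
    ring
  have hf2 : ∀ w, |f w| ≤ (τ + 2 * δ / r) * ‖w - wo‖ ^ 3 := fun w => by
    rw [hf, abs_mul]
    refine (mul_le_mul (hux w) (hdev w).2 (abs_nonneg _) (norm_nonneg _)).trans_eq ?_
    ring
  set K₁ := sigmaS2 σs2 σπ2 / (N * ν) + 1 with hK₁
  set K₃ := (τ + 2 * δ / r) * (K₁ + (N / ν * (16 * (∑ k, σs2 k) * K₁ +
    24 * |c| * (N * ∑ k, σ4 k)) + 1)) + 2 * δ * K₁ with hK₃
  set ρ : Fin N → ℝ := fun k =>
    ⟪u, Matrix.toEuclideanCLM (n := Fin M) (𝕜 := ℝ) (Rs k) u⟫ with hρ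
  set Kn : Fin N → ℝ := fun k => τ₂ * (1 + 2 * K₁) + 1 +
    (β2 k + σs2 k / r ^ 2 + |ρ k| / r ^ 2) * K₁ with hKn
  -- The three summands account for the nonlinear drift, the gradient quadratic form and the noise
  -- variances. All constants are fixed before the probability space, which makes the bound uniform.
  set KE := 2 / N * K₃ + δ ^ 2 * K₁ + ∑ k, (1 / (N : ℝ) ^ 2 + σπ2 k) * Kn k with hKE
  refine ⟨N / ν * KE + 1, ?_⟩
  intro Ω _ P _ A μbar σμ2 μub h hS hR h4 hc hμ
  have hxpos := h.muX_pos
  have hμpos := h.step.mean_pos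
  have hK₁0 : 0 ≤ K₁ := add_nonneg (div_nonneg (h.sigmaS2_nonneg hσs2) (by positivity)) zero_le_one
  have hmse := h.eventually_mse_le_mul hN hJ hβ2 hμ
  have hnl := h.eventually_integral_nonlinear_le hN hJ hβ2 hσs2 h4 hβ4 hσ4 hc hμ
    (by positivity) (by positivity) hfm hf1 hf2
  have hnoise : ∀ᶠ n in atTop, ∀ k, |∫ ω, ⟪u, A.noise J n k (A.iter n) ω⟫ ^ 2 ∂P - ρ k| ≤
      Kn k * Real.sqrt (muX μbar σμ2) :=
    eventually_all.2 fun k => h.eventually_integral_inner_noise_sq hJ hβ2 hσs2 hτ₂ h1κ hκ2 hr hS hR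
      hu k hxpos hμ.le_one hK₁0 hmse
  set x := muX μbar σμ2 with hx
  set s := Real.sqrt x with hs
  have hspos : 0 < s := Real.sqrt_pos.2 hxpos
  have hss : s ^ 2 = x := Real.sq_sqrt hxpos.le
  have hxs : x ≤ s := by
    have : s ≤ 1 := Real.sqrt_le_one.2 hμ.le_one
    nlinarith
  -- The extra `+ 1` in the constant pays for the margin `x * s` in the contraction lemma.
  rw [add_mul, one_mul]
  refine eventually_le_of_contraction (ρ := ν * μbar / N) (by positivity)
    (h.alphaCent_le hN hJ hβ2 hμ.mean_square).2 (by positivity) ?_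
  filter_upwards [hmse, hnl, hnoise] with n h1 h2 h3
  obtain ⟨q, hq0, hq1, hrec⟩ := h.integral_inner_sq_succ hJ hu n
  have hXu : Integrable (fun ω => ⟪u, A.iter n ω - wo⟫ ^ 2) P :=
    AsyncCentralizedModel.integrable_inner_sq (h.memLp_iter_sub hJ n) u
  have hfi : Integrable (fun ω => f (A.iter n ω)) P :=
    ((h.integrable_norm_sq hJ n).const_mul (2 * δ)).mono'
      (hfm.comp (h.measurable_iter hJ n)).aestronglyMeasurable (ae_of_all _ fun ω => hf1 _)
  have hsplit : ∫ ω, ⟪u, A.iter n ω - wo⟫ * ⟪u, gradient (aggregateCost J) (A.iter n ω)⟫ ∂P =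
      l * ∫ ω, ⟪u, A.iter n ω - wo⟫ ^ 2 ∂P + ∫ ω, f (A.iter n ω) ∂P := by
    rw [← integral_const_mul, ← integral_add (hXu.const_mul l) hfi]
    refine integral_congr_ae (ae_of_all _ fun ω => ?_)
    simp only [hf]
    ring
  rw [hrec, hsplit, ← h.mul_muX, ← hx]
  generalize ∫ ω, ⟪u, A.iter n ω - wo⟫ ^ 2 ∂P = p
  generalize ∫ ω, f (A.iter n ω) ∂P = e at *
  have hn : |∑ k, (1 / (N : ℝ) ^ 2 + σπ2 k) * ∫ ω, ⟪u, A.noise J n k (A.iter n) ω⟫ ^ 2 ∂P -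
      ∑ k, (1 / (N : ℝ) ^ 2 + σπ2 k) * ρ k| ≤
      (∑ k, (1 / (N : ℝ) ^ 2 + σπ2 k) * Kn k) * s := by
    rw [← Finset.sum_sub_distrib, Finset.sum_mul]
    refine (Finset.abs_sum_le_sum_abs _ _).trans (Finset.sum_le_sum fun k _ => ?_)
    have hw : 0 ≤ 1 / (N : ℝ) ^ 2 + σπ2 k :=
      add_nonneg (by positivity) (h.fusion_variance_nonneg k)
    rw [← mul_sub, abs_mul, abs_of_nonneg hw, mul_assoc]
    exact mul_le_mul_of_nonneg_left (h3 k) hw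
  have hsum : ∑ k, (1 + (N : ℝ) ^ 2 * σπ2 k) * ρ k =
      (N : ℝ) ^ 2 * ∑ k, (1 / (N : ℝ) ^ 2 + σπ2 k) * ρ k := by
    rw [Finset.mul_sum]
    refine Finset.sum_congr rfl fun k _ => ?_
    field_simp
  rw [hsum]
  generalize ∑ k, (1 / (N : ℝ) ^ 2 + σπ2 k) * ∫ ω, ⟪u, A.noise J n k (A.iter n) ω⟫ ^ 2 ∂P = V at *
  generalize ∑ k, (1 / (N : ℝ) ^ 2 + σπ2 k) * ρ k = W at *
  have hl1 : 0 ≤ 1 - 2 * (μbar / N) * l := by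
    have h5 : 2 * μbar * l ≤ N := by
      refine le_trans ?_ hμ.contraction
      have h6 : μbar ≤ x := h.le_muX
      nlinarith [mul_le_mul h6 hlδ hl.le hxpos.le]
    have h7 : 2 * (μbar / N) * l = (2 * μbar * l) / N := by ring
    rw [h7, sub_nonneg, div_le_one hN']
    exact h5
  have hq2 : q ≤ δ ^ 2 * K₁ * s := by
    refine hq1.trans ?_
    have h5 := mul_le_mul_of_nonneg_left (h1.trans (mul_le_mul_of_nonneg_left hxs hK₁0))
      (sq_nonneg δ)
    linarith
  exact abs_affine_step_sub_le hN' hμpos hxpos hν hlν hl1 h2 hq0 hq2 hn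

/-! ### Assembly of the three parts. -/

theorem abs_limsup_sub_le_of_eventually {u : ℕ → ℝ} {m e : ℝ}
    (h : ∀ᶠ n in atTop, |u n - m| ≤ e) : |limsup u atTop - m| ≤ e := by
  have h1 : ∀ᶠ n in atTop, u n ≤ m + e := h.mono fun n hn => by linarith [(abs_le.1 hn).2]
  have h2 : ∀ᶠ n in atTop, m - e ≤ u n := h.mono fun n hn => by linarith [(abs_le.1 hn).1]
  have g1 : limsup u atTop ≤ m + e :=
    limsup_le_of_le (IsBoundedUnder.isCoboundedUnder_le (isBoundedUnder_of_eventually_ge h2)) h1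
  have g2 : m - e ≤ limsup u atTop :=
    le_limsup_of_frequently_le h2.frequently (isBoundedUnder_of_eventually_le h1)
  rw [abs_le]
  constructor <;> linarith

theorem mse_eq_sum_integral_inner_sq {M N : ℕ} {Ω : Type*} [MeasurableSpace Ω] {P : Measure Ω}
    [IsProbabilityMeasure P] {A : CentralizedAlgorithm M N Ω} {wo : Vec M}
    (b : OrthonormalBasis (Fin M) ℝ (Vec M)) {n : ℕ}
    (h : MemLp (fun ω => A.iter n ω - wo) 2 P) :
    mse P A wo n = ∑ a, ∫ ω, (inner ℝ (b a) (A.iter n ω - wo)) ^ 2 ∂P := by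
  rw [AsyncCentralizedModel.mse_eq,
    ← integral_finsetSum _ fun a _ => (h.const_inner (b a)).integrable_sq]
  refine integral_congr_ae (ae_of_all _ fun ω => ?_)
  have := b.sum_sq_norm_inner_right (A.iter n ω - wo)
  simp only [Real.norm_eq_abs, sq_abs] at this
  exact this.symm

theorem lemma3 {M N : ℕ} (hN : 0 < N) (J : Fin N → Vec M → ℝ) (wo : Vec M)
    (νc δc : ℝ) (β2 σs2 σπ2 : Fin N → ℝ)
    (hβ2 : ∀ k, 0 ≤ β2 k) (hσs2 : ∀ k, 0 ≤ σs2 k)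
    (hdiff : ∀ k, TwiceDifferentiable (J k))
    (hconv : ∀ k, ConvexOn ℝ Set.univ (J k))
    (hmin : ∀ k, IsMinOn (J k) Set.univ wo)
    (hcost : CostCond (aggregateCost J) νc δc) :
    -- error recursion
    (∀ (Ω : Type u) [MeasurableSpace Ω] (P : Measure Ω) [IsProbabilityMeasure P]
      (A : CentralizedAlgorithm M N Ω) (μbar σμ2 μub : ℝ),
      AsyncCentralizedModel P A J wo β2 σs2 σπ2 μbar σμ2 μub →
      muX μbar σμ2 / N < 2 * νc / (δc ^ 2 + betaC2 δc β2 σπ2) →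
      0 ≤ alphaCent νc δc β2 σπ2 μbar σμ2 ∧ alphaCent νc δc β2 σπ2 μbar σμ2 < 1 ∧
      ∀ n, MemLp (A.iter n) 2 P ∧
        mse P A wo (n + 1) ≤ alphaCent νc δc β2 σπ2 μbar σμ2 * mse P A wo n +
          sigmaS2 σs2 σπ2 * (μbar ^ 2 + σμ2) / (N : ℝ) ^ 2) ∧
    -- steady-state error of order `μ_x`
    (∃ C μ₁ : ℝ, 0 < μ₁ ∧
      ∀ (Ω : Type u) [MeasurableSpace Ω] (P : Measure Ω) [IsProbabilityMeasure P]
        (A : CentralizedAlgorithm M N Ω) (μbar σμ2 μub : ℝ),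
        AsyncCentralizedModel P A J wo β2 σs2 σπ2 μbar σμ2 μub →
        muX μbar σμ2 ≤ μ₁ →
        BddAbove (Set.range (mse P A wo)) ∧
        limsup (mse P A wo) atTop ≤ C * muX μbar σμ2) ∧
    -- mean-square deviation
    (∀ (Rs : Fin N → Matrix (Fin M) (Fin M) ℝ) (τc τ₂ κ r : ℝ) (β4 σ4 : Fin N → ℝ) (c : ℝ),
      0 ≤ τc → 0 ≤ τ₂ → 1 ≤ κ → κ ≤ 2 → 0 < r → (∀ k, 0 ≤ β4 k) → (∀ k, 0 ≤ σ4 k) →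
      HessianLipschitzAt (aggregateCost J) wo τc r →
      ∃ C μ₁ : ℝ, 0 < μ₁ ∧
        ∀ (Ω : Type u) [MeasurableSpace Ω] (P : Measure Ω) [IsProbabilityMeasure P]
          (A : CentralizedAlgorithm M N Ω) (μbar σμ2 μub : ℝ),
          AsyncCentralizedModel P A J wo β2 σs2 σπ2 μbar σμ2 μub →
          CovarianceSmooth P A J wo τ₂ κ r →
          CovarianceLimit P A J wo Rs →
          FourthMomentCond P A J wo β4 σ4 →
          μub ^ 2 ≤ c * muX μbar σμ2 →
          muX μbar σμ2 ≤ μ₁ →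
          (∀ᶠ n in atTop, |mse P A wo n - msdFormula J wo σπ2 Rs (muX μbar σμ2)|
            ≤ C * muX μbar σμ2 ^ (3 / 2 : ℝ)) ∧
          |msd P A wo - msdFormula J wo σπ2 Rs (muX μbar σμ2)|
            ≤ C * muX μbar σμ2 ^ (3 / 2 : ℝ)) := by
  have hJ : CostSystem J wo νc δc := ⟨hdiff, hconv, hmin, hcost⟩
  have hν := hcost.nu_pos
  have hδ := hcost.delta_pos
  have hN' : (0 : ℝ) < N := by positivity
  refine ⟨?_, ?_, ?_⟩
  · intro Ω _ P _ A μbar σμ2 μub h hμ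
    exact ⟨h.alphaCent_nonneg hJ hβ2, h.alphaCent_lt_one hN hJ hβ2 hμ,
      fun n => ⟨h.memLp_iter hJ n, h.mse_succ_le hJ n⟩⟩
  -- The constant times `μ_x` is the fixed point of the mean-square recursion with contraction rate
  -- `νc * μbar / N`.
  · refine ⟨sigmaS2 σs2 σπ2 / (N * νc), N * νc / (δc ^ 2 + |betaC2 δc β2 σπ2|), by positivity, ?_⟩
    intro Ω _ P _ A μbar σμ2 μub h hμ
    exact ⟨h.bddAbove_mse hN hJ hβ2 hμ, h.limsup_mse_le hN hJ hβ2 hμ⟩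
  · intro Rs τc τ₂ κ r β4 σ4 c hτc hτ₂ h1κ hκ2 hr hβ4 hσ4 hL
    choose K hK using fun a => exists_eventually_abs_integral_inner_sq_sub_le.{u} hN hJ hβ2 hσs2 Rs c
      hτc hτ₂ h1κ hκ2 hr hβ4 hσ4 hL (σπ2 := σπ2) a
    obtain ⟨μ₁, hμ₁, hsmall⟩ := SmallStep.exists_pos hN hν hδ β2 σπ2 β4 c
    refine ⟨∑ a, K a, μ₁, hμ₁, ?_⟩
    intro Ω _ P _ A μbar σμ2 μub h hS hR h4 hc hμ
    have hxpos := h.muX_pos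
    have hpow : muX μbar σμ2 ^ (3 / 2 : ℝ) = muX μbar σμ2 * Real.sqrt (muX μbar σμ2) := by
      rw [Real.sqrt_eq_rpow, show (3 / 2 : ℝ) = 1 + 1 / 2 by norm_num, Real.rpow_add hxpos,
        Real.rpow_one]
    have hev : ∀ᶠ n in atTop, |mse P A wo n - msdFormula J wo σπ2 Rs (muX μbar σμ2)|
        ≤ (∑ a, K a) * muX μbar σμ2 ^ (3 / 2 : ℝ) := by
      filter_upwards [eventually_all.2 fun a =>
        hK a Ω P A μbar σμ2 μub h hS hR h4 hc (hsmall _ hxpos.le hμ)] with n hn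
      -- The trace formula in the eigenbasis of the aggregate Hessian, matching the fixed points
      -- direction by direction.
      have hformula : msdFormula J wo σπ2 Rs (muX μbar σμ2) = ∑ a, muX μbar σμ2 / (2 * N) *
          (((isHermitian_hessian hcost wo).eigenvalues a)⁻¹ *
          ∑ k, (1 + (N : ℝ) ^ 2 * σπ2 k) *
            inner ℝ ((isHermitian_hessian hcost wo).eigenvectorBasis a)
              (Matrix.toEuclideanCLM (n := Fin M) (𝕜 := ℝ) (Rs k)
                ((isHermitian_hessian hcost wo).eigenvectorBasis a))) := by
        rw [msdFormula, ← hessian_aggregateCost hdiff,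
          (isHermitian_hessian hcost wo).trace_inv_mul
            (fun a => (hν.trans_le (hcost.eigenvalues_mem wo a).1).ne'), Finset.mul_sum]
        refine Finset.sum_congr rfl fun a _ => ?_
        simp only [map_sum, map_smul, sum_apply, smul_apply,
          inner_sum, real_inner_smul_right]
      rw [mse_eq_sum_integral_inner_sq (isHermitian_hessian hcost wo).eigenvectorBasis
        (h.memLp_iter_sub hJ n), hformula, ← Finset.sum_sub_distrib, hpow, Finset.sum_mul]
      exact (Finset.abs_sum_le_sum_abs _ _).trans (Finset.sum_le_sum fun a _ => hn a)
    exact ⟨hev, abs_limsup_sub_le_of_eventually hev⟩
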